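/- \textbf{Problem.} Given query access to two lists of integers in increasing order (duplicates allowed), $L$ of length $l'$ and $M$ of length $m'$, output an integer that occurs in both lists, or report that no such integer exists. Put $l=\max(l',m')$. An algorithm \emph{solves} the problem on a set of inputs if on each of them its output is correct with probability at least $2/3$. \textbf{Time model.} Time is counted on a word RAM with words of $w$ bits that controls a quantum memory of $w$-bit words, initially all zero. In one step it performs a classical word instruction (assignment, arithmetic modulo $2^w$, bitwise and shift operations, comparison, memory access), a test, a procedure call, or applies to the quantum memory one elementary gate: a Hadamard gate on one bit of a word, the XOR of a constant or of the result of a word instruction on two words into a further word, or a query, which XORs the list entry whose position is held in one word into another word. A block of gates may also be applied inverted, at the cost of the block plus one step. The program is fixed (independent of the lists, their lengths and $w$) and is given $l'$ and $m'$; at the end two words of the quantum memory are measured and give the output. \textbf{Theorem.} \begin{enumerate} \item There are a program and constants $\kappa, C$ such that for all lengths $l',m'$ with $l\ge 1$ and every word length $w\ge\kappa(\lfloor\log_2 l\rfloor+1)$, the program stops after at most $C\sqrt{l}$ steps and solves the problem for all increasing lists of lengths $l'$ and $m'$ whose entries are signed $w$-bit integers. So the problem is solved in time $O(\sqrt l)$.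 \item This is optimal. There is a constant $c>0$ such that, for all $l$ and all $d\ge 2l$, every bounded-error quantum query algorithm (arbitrary unitary operations $U_t$ and a work space of any finite dimension, alternating with the oracle $|x\rangle|y\rangle\mapsto|x\rangle|y+f(x) \bmod d\rangle$, where $f(x)$ is the entry at position $x$ of the two lists) that solves the problem for all pairs of strictly increasing lists of length $l$ with entries in $\{0,\dots,d-1\}$ makes at least $c\sqrt l$ queries. Likewise there is a constant $c>0$ such that every program in the above time model that, for some $l$ and some $w\ge\lfloor\log_2 l\rfloor+3$, stops and solves the problem for all pairs of strictly increasing lists of length $l$ of signed $w$-bit integers takes at least $c\sqrt l$ steps on this $l$ and $w$. \item The bound improves on $O(\sqrt l\,c^{\log^* l})$: for every constant $c>1$ one has $\sqrt l=o(\sqrt l\,c^{\log^* l})$ as $l\to\infty$, where $\log^* l$ is the number of times $\log_2$ has to be applied to $l$ until the result is at most $1$. \end{enumerate} -/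

import Mathlib

open Asymptotics Filter

/-! ## The problem -/

/-- `IsAnswer L M o` says that `o` is a right answer to the intersection problem for the lists `L`
and `M`: `some z` is right if `z` occurs in both lists, `none` (not found) is right if no integer
does. -/
def IsAnswer {l m : ℕ} (L : Fin l → ℤ) (M : Fin m → ℤ) : Option ℤ → Prop
  | none => ∀ i j, L i ≠ M j
  | some z => (∃ i, L i = z) ∧ (∃ j, M j = z)

/-- All entries of the list are representable as signed `w`-bit words. -/
def FitsIn (w : ℕ) {l : ℕ} (L : Fin l → ℤ) : Prop :=
  ∀ i, -(2 : ℤ) ^ (w - 1) ≤ L i ∧ L i < (2 : ℤ) ^ (w - 1)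

/-! ## The time model: a word RAM that controls a quantum memory of words

A word has `w` bits. The quantum memory consists of `2 ^ w` words, so its computational basis states
are the functions from addresses to contents. Every gate acts on at most three words. -/

/-- Content of a memory of `2 ^ w` words of `w` bits, a function from addresses to contents. -/
abbrev WordMem (w : ℕ) : Type := BitVec w → BitVec w

/-- A state vector of the quantum memory, given by its amplitudes. -/
abbrev QState (w : ℕ) : Type := WordMem w → ℂ

/-- The arithmetic and logical instructions of the word RAM. -/
inductive WordOp : Type
  | add | sub | mul | and | or | xor | shl | shr | eq | ult | slt

/-- Arithmetic is modulo `2 ^ w`, a comparison returns the word `1` or `0`; `ult` compares unsigned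
words, and `slt` compares words as signed (two's complement) integers. -/
def WordOp.eval {w : ℕ} : WordOp → BitVec w → BitVec w → BitVec w
  | .add, a, b => a + b
  | .sub, a, b => a - b
  | .mul, a, b => a * b
  | .and, a, b => a &&& b
  | .or, a, b => a ||| b
  | .xor, a, b => a ^^^ b
  | .shl, a, b => a <<< b
  | .shr, a, b => a >>> b
  | .eq, a, b => if a = b then 1#w else 0#w
  | .ult, a, b => if a.toNat < b.toNat then 1#w else 0#w
  | .slt, a, b => if a.toInt < b.toInt then 1#w else 0#w

/-- Elementary gates on the quantum memory. All of them are their own inverses.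
* `had a j`: Hadamard gate on bit `j` of word `a`.
* `imm v c`: XOR the constant `v` into word `c`.
* `arith o a b c`: XOR the result of `o` on words `a`, `b` into word `c`.
* `queryL a c`, `queryM a c`: XOR the entry of the list whose position is stored in word `a` into
  word `c`. -/
inductive Gate (w : ℕ) : Type
  | had (a : BitVec w) (j : ℕ)
  | imm (v c : BitVec w)
  | arith (o : WordOp) (a b c : BitVec w)
  | queryL (a c : BitVec w)
  | queryM (a c : BitVec w)

/-- The basis state that results from XORing `v` into word `c`. -/
def xorAt {w : ℕ} (x : WordMem w) (c v : BitVec w) : WordMem w :=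
  Function.update x c (x c ^^^ v)

/-- The answer to a query for position `i` of a list (positions are counted from `0`): the entry as a
signed `w`-bit word, and `0` beyond the end of the list. -/
def entryWord (w : ℕ) {l : ℕ} (L : Fin l → ℤ) (i : ℕ) : BitVec w :=
  if h : i < l then BitVec.ofInt w (L ⟨i, h⟩) else 0#w

/-- The action of a gate on state vectors. A gate whose target is also one of its sources, and a
Hadamard gate on a bit that does not exist, act as the identity. -/
noncomputable def Gate.apply {w l m : ℕ} (L : Fin l → ℤ) (M : Fin m → ℤ) :
    Gate w → QState w → QState w
  | .had a j, ψ => fun x =>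
      if j < w then
        ((if (x a).getLsbD j then -ψ x else ψ x) + ψ (xorAt x a (BitVec.twoPow w j)))
          / (Real.sqrt 2 : ℂ)
      else ψ x
  | .imm v c, ψ => fun x => ψ (xorAt x c v)
  | .arith o a b c, ψ => fun x =>
      if c = a ∨ c = b then ψ x else ψ (xorAt x c (o.eval (x a) (x b)))
  | .queryL a c, ψ => fun x =>
      if c = a then ψ x else ψ (xorAt x c (entryWord w L (x a).toNat))
  | .queryM a c, ψ => fun x =>
      if c = a then ψ x else ψ (xorAt x c (entryWord w M (x a).toNat))

/-- The state after the gates of the list have been applied one after another, from left to right,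
to the all-zero basis state. -/
noncomputable def circuitState {w l m : ℕ} (L : Fin l → ℤ) (M : Fin m → ℤ)
    (gs : List (Gate w)) : QState w :=
  gs.foldl (fun ψ g => g.apply L M ψ) (Pi.single (fun _ => 0#w) 1)

/-- The output is read off from a measurement of words `0` and `1` of the quantum memory: not found if
word `0` is zero, and otherwise the signed integer in word `1`. -/
def readOutput {w : ℕ} (x : WordMem w) : Option ℤ :=
  if x 0#w = 0#w then none else some (x 1#w).toInt

open Classical in
/-- The probability that the measured output is right. -/
noncomputable def circuitSuccess {w l m : ℕ} (L : Fin l → ℤ) (M : Fin m → ℤ)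
    (gs : List (Gate w)) : ℝ :=
  ∑ x : WordMem w, if IsAnswer L M (readOutput x) then ‖circuitState L M gs x‖ ^ 2 else 0

/-- Commands of the control language. Arguments are numbers of classical registers, except that `n` in
`const` is a literal and `p` in `call` is the number of a procedure. -/
inductive Cmd : Type
  | skip
  | const (r n : ℕ)
  | arith (o : WordOp) (r a b : ℕ)
  | load (r a : ℕ)
  | store (a r : ℕ)
  | qhad (a j : ℕ)
  | qimm (v c : ℕ)
  | qarith (o : WordOp) (a b c : ℕ)
  | qqueryL (a c : ℕ)
  | qqueryM (a c : ℕ)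
  | seq (c d : Cmd)
  | cond (r : ℕ) (c d : Cmd)
  | loop (r : ℕ) (c : Cmd)
  | call (p : ℕ)
  | adj (c : Cmd)

/-- A program is a finite list of procedures, which may call each other recursively; the one with
number `0` is the main procedure. It does not depend on the input or on the word length. -/
abbrev Program : Type := List Cmd

/-- Classical registers and classical random access memory. -/
structure Control (w : ℕ) : Type where
  reg : ℕ → BitVec w
  mem : WordMem w

/-- Assignment to a classical register. -/
def Control.set {w : ℕ} (s : Control w) (r : ℕ) (v : BitVec w) : Control w :=
  { s with reg := Function.update s.reg r v }

/-- `Exec P c s gs t s'`: started with classical data `s`, the command `c` of the program `P` stops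
after `t` steps with classical data `s'`, and has applied the gates `gs`, in this order, to the
quantum memory. Each classical instruction, each test, each call and each gate takes one step. The
command `adj c` stands for `c` with its gates applied in the reverse order, that is, for the inverse
of the unitary operation performed by `c`. -/
inductive Exec {w : ℕ} (P : Program) :
    Cmd → Control w → List (Gate w) → ℕ → Control w → Prop
  | skip (s : Control w) : Exec P .skip s [] 1 s
  | const (r n : ℕ) (s : Control w) : Exec P (.const r n) s [] 1 (s.set r (BitVec.ofNat w n))
  | arith (o : WordOp) (r a b : ℕ) (s : Control w) :
      Exec P (.arith o r a b) s [] 1 (s.set r (o.eval (s.reg a) (s.reg b)))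
  | load (r a : ℕ) (s : Control w) : Exec P (.load r a) s [] 1 (s.set r (s.mem (s.reg a)))
  | store (a r : ℕ) (s : Control w) :
      Exec P (.store a r) s [] 1 { s with mem := Function.update s.mem (s.reg a) (s.reg r) }
  | qhad (a j : ℕ) (s : Control w) :
      Exec P (.qhad a j) s [Gate.had (s.reg a) (s.reg j).toNat] 1 s
  | qimm (v c : ℕ) (s : Control w) : Exec P (.qimm v c) s [Gate.imm (s.reg v) (s.reg c)] 1 s
  | qarith (o : WordOp) (a b c : ℕ) (s : Control w) :
      Exec P (.qarith o a b c) s [Gate.arith o (s.reg a) (s.reg b) (s.reg c)] 1 s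
  | qqueryL (a c : ℕ) (s : Control w) :
      Exec P (.qqueryL a c) s [Gate.queryL (s.reg a) (s.reg c)] 1 s
  | qqueryM (a c : ℕ) (s : Control w) :
      Exec P (.qqueryM a c) s [Gate.queryM (s.reg a) (s.reg c)] 1 s
  | seq {c d : Cmd} {s s' s'' : Control w} {gs hs : List (Gate w)} {t u : ℕ} :
      Exec P c s gs t s' → Exec P d s' hs u s'' → Exec P (.seq c d) s (gs ++ hs) (t + u) s''
  | cond_true {r : ℕ} {c d : Cmd} {s s' : Control w} {gs : List (Gate w)} {t : ℕ} :
      s.reg r ≠ 0#w → Exec P c s gs t s' → Exec P (.cond r c d) s gs (t + 1) s'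
  | cond_false {r : ℕ} {c d : Cmd} {s s' : Control w} {gs : List (Gate w)} {t : ℕ} :
      s.reg r = 0#w → Exec P d s gs t s' → Exec P (.cond r c d) s gs (t + 1) s'
  | loop_stop {r : ℕ} {c : Cmd} {s : Control w} :
      s.reg r = 0#w → Exec P (.loop r c) s [] 1 s
  | loop_step {r : ℕ} {c : Cmd} {s s' s'' : Control w} {gs hs : List (Gate w)} {t u : ℕ} :
      s.reg r ≠ 0#w → Exec P c s gs t s' → Exec P (.loop r c) s' hs u s'' →
      Exec P (.loop r c) s (gs ++ hs) (t + u + 1) s''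
  | call {p : ℕ} {s s' : Control w} {gs : List (Gate w)} {t : ℕ} :
      Exec P (P.getD p .skip) s gs t s' → Exec P (.call p) s gs (t + 1) s'
  | adj {c : Cmd} {s s' : Control w} {gs : List (Gate w)} {t : ℕ} :
      Exec P c s gs t s' → Exec P (.adj c) s gs.reverse (t + 1) s'

/-- Initially the lengths of the two lists are in registers `0` and `1`, and all else is zero. -/
def Control.start (w l m : ℕ) : Control w where
  reg r := if r = 0 then BitVec.ofNat w l else if r = 1 then BitVec.ofNat w m else 0#w
  mem _ := 0#w

/-- With word length `w`, on lists of lengths `l` and `m`, the program `P` stops after `t` steps and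
has then applied the gates `gs`. -/
def Program.RunsIn (P : Program) (w l m : ℕ) (gs : List (Gate w)) (t : ℕ) : Prop :=
  ∃ s', Exec P (.call 0) (Control.start w l m) gs t s'

/-! ## The query model -/

/-- Basis states of a quantum query algorithm: a query register that holds a position in one of the
two lists, an answer register of dimension `d`, and a work register of dimension `k`. -/
abbrev QueryBasis (l m d k : ℕ) : Type := (Fin l ⊕ Fin m) × Fin d × Fin k

/-- The query operator, `|x, y, z⟩ ↦ |x, y + f x, z⟩` with addition modulo `d`, where `f` reads the
list `L` or `M` at the position `x`. -/
def queryOracle {l m d k : ℕ} (L : Fin l → Fin d) (M : Fin m → Fin d)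
    (ψ : QueryBasis l m d k → ℂ) : QueryBasis l m d k → ℂ :=
  fun b => ψ (b.1, b.2.1 - Sum.elim L M b.1, b.2.2)

/-- A quantum query algorithm for two lists of lengths `l` and `m` with entries in `{0, …, d - 1}`:
an initial state, a number of queries, for each query the arbitrary unitary operation that follows
it, and the output for each result of the final measurement. -/
structure QueryAlgorithm (l m d : ℕ) : Type where
  k : ℕ
  init : QueryBasis l m d k → ℂ
  init_norm : ∑ b, ‖init b‖ ^ 2 = 1
  queries : ℕ
  U : ℕ → Matrix.unitaryGroup (QueryBasis l m d k) ℂ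
  out : QueryBasis l m d k → Option ℤ

/-- The state after `t` queries, each followed by its unitary operation. -/
def QueryAlgorithm.state {l m d : ℕ} (A : QueryAlgorithm l m d)
    (L : Fin l → Fin d) (M : Fin m → Fin d) : ℕ → QueryBasis l m d A.k → ℂ
  | 0 => A.init
  | t + 1 => Matrix.mulVec (A.U t : Matrix _ _ ℂ) (queryOracle L M (A.state L M t))

open Classical in
/-- The probability that the output is right. -/
noncomputable def QueryAlgorithm.success {l m d : ℕ} (A : QueryAlgorithm l m d)
    (L : Fin l → Fin d) (M : Fin m → Fin d) : ℝ :=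
  ∑ b, if IsAnswer (fun i => ((L i : ℕ) : ℤ)) (fun j => ((M j : ℕ) : ℤ)) (A.out b) then
    ‖A.state L M A.queries b‖ ^ 2 else 0

/-! ## The iterated logarithm -/

/-- `log*`: how often the binary logarithm has to be applied until the result is at most `1`. -/
noncomputable def logStar (n : ℕ) : ℕ :=
  sInf {k : ℕ | (Real.logb 2)^[k] (n : ℝ) ≤ 1}

/-! Upper bound. Merge the two lists, placing an entry of L before equal entries of M. A common
integer then shows as two adjacent equal entries, its last copy in L followed by its first copy in M
(`exists_foundAt`), so it suffices to search at most l + m positions. Testing a position p requires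
`splitPos L M p`, the number of entries of L before it. Binary search from scratch would cost a
logarithmic factor in every test. Instead the positions form a 32-ary tree of blocks. On the way
from a block of length 32^(k+1) with known split to one of its parts, the split grows by less than
the length of the block, so that binary search takes only O(k + 1) steps (`run_levelC`).

Each level chooses a random part of its block and wraps one round of amplitude amplification around
the search of the level below. The round uses that search three times and multiplies a small success
probability by almost 9. Time obeys T(k+1) = 3 T(k) + O(k+1), hence T(k) = O(3^k) (`searchTime_le`).
The K lowest levels divide blocks and lose a factor 32 each; the levels from K + 1 to D only
amplify. As 9^D and 32^K are both of order l + m, the time is O(√l) and the success probability is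
at least a constant (`const_le_succProb`).

Amplification overshoots if the success probability is already large, which may happen because the
number of matches is unknown. Level k therefore suspends the reflection about the good states with
probability η = 2^-(min(k, D - k) + 4), decided by coin bits. If the reflected part overshoots, the
suspended part still succeeds with probability of order η, which exceeds what the induction requires
at that level; and since these η have a bounded sum, the losses by factors 1 - η stay bounded
(`le_amplified`, `le_succProb`).

A constant number of outer rounds raises the constant probability p to 2/3. A round searches, copies
a find into a record, undoes the search and reflects about the start state. The unrecorded failing
amplitude is multiplied by 2p - 1 in each round (`RoundState.round`), and only right answers are
ever recorded, so the error is one-sided (`circuitSuccess_mainG`). The section on programs shows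
that a fixed program emits exactly these gates within the time stated.

Lower bound. Let L be 0, 2, 4, … and M be 1, 3, 5, …, and compare this disjoint pair with the l
variants in which one entry 2j + 1 of M is lowered to 2j. A query separates variant j from the
reference run by at most twice the norm of the part of the state that asks for position j. These
squared norms sum to at most 1 over j, so by Cauchy–Schwarz T queries yield a total separation O(T
√l), whereas correctness needs a constant for each of the l variants (`hybrid_bound`). In the time
model the control never sees the lists, so all inputs share one gate sequence and the same argument
applies.

The comparison with √l c^(log* l) only needs that log* is unbounded, which follows from towers of
powers of two. -/

/-! ## The iterated logarithm tends to infinity -/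

/-- Iterated powers of two. -/
noncomputable def powTower : ℕ → ℝ
  | 0 => 1
  | k + 1 => 2 ^ powTower k

theorem powTower_pos (k : ℕ) : 0 < powTower k := by
  cases k with
  | zero => simp [powTower]
  | succ k => exact Real.rpow_pos_of_pos (by norm_num) _

theorem one_lt_iterate_logb (k : ℕ) :
    ∀ x : ℝ, powTower k < x → 1 < (Real.logb 2)^[k] x := by
  induction k with
  | zero => intro x hx; simpa [powTower] using hx
  | succ k ih =>
    intro x hx
    rw [Function.iterate_succ_apply]
    refine ih _ ?_
    have hx0 : 0 < x := (powTower_pos (k + 1)).trans hx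
    exact (Real.lt_logb_iff_rpow_lt (by norm_num) hx0).2 hx

theorem powTower_lt_succ (k : ℕ) : powTower k < powTower (k + 1) := by
  induction k with
  | zero => norm_num [powTower]
  | succ k ih => exact Real.rpow_lt_rpow_of_exponent_lt (by norm_num) ih

theorem powTower_strictMono : StrictMono powTower := strictMono_nat_of_lt_succ powTower_lt_succ

/-- `logStar` is an infimum in the natural numbers, which is 0 for the empty set, so a lower bound
for it needs the set to be nonempty. Above 2 the binary logarithm lowers its argument by at least 1,
which allows induction on an integer bound. -/
theorem exists_iterate_logb_le_one (n : ℕ) :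
    ∀ x : ℝ, x ≤ n → ∃ k, (Real.logb 2)^[k] x ≤ 1 := by
  induction n with
  | zero => intro x hx; exact ⟨0, by simpa using hx.trans (by norm_num)⟩
  | succ n ih =>
    intro x hx
    by_cases h1 : x ≤ 1
    · exact ⟨0, h1⟩
    push Not at h1
    by_cases h2 : x ≤ 2
    · refine ⟨1, ?_⟩
      simp only [Function.iterate_one]
      rw [Real.logb_le_iff_le_rpow (by norm_num) (by linarith)]
      simpa using h2
    push Not at h2
    obtain ⟨k, hk⟩ := ih (Real.logb 2 x) (by
      have hl2 : (0.6931471803 : ℝ) < Real.log 2 := Real.log_two_gt_d9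
      have h3 : Real.log x = Real.log 2 + Real.log (x / 2) := by
        rw [← Real.log_mul (by norm_num) (by linarith)]; congr 1; ring
      have h4 := Real.log_le_sub_one_of_pos (show 0 < x / 2 by linarith)
      -- From log x ≤ log 2 + x/2 - 1 the claim reduces to (x - 2)/2 ≤ (x - 2) log 2, and log 2 >
      -- 1/2.
      have : Real.logb 2 x ≤ x - 1 := by
        rw [Real.logb, div_le_iff₀ (by linarith), h3]
        nlinarith
      push_cast at hx
      linarith)
    exact ⟨k + 1, by rwa [Function.iterate_succ_apply]⟩

theorem lt_logStar {k n : ℕ} (h : powTower k < n) : k < logStar n := by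
  have hne : {k : ℕ | (Real.logb 2)^[k] (n : ℝ) ≤ 1}.Nonempty :=
    exists_iterate_logb_le_one n n le_rfl
  have hm := Nat.sInf_mem hne
  by_contra! hle
  have h1 := one_lt_iterate_logb (logStar n) n
    ((powTower_strictMono.monotone hle).trans_lt h)
  exact absurd hm (not_le.2 h1)

theorem tendsto_logStar : Tendsto logStar atTop atTop := by
  refine tendsto_atTop.2 fun k => ?_
  obtain ⟨N, hN⟩ := exists_nat_gt (powTower k)
  filter_upwards [eventually_ge_atTop N] with n hn
  exact (lt_logStar (hN.trans_le (by exact_mod_cast hn))).le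

theorem sqrt_isLittleO_sqrt_mul_pow_logStar (c : ℝ) (hc : 1 < c) :
    (fun l : ℕ => Real.sqrt l) =o[atTop] (fun l : ℕ => Real.sqrt l * c ^ logStar l) := by
  have h1 : (fun _ : ℕ => (1 : ℝ)) =o[atTop] (fun l : ℕ => c ^ logStar l) := by
    rw [isLittleO_one_left_iff]
    refine tendsto_norm_atTop_atTop.comp ?_
    exact (tendsto_pow_atTop_atTop_of_one_lt hc).comp tendsto_logStar
  simpa using (isBigO_refl (fun l : ℕ => Real.sqrt l) atTop).mul_isLittleO h1

/-! ## The hybrid argument -/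

/-- If `T` steps, each of which separates the `j`-th run from the reference run by at most `2 p t j`
with `∑ j, (p t j)²  ≤ 1`, separate every one of the `l` runs by `δ`, then `δ √l ≤ 2 T`. -/
theorem hybrid_bound {l T : ℕ} (D p : ℕ → Fin l → ℝ) (δ : ℝ)
    (h0 : ∀ j, D 0 j = 0) (hstep : ∀ t < T, ∀ j, D (t + 1) j ≤ D t j + 2 * p t j)
    (hp : ∀ t < T, ∑ j, p t j ^ 2 ≤ 1) (hT : ∀ j, δ ≤ D T j) :
    δ * Real.sqrt l ≤ 2 * T := by
  rcases Nat.eq_zero_or_pos l with rfl | hl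
  · simp
  have hsum : ∀ t ≤ T, ∑ j, D t j ≤ 2 * t * Real.sqrt l := by
    intro t
    induction t with
    | zero => intro _; simp [h0]
    | succ t ih =>
      intro ht
      have h1 : ∑ j, D (t + 1) j ≤ ∑ j, D t j + 2 * ∑ j, p t j := by
        rw [Finset.mul_sum, ← Finset.sum_add_distrib]
        exact Finset.sum_le_sum fun j _ => hstep t (by omega) j
      -- Cauchy–Schwarz: the square of the sum is at most l times the sum of squares.
      have h2 : ∑ j, p t j ≤ Real.sqrt l := by
        refine Real.le_sqrt_of_sq_le ?_
        have := sq_sum_le_card_mul_sum_sq (s := (Finset.univ : Finset (Fin l))) (f := p t)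
        simp only [Finset.card_univ, Fintype.card_fin] at this
        refine this.trans ?_
        have := hp t (by omega)
        have hl' : (0 : ℝ) ≤ l := by positivity
        nlinarith
      have := ih (by omega)
      push_cast
      linarith
  have h1 := hsum T le_rfl
  have h2 : (l : ℝ) * δ ≤ ∑ j, D T j := by
    have := Finset.card_nsmul_le_sum (Finset.univ : Finset (Fin l)) (D T) δ (fun j _ => hT j)
    simpa using this
  have hs : 0 < Real.sqrt l := Real.sqrt_pos.2 (by exact_mod_cast hl)
  have h3 : Real.sqrt l * Real.sqrt l = l := Real.mul_self_sqrt (by positivity)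
  have : Real.sqrt l * (δ * Real.sqrt l) ≤ Real.sqrt l * (2 * T) := by
    calc Real.sqrt l * (δ * Real.sqrt l) = (Real.sqrt l * Real.sqrt l) * δ := by ring
      _ = l * δ := by rw [h3]
      _ ≤ Real.sqrt l * (2 * T) := by linarith
  exact le_of_mul_le_mul_left this hs

/-- The Euclidean norm of a function on a finite type. -/
noncomputable def l2norm {X : Type*} [Fintype X] (ψ : X → ℂ) : ℝ := ‖WithLp.toLp 2 ψ‖

/-! ### Euclidean norms and distinguishability of states -/

section l2norm
variable {X : Type*} [Fintype X]

theorem l2norm_sq (ψ : X → ℂ) : l2norm ψ ^ 2 = ∑ x, ‖ψ x‖ ^ 2 := by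
  simp [l2norm, EuclideanSpace.norm_sq_eq]

theorem l2norm_nonneg (ψ : X → ℂ) : 0 ≤ l2norm ψ := norm_nonneg _

theorem l2norm_add_le (ψ φ : X → ℂ) : l2norm (ψ + φ) ≤ l2norm ψ + l2norm φ := by
  simpa [l2norm] using norm_add_le (WithLp.toLp 2 ψ) (WithLp.toLp 2 φ)

theorem l2norm_sub_le (ψ φ : X → ℂ) : l2norm (ψ - φ) ≤ l2norm ψ + l2norm φ := by
  simpa [l2norm] using norm_sub_le (WithLp.toLp 2 ψ) (WithLp.toLp 2 φ)

theorem l2norm_zero : l2norm (0 : X → ℂ) = 0 := by simp [l2norm]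

theorem l2norm_le_of_sq_le {ψ : X → ℂ} {a : ℝ} (ha : 0 ≤ a) (h : ∑ x, ‖ψ x‖ ^ 2 ≤ a ^ 2) :
    l2norm ψ ≤ a := by
  rw [← l2norm_sq] at h
  exact le_of_sq_le_sq h ha

theorem l2norm_congr_sq {Y : Type*} [Fintype Y] {ψ : X → ℂ} {φ : Y → ℂ}
    (h : ∑ x, ‖ψ x‖ ^ 2 = ∑ x, ‖φ x‖ ^ 2) : l2norm ψ = l2norm φ := by
  rw [← l2norm_sq, ← l2norm_sq] at h
  exact (sq_eq_sq₀ (l2norm_nonneg _) (l2norm_nonneg _)).1 h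

/-- Two unit vectors that are told apart by a test with error at most `1/3` are not close. -/
theorem l2norm_sub_ge_of_distinguish {S : X → Prop} [DecidablePred S] {ψ φ : X → ℂ}
    (hψ : 2 / 3 ≤ ∑ x, if S x then ‖ψ x‖ ^ 2 else 0)
    (hφ : (∑ x, if S x then ‖φ x‖ ^ 2 else 0) ≤ 1 / 3) :
    1 / 5 ≤ l2norm (φ - ψ) := by
  set ψ' : X → ℂ := fun x => if S x then ψ x else 0
  set φ' : X → ℂ := fun x => if S x then φ x else 0
  have e1 : l2norm ψ' ^ 2 = ∑ x, if S x then ‖ψ x‖ ^ 2 else 0 := by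
    rw [l2norm_sq]; refine Finset.sum_congr rfl fun x _ => ?_
    by_cases h : S x <;> simp [ψ', h]
  have e2 : l2norm φ' ^ 2 = ∑ x, if S x then ‖φ x‖ ^ 2 else 0 := by
    rw [l2norm_sq]; refine Finset.sum_congr rfl fun x _ => ?_
    by_cases h : S x <;> simp [φ', h]
  have e3 : l2norm (φ' - ψ') ≤ l2norm (φ - ψ) := by
    refine l2norm_le_of_sq_le (l2norm_nonneg _) ?_
    rw [l2norm_sq]; refine Finset.sum_le_sum fun x _ => ?_
    by_cases h : S x <;> simp [ψ', φ', h]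
  have e4 : l2norm ψ' ≤ l2norm φ' + l2norm (φ' - ψ') := by
    have := l2norm_sub_le φ' (φ' - ψ')
    simpa using this
  rw [← e1] at hψ
  rw [← e2] at hφ
  -- Decimal bounds for √(1/3) and √(2/3); their difference 0.23 exceeds 1/5.
  have h1 : l2norm φ' ≤ 0.58 := by
    refine le_of_sq_le_sq (hφ.trans ?_) (by norm_num); norm_num
  have h2 : 0.81 ≤ l2norm ψ' := by
    refine le_of_sq_le_sq (le_trans ?_ hψ) (l2norm_nonneg _); norm_num
  linarith

theorem sum_filter_compl {S : X → Prop} [DecidablePred S] (f : X → ℝ) :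
    (∑ x, if S x then f x else 0) + (∑ x, if S x then 0 else f x) = ∑ x, f x := by
  rw [← Finset.sum_add_distrib]
  exact Finset.sum_congr rfl fun x _ => by by_cases h : S x <;> simp [h]

/-- A vector moved by permutations which agree, and preserve a set, outside and inside of it. -/
theorem l2norm_comp_sub_comp_le {S : X → Prop} [DecidablePred S] (σ τ : X ≃ X) (ψ : X → ℂ)
    (hσ : ∀ x, S (σ x) ↔ S x) (hτ : ∀ x, S (τ x) ↔ S x) (h : ∀ x, ¬ S x → σ x = τ x) :
    l2norm (ψ ∘ σ - ψ ∘ τ) ≤ 2 * l2norm (fun x => if S x then ψ x else 0) := by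
  set φ : X → ℂ := fun x => if S x then ψ x else 0
  -- Outside S both permutations pick the same amplitude, so only the part φ on S matters. Its norm
  -- is paid once for each permutation, whence the factor 2.
  have e : ψ ∘ σ - ψ ∘ τ = φ ∘ σ - φ ∘ τ := by
    funext x
    by_cases hx : S x
    · simp [φ, hσ, hτ, hx]
    · simp [φ, hτ, hx, h x hx]
  have hn : ∀ ρ : X ≃ X, l2norm (φ ∘ ρ) = l2norm φ := fun ρ =>
    l2norm_congr_sq (Equiv.sum_comp ρ fun x => ‖φ x‖ ^ 2)
  rw [e]
  refine (l2norm_sub_le _ _).trans ?_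
  rw [hn, hn]; linarith

end l2norm

/-! ## Hard inputs -/

/-- The position in `{0, …, 2 l - 1}` of the entry `i` of the second list: odd, except that for the
marked `j` it is the even one that also occurs in the first list. -/
def hardIndex {l : ℕ} (o : Option (Fin l)) (i : Fin l) : ℕ :=
  if o = some i then 2 * i else 2 * i + 1

theorem hardIndex_lt {l : ℕ} (o : Option (Fin l)) (i : Fin l) : hardIndex o i < 2 * l := by
  unfold hardIndex; split <;> omega

theorem hardIndex_lt_hardIndex {l : ℕ} (o : Option (Fin l)) {i j : Fin l} (h : i < j) :
    hardIndex o i < hardIndex o j := by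
  have h' : (i : ℕ) < j := h
  unfold hardIndex; split <;> split <;> omega

theorem hardIndex_of_ne {l : ℕ} {i j : Fin l} (h : i ≠ j) :
    hardIndex (some j) i = hardIndex none i := by
  simp [hardIndex, h.symm]

theorem isAnswer_none_hard {l : ℕ} :
    IsAnswer (fun i : Fin l => ((2 * i : ℕ) : ℤ)) (fun i : Fin l => (hardIndex none i : ℤ)) none := by
  intro i j
  simp [hardIndex]
  omega

theorem not_isAnswer_none_hard {l : ℕ} (j : Fin l) :
    ¬ IsAnswer (fun i : Fin l => ((2 * i : ℕ) : ℤ)) (fun i => (hardIndex (some j) i : ℤ)) none := by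
  intro h
  exact h j j (by simp [hardIndex])

theorem isAnswer_some_hard {l : ℕ} (z : ℤ) :
    ¬ IsAnswer (fun i : Fin l => ((2 * i : ℕ) : ℤ)) (fun i : Fin l => (hardIndex none i : ℤ)) (some z) := by
  rintro ⟨⟨i, rfl⟩, ⟨j, hj⟩⟩
  simp [hardIndex] at hj
  omega

open Classical in
/-- From correctness on the hard inputs to distance of the final states. -/
theorem l2norm_sub_ge_of_success {X : Type*} [Fintype X] {l : ℕ} (out : X → Option ℤ)
    (ψ : Option (Fin l) → X → ℂ) (hn : ∀ o, ∑ x, ‖ψ o x‖ ^ 2 = 1)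
    (h : ∀ o, 2 / 3 ≤ ∑ x, if IsAnswer (fun i : Fin l => ((2 * i : ℕ) : ℤ))
      (fun i => (hardIndex o i : ℤ)) (out x) then ‖ψ o x‖ ^ 2 else 0) (j : Fin l) :
    1 / 5 ≤ l2norm (ψ (some j) - ψ none) := by
  refine l2norm_sub_ge_of_distinguish (S := fun x => out x = none) ?_ ?_
  · refine (h none).trans_eq (Finset.sum_congr rfl fun x _ => ?_)
    rcases hx : out x with _ | z
    · rw [if_pos isAnswer_none_hard, if_pos rfl]
    · rw [if_neg (isAnswer_some_hard z)]; simp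
  · have h1 := sum_filter_compl (S := fun x => out x = none) (fun x => ‖ψ (some j) x‖ ^ 2)
    have h2 : (2 : ℝ) / 3 ≤ ∑ x, if out x = none then 0 else ‖ψ (some j) x‖ ^ 2 := by
      refine (h (some j)).trans (Finset.sum_le_sum fun x _ => ?_)
      rcases hx : out x with _ | z
      · rw [if_neg (not_isAnswer_none_hard j)]; simp
      · simp only [reduceCtorEq, if_false]; split <;> simp
    rw [hn] at h1
    linarith

/-! ## The lower bound for query algorithms -/

theorem l2norm_mulVec_unitary {X : Type*} [Fintype X] [DecidableEq X]
    (U : Matrix.unitaryGroup X ℂ) (ψ : X → ℂ) :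
    l2norm (Matrix.mulVec (U : Matrix X X ℂ) ψ) = l2norm ψ := by
  have h : star (Matrix.mulVec (U : Matrix X X ℂ) ψ) ⬝ᵥ Matrix.mulVec (U : Matrix X X ℂ) ψ =
      star ψ ⬝ᵥ ψ := by
    rw [Matrix.star_mulVec, Matrix.dotProduct_mulVec, Matrix.vecMul_vecMul,
      ← Matrix.star_eq_conjTranspose, Unitary.coe_star_mul_self, Matrix.vecMul_one]
  have hs : ∀ φ : X → ℂ, star φ ⬝ᵥ φ = ((∑ x, ‖φ x‖ ^ 2 : ℝ) : ℂ) := by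
    intro φ
    simp only [dotProduct, Pi.star_apply, RCLike.star_def, Complex.ofReal_sum]
    exact Finset.sum_congr rfl fun x _ => by rw [Complex.conj_mul']; push_cast; rfl
  rw [hs, hs] at h
  exact l2norm_congr_sq (by exact_mod_cast h)

/-- The permutation of the basis states performed by the query operator. -/
def oracleEquiv {l m d : ℕ} (k : ℕ) (L : Fin l → Fin d) (M : Fin m → Fin d) :
    QueryBasis l m d k ≃ QueryBasis l m d k where
  toFun b := (b.1, b.2.1 - Sum.elim L M b.1, b.2.2)
  invFun b := (b.1, b.2.1 + Sum.elim L M b.1, b.2.2)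
  left_inv b := by
    obtain ⟨x, y, z⟩ := b
    have : NeZero d := ⟨by rintro rfl; exact y.elim0⟩
    simp
  right_inv b := by
    obtain ⟨x, y, z⟩ := b
    have : NeZero d := ⟨by rintro rfl; exact y.elim0⟩
    simp

theorem queryOracle_eq {l m d k : ℕ} (L : Fin l → Fin d) (M : Fin m → Fin d)
    (ψ : QueryBasis l m d k → ℂ) : queryOracle L M ψ = ψ ∘ oracleEquiv k L M := rfl

theorem l2norm_comp_equiv {X : Type*} [Fintype X] (σ : X ≃ X) (ψ : X → ℂ) :
    l2norm (ψ ∘ σ) = l2norm ψ :=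
  l2norm_congr_sq (Equiv.sum_comp σ fun x => ‖ψ x‖ ^ 2)

theorem QueryAlgorithm.l2norm_state {l m d : ℕ} (A : QueryAlgorithm l m d)
    (L : Fin l → Fin d) (M : Fin m → Fin d) (t : ℕ) : l2norm (A.state L M t) = 1 := by
  induction t with
  | zero =>
    have := A.init_norm
    rw [← l2norm_sq] at this
    exact (sq_eq_sq₀ (l2norm_nonneg _) (by norm_num)).1 (by rw [one_pow]; exact this)
  | succ t ih => rw [QueryAlgorithm.state, l2norm_mulVec_unitary, queryOracle_eq,
      l2norm_comp_equiv, ih]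

/-- The sets are disjoint, so each basis state is counted at most once. This is the bound on the
total query weight in the hybrid argument. -/
theorem sum_l2norm_restrict_le {X : Type*} [Fintype X] {l : ℕ} (S : Fin l → X → Prop)
    [∀ j, DecidablePred (S j)] (hS : ∀ x i j, S i x → S j x → i = j) (ψ : X → ℂ) :
    ∑ j, l2norm (fun x => if S j x then ψ x else 0) ^ 2 ≤ l2norm ψ ^ 2 := by
  simp only [l2norm_sq]
  rw [Finset.sum_comm]
  refine Finset.sum_le_sum fun x _ => ?_
  by_cases h : ∃ j, S j x
  · obtain ⟨j, hj⟩ := h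
    rw [Finset.sum_eq_single j]
    · simp [hj]
    · intro i _ hij
      have : ¬ S i x := fun hi => hij (hS x i j hi hj)
      simp [this]
    · simp
  · push Not at h
    simp [h]

/-- The reference run has M odd throughout. The oracle of variant j differs from the reference
oracle only on basis states that ask for position j of M, and the unitaries after the query preserve
distances. The constant 1/10 is half of the final separation 1/5. -/
theorem query_lower_bound (l d : ℕ) (A : QueryAlgorithm l l d) (hd : 2 * l ≤ d)
    (h : ∀ L M : Fin l → Fin d, StrictMono L → StrictMono M → 2 / 3 ≤ A.success L M) :
    1 / 10 * Real.sqrt l ≤ A.queries := by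
  let L : Fin l → Fin d := fun i => ⟨2 * i, by omega⟩
  let M : Option (Fin l) → Fin l → Fin d := fun o i =>
    ⟨hardIndex o i, (hardIndex_lt o i).trans_le hd⟩
  have hL : StrictMono L := fun a b hab => by
    have h' : (a : ℕ) < b := hab
    simp only [L, Fin.mk_lt_mk]; omega
  have hM : ∀ o, StrictMono (M o) := fun o a b hab => hardIndex_lt_hardIndex o hab
  let S : Fin l → QueryBasis l l d A.k → Prop := fun j b => b.1 = Sum.inr j
  have hS : ∀ j, DecidablePred (S j) := fun j => Classical.decPred _
  have key := hybrid_bound (l := l) (T := A.queries)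
    (fun t j => l2norm (A.state L (M (some j)) t - A.state L (M none) t))
    (fun t j => l2norm (fun x => if S j x then A.state L (M none) t x else 0)) (1 / 5)
    ?_ ?_ ?_ ?_
  · linarith
  · intro j
    simp [QueryAlgorithm.state, l2norm_zero]
  · intro t _ j
    simp only [QueryAlgorithm.state]
    rw [← Matrix.mulVec_sub, l2norm_mulVec_unitary]
    -- Hybrid splitting: carry the old difference through the variant oracle, which preserves its
    -- norm, and add the difference of the two oracles on the reference state.
    have e : queryOracle L (M (some j)) (A.state L (M (some j)) t) -
        queryOracle L (M none) (A.state L (M none) t) =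
        (A.state L (M (some j)) t - A.state L (M none) t) ∘ oracleEquiv A.k L (M (some j)) +
        (A.state L (M none) t ∘ oracleEquiv A.k L (M (some j)) -
          A.state L (M none) t ∘ oracleEquiv A.k L (M none)) := by
      rw [queryOracle_eq, queryOracle_eq]; funext x; simp
    rw [e]
    refine (l2norm_add_le _ _).trans ?_
    rw [l2norm_comp_equiv]
    refine add_le_add_right (l2norm_comp_sub_comp_le _ _ _ ?_ ?_ ?_) _
    · intro x; rfl
    · intro x; rfl
    · rintro ⟨x, y, z⟩ hx
      rcases x with x | x
      · rfl
      · have hxj : x ≠ j := fun e => hx (by simp [S, e])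
        simp [oracleEquiv, M, hardIndex_of_ne hxj]
  · intro t _
    refine (sum_l2norm_restrict_le S ?_ _).trans ?_
    · intro x i j hi hj
      exact Sum.inr_injective (hi.symm.trans hj)
    · rw [A.l2norm_state]; norm_num
  · intro j
    refine l2norm_sub_ge_of_success A.out (fun o => A.state L (M o) A.queries) ?_ ?_ j
    · intro o
      rw [← l2norm_sq, A.l2norm_state]; norm_num
    · intro o
      exact h L (M o) hL (hM o)

/-! ## Circuits as linear maps -/

theorem xorAt_same {w : ℕ} (x : WordMem w) (c v : BitVec w) : xorAt x c v c = x c ^^^ v := by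
  simp [xorAt]

theorem xorAt_ne {w : ℕ} (x : WordMem w) {a c : BitVec w} (v : BitVec w) (h : a ≠ c) :
    xorAt x c v a = x a := by
  simp [xorAt, h]

theorem xorAt_xorAt {w : ℕ} (x : WordMem w) (c v : BitVec w) : xorAt (xorAt x c v) c v = x := by
  simp [xorAt]

theorem xorAt_zero {w : ℕ} (x : WordMem w) (c : BitVec w) : xorAt x c 0#w = x := by
  simp [xorAt]

theorem xorAt_comm {w : ℕ} (x : WordMem w) {c d : BitVec w} (u v : BitVec w) (h : c ≠ d) :
    xorAt (xorAt x c u) d v = xorAt (xorAt x d v) c u := by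
  funext a
  by_cases h1 : a = c
  · subst h1; simp [xorAt, h]
  · by_cases h2 : a = d
    · subst h2; simp [xorAt, h1]
    · simp [xorAt, h1, h2]

section circuits
variable {w l m : ℕ} (L : Fin l → ℤ) (M : Fin m → ℤ)

/-- The action of a gate other than a Hadamard gate on basis states. -/
def Gate.map : Gate w → WordMem w → WordMem w
  | .had _ _, x => x
  | .imm v c, x => xorAt x c v
  | .arith o a b c, x => if c = a ∨ c = b then x else xorAt x c (o.eval (x a) (x b))
  | .queryL a c, x => if c = a then x else xorAt x c (entryWord w L (x a).toNat)
  | .queryM a c, x => if c = a then x else xorAt x c (entryWord w M (x a).toNat)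

/-- The gate permutes the basis states. -/
def Gate.IsPerm : Gate w → Prop
  | .had _ _ => False
  | _ => True

/-- The word that the gate may change. -/
def Gate.target : Gate w → BitVec w
  | .had a _ => a
  | .imm _ c => c
  | .arith _ _ _ c => c
  | .queryL _ c => c
  | .queryM _ c => c

/-- The gate neither reads nor changes word `r`. -/
def Gate.Avoids (r : BitVec w) : Gate w → Prop
  | .had a _ => a ≠ r
  | .imm _ c => c ≠ r
  | .arith _ a b c => a ≠ r ∧ b ≠ r ∧ c ≠ r
  | .queryL a c => a ≠ r ∧ c ≠ r
  | .queryM a c => a ≠ r ∧ c ≠ r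

theorem Gate.apply_of_isPerm {g : Gate w} (h : g.IsPerm) (ψ : QState w) :
    g.apply L M ψ = ψ ∘ g.map L M := by
  cases g with
  | had a j => exact h.elim
  | imm v c => rfl
  | arith o a b c => funext x; simp only [Gate.apply, Gate.map, Function.comp]; split <;> rfl
  | queryL a c => funext x; simp only [Gate.apply, Gate.map, Function.comp]; split <;> rfl
  | queryM a c => funext x; simp only [Gate.apply, Gate.map, Function.comp]; split <;> rfl

theorem Gate.map_map (g : Gate w) (x : WordMem w) : g.map L M (g.map L M x) = x := by
  cases g with
  | had a j => rfl
  | imm v c => simp [Gate.map, xorAt_xorAt]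
  | arith o a b c =>
    by_cases h : c = a ∨ c = b
    · simp [Gate.map, h]
    · have h1 : a ≠ c := fun e => h (Or.inl e.symm)
      have h2 : b ≠ c := fun e => h (Or.inr e.symm)
      simp only [Gate.map, h, if_false, xorAt_ne _ _ h1, xorAt_ne _ _ h2, xorAt_xorAt]
  | queryL a c =>
    by_cases h : c = a
    · simp [Gate.map, h]
    · simp only [Gate.map, h, if_false, xorAt_ne _ _ (Ne.symm h), xorAt_xorAt]
  | queryM a c =>
    by_cases h : c = a
    · simp [Gate.map, h]
    · simp only [Gate.map, h, if_false, xorAt_ne _ _ (Ne.symm h), xorAt_xorAt]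

/-- The permutation of the basis states performed by a gate. -/
def Gate.equiv (g : Gate w) : WordMem w ≃ WordMem w where
  toFun := g.map L M
  invFun := g.map L M
  left_inv := g.map_map L M
  right_inv := g.map_map L M

theorem Gate.map_of_ne_target (g : Gate w) (x : WordMem w) {r : BitVec w} (h : r ≠ g.target) :
    g.map L M x r = x r := by
  cases g with
  | had a j => rfl
  | imm v c => exact xorAt_ne _ _ h
  | arith o a b c => simp only [Gate.map]; split; · rfl
                     exact xorAt_ne _ _ h
  | queryL a c => simp only [Gate.map]; split; · rfl
                  exact xorAt_ne _ _ h
  | queryM a c => simp only [Gate.map]; split; · rfl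
                  exact xorAt_ne _ _ h

/-- A value XORed into an untouched word survives later gates unchanged. This lets a result be
copied out between computing and uncomputing. -/
theorem Gate.map_xorAt {g : Gate w} {r : BitVec w} (h : g.Avoids r) (x : WordMem w)
    (v : BitVec w) : g.map L M (xorAt x r v) = xorAt (g.map L M x) r v := by
  cases g with
  | had a j => rfl
  | imm u c => exact xorAt_comm _ _ _ (Ne.symm h)
  | arith o a b c =>
    simp only [Gate.map, xorAt_ne _ _ h.1, xorAt_ne _ _ h.2.1]
    split; · rfl
    exact xorAt_comm _ _ _ (Ne.symm h.2.2)
  | queryL a c =>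
    simp only [Gate.map, xorAt_ne _ _ h.1]
    split; · rfl
    exact xorAt_comm _ _ _ (Ne.symm h.2)
  | queryM a c =>
    simp only [Gate.map, xorAt_ne _ _ h.1]
    split; · rfl
    exact xorAt_comm _ _ _ (Ne.symm h.2)

/-- A gate as a linear map. -/
noncomputable def Gate.lin (g : Gate w) : QState w →ₗ[ℂ] QState w where
  toFun := g.apply L M
  map_add' ψ φ := by
    cases g <;> funext x <;> simp only [Gate.apply, Pi.add_apply] <;> split <;>
      first | rfl | (split <;> ring)
  map_smul' c ψ := by
    cases g <;> funext x <;>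
      simp only [Gate.apply, Pi.smul_apply, smul_eq_mul, RingHom.id_apply] <;> split <;>
      first | rfl | (split <;> ring)

theorem Gate.lin_of_isPerm {g : Gate w} (h : g.IsPerm) (ψ : QState w) :
    g.lin L M ψ = ψ ∘ g.map L M := g.apply_of_isPerm L M h ψ

/-- A circuit as a linear map. -/
noncomputable def circ : List (Gate w) → QState w →ₗ[ℂ] QState w
  | [] => LinearMap.id
  | g :: gs => circ gs ∘ₗ g.lin L M

@[simp] theorem circ_nil (ψ : QState w) : circ L M [] ψ = ψ := rfl

@[simp] theorem circ_cons (g : Gate w) (gs : List (Gate w)) (ψ : QState w) :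
    circ L M (g :: gs) ψ = circ L M gs (g.lin L M ψ) := rfl

theorem circ_append (gs hs : List (Gate w)) (ψ : QState w) :
    circ L M (gs ++ hs) ψ = circ L M hs (circ L M gs ψ) := by
  induction gs generalizing ψ with
  | nil => rfl
  | cons g gs ih => simp [ih]

/-- A basis state. -/
noncomputable def ket (x : WordMem w) : QState w := Pi.single x 1

theorem ket_self (x : WordMem w) : ket x x = 1 := by simp [ket]

theorem ket_ne {x y : WordMem w} (h : y ≠ x) : ket x y = 0 := by simp [ket, h]

theorem circuitState_eq (gs : List (Gate w)) :
    circuitState L M gs = circ L M gs (ket fun _ => 0#w) := by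
  unfold circuitState ket
  generalize (Pi.single (fun _ => 0#w) 1 : QState w) = ψ
  induction gs generalizing ψ with
  | nil => rfl
  | cons g gs ih => exact ih _

/-! ### Unitarity -/

/-- The inner product of state vectors. -/
noncomputable def ip {X : Type*} [Fintype X] (ψ φ : X → ℂ) : ℂ := ∑ x, star (ψ x) * φ x

/-- The squared norm of a state vector. -/
noncomputable def nsq {X : Type*} [Fintype X] (ψ : X → ℂ) : ℝ := ∑ x, ‖ψ x‖ ^ 2

theorem ip_self {X : Type*} [Fintype X] (ψ : X → ℂ) : ip ψ ψ = (nsq ψ : ℂ) := by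
  simp only [ip, nsq, Complex.ofReal_sum, RCLike.star_def]
  exact Finset.sum_congr rfl fun x _ => by rw [Complex.conj_mul']; push_cast; rfl

theorem ip_ket (x : WordMem w) (ψ : QState w) : ip (ket x) ψ = ψ x := by
  rw [ip, Finset.sum_eq_single x]
  · simp [ket_self]
  · intro y _ h; simp [ket_ne h]
  · simp

theorem sqrt_two_mul_self : (Real.sqrt 2 : ℂ) * (Real.sqrt 2 : ℂ) = 2 := by
  rw [← Complex.ofReal_mul, Real.mul_self_sqrt (by norm_num)]; norm_num

theorem getLsbD_xor_twoPow_self {w j : ℕ} (hj : j < w) (v : BitVec w) :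
    (v ^^^ BitVec.twoPow w j).getLsbD j = !v.getLsbD j := by
  simp [hj]

theorem Gate.lin_lin (g : Gate w) (ψ : QState w) : g.lin L M (g.lin L M ψ) = ψ := by
  by_cases h : g.IsPerm
  · rw [g.lin_of_isPerm L M h, g.lin_of_isPerm L M h]
    funext x; simp [Gate.map_map]
  · cases g with
    | had a j =>
      funext x
      by_cases hj : j < w
      · simp only [Gate.lin, Gate.apply, LinearMap.coe_mk, AddHom.coe_mk, hj, if_true,
          xorAt_xorAt, xorAt_same, getLsbD_xor_twoPow_self hj]
        have h2 := sqrt_two_mul_self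
        have h3 : (Real.sqrt 2 : ℂ) ≠ 0 := by
          intro h; rw [h] at h2; norm_num at h2
        cases (x a).getLsbD j <;> simp <;> field_simp <;> ring_nf <;>
          rw [← sq] at h2 <;> rw [h2]
      · simp [Gate.lin, Gate.apply, hj]
    | _ => exact absurd trivial h

/-- Gates are self-adjoint: the permutations are involutions and the Hadamard matrix is real and
symmetric. As each gate is also its own inverse, circuits are unitary and the reversed list is the
adjoint. -/
theorem Gate.ip_lin (g : Gate w) (ψ φ : QState w) :
    ip (g.lin L M ψ) φ = ip ψ (g.lin L M φ) := by
  by_cases h : g.IsPerm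
  · rw [g.lin_of_isPerm L M h, g.lin_of_isPerm L M h]
    unfold ip
    refine Fintype.sum_equiv (g.equiv L M) _ _ fun x => ?_
    simp [Gate.equiv, Gate.map_map]
  · cases g with
    | had a j =>
      by_cases hj : j < w
      · have e1 : ∀ x, star (ψ (xorAt x a (BitVec.twoPow w j))) * φ x =
            star (ψ (xorAt x a (BitVec.twoPow w j))) *
              φ (xorAt (xorAt x a (BitVec.twoPow w j)) a (BitVec.twoPow w j)) := by
          intro x; rw [xorAt_xorAt]
        -- Flipping bit j is an involution of the basis states, used as a substitution.
        have e2 : ∑ x, star (ψ (xorAt x a (BitVec.twoPow w j))) * φ x =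
            ∑ x, star (ψ x) * φ (xorAt x a (BitVec.twoPow w j)) := by
          refine Fintype.sum_equiv
            (⟨fun x => xorAt x a (BitVec.twoPow w j), fun x => xorAt x a (BitVec.twoPow w j),
              fun x => xorAt_xorAt _ _ _, fun x => xorAt_xorAt _ _ _⟩ : WordMem w ≃ WordMem w)
            _ _ fun x => ?_
          change _ = star (ψ (xorAt x a _)) * φ (xorAt (xorAt x a _) a _)
          rw [xorAt_xorAt]
        simp only [ip, Gate.lin, Gate.apply, LinearMap.coe_mk, AddHom.coe_mk, hj, if_true]
        have e3 : ∀ x, star (((if (x a).getLsbD j then -ψ x else ψ x) +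
            ψ (xorAt x a (BitVec.twoPow w j))) / (Real.sqrt 2 : ℂ)) * φ x =
            (star (ψ x) * (if (x a).getLsbD j then -φ x else φ x)) / (Real.sqrt 2 : ℂ) +
            (star (ψ (xorAt x a (BitVec.twoPow w j))) * φ x) / (Real.sqrt 2 : ℂ) := by
          intro x
          simp only [RCLike.star_def, map_div₀, map_add, Complex.conj_ofReal]
          split <;> (try simp only [map_neg]) <;> ring
        rw [Finset.sum_congr rfl fun x _ => e3 x, Finset.sum_add_distrib, ← Finset.sum_div,
          ← Finset.sum_div, e2, ← add_div, ← Finset.sum_add_distrib, Finset.sum_div]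
        exact Finset.sum_congr rfl fun x _ => by ring
      · simp only [ip, Gate.lin, Gate.apply, LinearMap.coe_mk, AddHom.coe_mk, hj, if_false]
    | _ => exact absurd trivial h

theorem circ_reverse_circ (gs : List (Gate w)) (ψ : QState w) :
    circ L M gs.reverse (circ L M gs ψ) = ψ := by
  induction gs generalizing ψ with
  | nil => rfl
  | cons g gs ih => rw [List.reverse_cons, circ_append, circ_cons L M g gs, ih, circ_cons, Gate.lin_lin]; rfl

theorem circ_circ_reverse (gs : List (Gate w)) (ψ : QState w) :
    circ L M gs (circ L M gs.reverse ψ) = ψ := by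
  simpa using circ_reverse_circ L M gs.reverse ψ

theorem ip_circ (gs : List (Gate w)) (ψ φ : QState w) :
    ip (circ L M gs ψ) φ = ip ψ (circ L M gs.reverse φ) := by
  induction gs generalizing ψ φ with
  | nil => rfl
  | cons g gs ih =>
    rw [circ_cons, ih, Gate.ip_lin, List.reverse_cons, circ_append]; rfl

theorem nsq_circ (gs : List (Gate w)) (ψ : QState w) : nsq (circ L M gs ψ) = nsq ψ := by
  have h : ip (circ L M gs ψ) (circ L M gs ψ) = ip ψ ψ := by rw [ip_circ, circ_reverse_circ]
  rw [ip_self, ip_self] at h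
  exact_mod_cast h

theorem nsq_ket (x : WordMem w) : nsq (ket x) = 1 := by
  rw [nsq, Finset.sum_eq_single x]
  · simp [ket_self]
  · intro y _ h; simp [ket_ne h]
  · simp

theorem nsq_eq_l2norm_sq {X : Type*} [Fintype X] (ψ : X → ℂ) : nsq ψ = l2norm ψ ^ 2 :=
  (l2norm_sq ψ).symm

theorem Gate.l2norm_lin (g : Gate w) (ψ : QState w) : l2norm (g.lin L M ψ) = l2norm ψ := by
  refine l2norm_congr_sq ?_
  exact nsq_circ L M [g] ψ

end circuits

/-! ## The lower bound for programs -/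

theorem Exec.length_le {w : ℕ} {P : Program} {c : Cmd} {s s' : Control w} {gs : List (Gate w)}
    {t : ℕ} (h : Exec P c s gs t s') : gs.length ≤ t := by
  induction h <;> (try simp only [List.length_nil, List.length_append, List.length_cons,
    List.length_reverse]) <;> omega

/-- The gate list is the same for all inputs, so the runs can be compared gate by gate. Only queries
to M depend on the variant; every other gate preserves the difference of the states. -/
theorem circuit_lower_bound {w l : ℕ} (gs : List (Gate w)) (hw : Nat.log 2 l + 3 ≤ w)
    (h : ∀ L M : Fin l → ℤ, StrictMono L → StrictMono M → FitsIn w L → FitsIn w M →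
      2 / 3 ≤ circuitSuccess L M gs) :
    1 / 10 * Real.sqrt l ≤ gs.length := by
  -- This is what the three extra bits of `hw` are for: the hard entries, all below 2l, fit into
  -- signed words.
  have h2 : 2 * l < 2 ^ (w - 1) := by
    have h1 := Nat.lt_pow_succ_log_self (b := 2) (by norm_num) l
    have h3 : 2 ^ (Nat.log 2 l + 2) ≤ 2 ^ (w - 1) := Nat.pow_le_pow_right (by norm_num) (by omega)
    rw [pow_succ] at h3
    omega
  have h2' : (2 * l : ℤ) < 2 ^ (w - 1) := by exact_mod_cast h2
  let L : Fin l → ℤ := fun i => ((2 * i : ℕ) : ℤ)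
  let M : Option (Fin l) → Fin l → ℤ := fun o i => (hardIndex o i : ℤ)
  have hL : StrictMono L := fun a b hab => by
    have h' : (a : ℕ) < b := hab
    simp only [L]; omega
  have hM : ∀ o, StrictMono (M o) := fun o a b hab => by
    simp only [M]; exact_mod_cast hardIndex_lt_hardIndex o hab
  have fL : FitsIn w L := fun i => by
    have := i.2
    simp only [L]; constructor <;> push_cast <;> omega
  have fM : ∀ o, FitsIn w (M o) := fun o i => by
    have := hardIndex_lt o i
    simp only [M]; constructor <;> omega
  -- The basis states on which gate t really queries position j of M. A query whose target is its
  -- own address word acts as the identity and is left out.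
  let S : ℕ → Fin l → WordMem w → Prop := fun t j x =>
    ∃ a c, gs[t]? = some (.queryM a c) ∧ c ≠ a ∧ (x a).toNat = (j : ℕ)
  have hS : ∀ t j, DecidablePred (S t j) := fun t j => Classical.decPred _
  let ψ : ℕ → Option (Fin l) → QState w := fun t o => circ L (M o) (gs.take t) (ket fun _ => 0#w)
  have hψ1 : ∀ t o, l2norm (ψ t o) = 1 := by
    intro t o
    have := nsq_circ L (M o) (gs.take t) (ket fun _ => 0#w)
    rw [nsq_ket, nsq_eq_l2norm_sq] at this
    exact (sq_eq_sq₀ (l2norm_nonneg _) (by norm_num)).1 (by rw [one_pow]; exact this)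
  have hψs : ∀ t (ht : t < gs.length) o, ψ (t + 1) o = (gs[t]).lin L (M o) (ψ t o) := by
    intro t ht o
    simp only [ψ]
    rw [List.take_add_one, List.getElem?_eq_getElem ht, circ_append]
    rfl
  have key := hybrid_bound (l := l) (T := gs.length)
    (fun t j => l2norm (ψ t (some j) - ψ t none))
    (fun t j => l2norm (fun x => if S t j x then ψ t none x else 0)) (1 / 5)
    ?_ ?_ ?_ ?_
  · linarith
  · intro j
    simp [ψ, l2norm_zero]
  · intro t ht j
    rw [hψs t ht, hψs t ht]
    have e : (gs[t]).lin L (M (some j)) (ψ t (some j)) - (gs[t]).lin L (M none) (ψ t none) =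
        (gs[t]).lin L (M (some j)) (ψ t (some j) - ψ t none) +
        ((gs[t]).lin L (M (some j)) (ψ t none) - (gs[t]).lin L (M none) (ψ t none)) := by
      rw [map_sub]; abel
    rw [e]
    refine (l2norm_add_le _ _).trans ?_
    rw [Gate.l2norm_lin]
    refine add_le_add_right ?_ _
    have hS0 : ∀ x, S t j x → ∃ a c, gs[t] = .queryM a c ∧ c ≠ a ∧ (x a).toNat = (j : ℕ) := by
      rintro x ⟨a, c, h1, h2, h3⟩
      rw [List.getElem?_eq_getElem ht, Option.some_inj] at h1
      exact ⟨a, c, h1, h2, h3⟩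
    have hS1 : ∀ x a c, gs[t] = .queryM a c → c ≠ a → (x a).toNat = (j : ℕ) → S t j x := by
      intro x a c h1 h2 h3
      exact ⟨a, c, by rw [List.getElem?_eq_getElem ht, h1], h2, h3⟩
    generalize gs[t] = g at hS0 hS1
    cases g with
    | queryM a c =>
      rw [Gate.lin_of_isPerm (g := .queryM a c) _ _ trivial,
        Gate.lin_of_isPerm (g := .queryM a c) _ _ trivial]
      have hinv : ∀ (o : Option (Fin l)) x,
          S t j ((Gate.queryM a c).equiv L (M o) x) ↔ S t j x := by
        intro o x
        have hx : ∀ a' c', Gate.queryM a c = Gate.queryM a' c' → c' ≠ a' →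
            ((Gate.queryM a c).equiv L (M o) x a') = x a' := by
          intro a' c' h1 h2
          cases h1
          exact Gate.map_of_ne_target L (M o) (.queryM a c) _ (Ne.symm h2)
        constructor
        · intro h
          obtain ⟨a', c', h1, h2, h3⟩ := hS0 _ h
          exact hS1 _ a' c' h1 h2 (by rw [← hx a' c' h1 h2]; exact h3)
        · intro h
          obtain ⟨a', c', h1, h2, h3⟩ := hS0 _ h
          exact hS1 _ a' c' h1 h2 (by rw [hx a' c' h1 h2]; exact h3)
      refine l2norm_comp_sub_comp_le ((Gate.queryM a c).equiv L (M (some j)))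
        ((Gate.queryM a c).equiv L (M none)) _ (hinv _) (hinv _) ?_
      intro x hx
      by_cases hca : c = a
      · simp [Gate.equiv, Gate.map, hca]
      · have hne : (x a).toNat ≠ j := fun e => hx (hS1 x a c rfl hca e)
        have : entryWord w (M (some j)) (x a).toNat = entryWord w (M none) (x a).toNat := by
          unfold entryWord
          split
          · rename_i hlt
            simp only [M]
            rw [hardIndex_of_ne]
            intro e
            exact hne (congrArg Fin.val e)
          · rfl
        simp [Gate.equiv, Gate.map, hca, this]
    | _ =>
      refine le_trans (le_of_eq ?_) (mul_nonneg (by norm_num) (l2norm_nonneg _))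
      convert l2norm_zero (X := WordMem w) using 2
      exact sub_eq_zero.2 rfl
  · intro t _
    refine (sum_l2norm_restrict_le (S t) ?_ _).trans ?_
    · rintro x i j ⟨a, c, h1, _, h3⟩ ⟨a', c', h1', _, h3'⟩
      rw [h1, Option.some_inj] at h1'
      cases h1'
      exact Fin.ext (h3.symm.trans h3')
    · rw [hψ1]; norm_num
  · intro j
    refine l2norm_sub_ge_of_success readOutput (fun o => ψ gs.length o) ?_ ?_ j
    · intro o
      rw [← l2norm_sq, hψ1]; norm_num
    · intro o
      have := h L (M o) hL (hM o) fL (fM o)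
      rw [circuitSuccess, circuitState_eq] at this
      simpa only [ψ, List.take_length] using this

/-! ## Blocks of gates -/

section blocks
variable {w l m : ℕ} (L : Fin l → ℤ) (M : Fin m → ℤ)

/-- The action on basis states of a circuit without Hadamard gates. -/
def run : List (Gate w) → WordMem w → WordMem w
  | [], x => x
  | g :: gs, x => run gs (g.map L M x)

@[simp] theorem run_nil (x : WordMem w) : run L M [] x = x := rfl

@[simp] theorem run_cons (g : Gate w) (gs : List (Gate w)) (x : WordMem w) :
    run L M (g :: gs) x = run L M gs (g.map L M x) := rfl

theorem run_append (gs hs : List (Gate w)) (x : WordMem w) :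
    run L M (gs ++ hs) x = run L M hs (run L M gs x) := by
  induction gs generalizing x with
  | nil => rfl
  | cons g gs ih => simp [ih]

theorem run_reverse_run (gs : List (Gate w)) (x : WordMem w) :
    run L M gs.reverse (run L M gs x) = x := by
  induction gs generalizing x with
  | nil => rfl
  | cons g gs ih =>
    rw [List.reverse_cons, run_append, run_cons L M g gs, ih, run_cons, Gate.map_map]; rfl

theorem run_xorAt {gs : List (Gate w)} {r : BitVec w} (h : ∀ g ∈ gs, g.Avoids r) (x : WordMem w)
    (v : BitVec w) : run L M gs (xorAt x r v) = xorAt (run L M gs x) r v := by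
  induction gs generalizing x with
  | nil => rfl
  | cons g gs ih =>
    rw [run_cons, Gate.map_xorAt L M (h g (by simp)), ih (fun g hg => h g (by simp [hg])), run_cons]

theorem run_of_ne_target {gs : List (Gate w)} {r : BitVec w} (h : ∀ g ∈ gs, r ≠ g.target)
    (x : WordMem w) : run L M gs x r = x r := by
  induction gs generalizing x with
  | nil => rfl
  | cons g gs ih =>
    rw [run_cons, ih (fun g hg => h g (by simp [hg])), Gate.map_of_ne_target _ _ _ _ (h g (by simp))]

/-- Amplitudes are pulled back along the inverse of the permutation of the basis states, and the
inverse is the reversed list. -/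
theorem circ_of_isPerm {gs : List (Gate w)} (h : ∀ g ∈ gs, g.IsPerm) (ψ : QState w) :
    circ L M gs ψ = ψ ∘ run L M gs.reverse := by
  induction gs generalizing ψ with
  | nil => rfl
  | cons g gs ih =>
    rw [circ_cons, ih (fun g hg => h g (by simp [hg])), Gate.lin_of_isPerm L M (h g (by simp))]
    funext x
    simp [run_append]

theorem circ_ket_of_isPerm {gs : List (Gate w)} (h : ∀ g ∈ gs, g.IsPerm) (x : WordMem w) :
    circ L M gs (ket x) = ket (run L M gs x) := by
  rw [circ_of_isPerm L M h]
  funext y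
  by_cases hy : y = run L M gs x
  · subst hy; simp [run_reverse_run, ket_self]
  · rw [ket_ne hy, Function.comp, ket_ne]
    intro e
    apply hy
    rw [← e]
    simpa using (run_reverse_run L M gs.reverse y).symm

/-! ### Locality of circuits -/

/-- The circuit acts within the words of the set `W`: it commutes with multiplication by functions
which do not depend on these words. -/
def Loc (W : Set (BitVec w)) (gs : List (Gate w)) : Prop :=
  ∀ (q ψ : QState w), (∀ x y, (∀ a, a ∉ W → x a = y a) → q x = q y) →
    circ L M gs (q * ψ) = q * circ L M gs ψ

variable {L M}

theorem Loc.nil (W : Set (BitVec w)) : Loc L M W [] := fun _ _ _ => rfl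

theorem Loc.append {W : Set (BitVec w)} {gs hs : List (Gate w)} (h1 : Loc L M W gs)
    (h2 : Loc L M W hs) : Loc L M W (gs ++ hs) := by
  intro q ψ hq
  rw [circ_append, circ_append, h1 q ψ hq, h2 q _ hq]

theorem Loc.mono {W V : Set (BitVec w)} {gs : List (Gate w)} (h : Loc L M W gs) (hWV : W ⊆ V) :
    Loc L M V gs := fun q ψ hq =>
  h q ψ fun x y hxy => hq x y fun a ha => hxy a fun hW => ha (hWV hW)

theorem Loc.reverse {W : Set (BitVec w)} {gs : List (Gate w)} (h : Loc L M W gs) :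
    Loc L M W gs.reverse := by
  intro q ψ hq
  have := h q (circ L M gs.reverse ψ) hq
  rw [circ_circ_reverse] at this
  rw [← this, circ_reverse_circ]

theorem Loc.had (a : BitVec w) (j : ℕ) : Loc L M {a} [Gate.had a j] := by
  intro q ψ hq
  funext x
  have : q (xorAt x a (BitVec.twoPow w j)) = q x := hq _ _ fun b hb => xorAt_ne _ _ hb
  simp only [circ_cons, circ_nil, Gate.lin, Gate.apply, LinearMap.coe_mk, AddHom.coe_mk,
    Pi.mul_apply, this]
  split
  · split <;> ring
  · rfl

theorem Loc.of_circ_comp {W : Set (BitVec w)} {gs : List (Gate w)} {τ : WordMem w → WordMem w}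
    (h : ∀ ψ, circ L M gs ψ = ψ ∘ τ) (hτ : ∀ x a, a ∉ W → τ x a = x a) : Loc L M W gs := by
  intro q ψ hq
  rw [h, h]
  funext x
  simp only [Function.comp, Pi.mul_apply, hq (τ x) x (hτ x)]

theorem Loc.of_diag {gs : List (Gate w)} {g : WordMem w → Prop} [DecidablePred g]
    (h : ∀ ψ, circ L M gs ψ = fun x => if g x then -ψ x else ψ x) (W : Set (BitVec w)) :
    Loc L M W gs := by
  intro q ψ _
  rw [h, h]
  funext x
  simp only [Pi.mul_apply]
  split <;> ring

-- The indicator of Q depends only on words outside W, so it commutes with the circuit. Hence facts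
-- about untouched words persist on the whole support of a superposition, which replaces tracking
-- individual basis states through Hadamard gates.
open Classical in
theorem Loc.support {W : Set (BitVec w)} {gs : List (Gate w)} (h : Loc L M W gs)
    {ψ : QState w} {Q : WordMem w → Prop} (hQ : ∀ x y, (∀ a, a ∉ W → x a = y a) → (Q x ↔ Q y))
    (hψ : ∀ y, ψ y ≠ 0 → Q y) : ∀ y, circ L M gs ψ y ≠ 0 → Q y := by
  have e : (fun y => if Q y then 1 else 0 : QState w) * ψ = ψ := by
    funext y
    by_cases hy : Q y
    · simp [hy]
    · have : ψ y = 0 := by by_contra hne; exact hy (hψ y hne)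
      simp [this]
  have := h (fun y => if Q y then 1 else 0) ψ (fun x y hxy => by simp only [hQ x y hxy])
  rw [e] at this
  intro y hy
  rw [this] at hy
  by_contra hn
  simp [hn] at hy

theorem Loc.support_ket {W : Set (BitVec w)} {gs : List (Gate w)} (h : Loc L M W gs)
    (x : WordMem w) : ∀ y, circ L M gs (ket x) y ≠ 0 → ∀ a, a ∉ W → y a = x a := by
  refine h.support (Q := fun y => ∀ a, a ∉ W → y a = x a) ?_ ?_
  · intro y z hyz
    exact forall_congr' fun a => imp_congr_right fun ha => by rw [hyz a ha]
  · intro y hy a _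
    by_cases e : y = x
    · rw [e]
    · exact absurd (ket_ne e) hy

variable (L M)

/-! ### Computing, acting and uncomputing -/

/-- Compute by `C`, XOR the words `a₁`, `a₂` of the result into the words `c₁`, `c₂`, uncompute. -/
def xorBlock (C : List (Gate w)) (a₁ c₁ a₂ c₂ : BitVec w) : List (Gate w) :=
  C ++ [.arith .or a₁ a₁ c₁, .arith .or a₂ a₂ c₂] ++ C.reverse

theorem xorBlock_isPerm {C : List (Gate w)} (hC : ∀ g ∈ C, g.IsPerm) (a₁ c₁ a₂ c₂ : BitVec w) :
    ∀ g ∈ xorBlock C a₁ c₁ a₂ c₂, g.IsPerm := by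
  intro g hg
  simp only [xorBlock, List.mem_append, List.mem_cons, List.not_mem_nil, or_false,
    List.mem_reverse] at hg
  rcases hg with (h | rfl | rfl) | h
  · exact hC g h
  · trivial
  · trivial
  · exact hC g h

theorem xorBlock_reverse (C : List (Gate w)) (a₁ c₁ a₂ c₂ : BitVec w) :
    (xorBlock C a₁ c₁ a₂ c₂).reverse = xorBlock C a₂ c₂ a₁ c₁ := by
  simp [xorBlock]

/-- The OR of a word with itself serves as a copy. Since C avoids both targets, the copies commute
past the reversed C, which then cancels C. The condition `h3` keeps the first copy from altering the
source of the second. -/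
theorem run_xorBlock {C : List (Gate w)} {a₁ c₁ a₂ c₂ : BitVec w} (h1 : a₁ ≠ c₁) (h2 : a₂ ≠ c₂)
    (h3 : a₂ ≠ c₁) (hc1 : ∀ g ∈ C, g.Avoids c₁) (hc2 : ∀ g ∈ C, g.Avoids c₂) (x : WordMem w) :
    run L M (xorBlock C a₁ c₁ a₂ c₂) x =
      xorAt (xorAt x c₁ (run L M C x a₁)) c₂ (run L M C x a₂) := by
  have hr1 : ∀ g ∈ C.reverse, g.Avoids c₁ := fun g hg => hc1 g (List.mem_reverse.1 hg)
  have hr2 : ∀ g ∈ C.reverse, g.Avoids c₂ := fun g hg => hc2 g (List.mem_reverse.1 hg)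
  rw [xorBlock, run_append, run_append, run_cons, run_cons, run_nil]
  simp only [Gate.map, Ne.symm h1, Ne.symm h2, or_self, if_false, WordOp.eval, BitVec.or_self,
    xorAt_ne _ _ h3]
  rw [run_xorAt L M hr2, run_xorAt L M hr1, run_reverse_run]

theorem Loc.xorBlock {C : List (Gate w)} (hC : ∀ g ∈ C, g.IsPerm) {a₁ c₁ a₂ c₂ : BitVec w}
    (h1 : a₁ ≠ c₁) (h2 : a₂ ≠ c₂) (h4 : a₁ ≠ c₂)
    (hc1 : ∀ g ∈ C, g.Avoids c₁) (hc2 : ∀ g ∈ C, g.Avoids c₂) {W : Set (BitVec w)}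
    (hW1 : c₁ ∈ W) (hW2 : c₂ ∈ W) : Loc L M W (xorBlock C a₁ c₁ a₂ c₂) := by
  refine Loc.of_circ_comp (circ_of_isPerm L M (xorBlock_isPerm hC _ _ _ _)) fun x a ha => ?_
  -- Reversal exchanges the two copies, so here the condition on the sources is a₁ ≠ c₂.
  rw [xorBlock_reverse, run_xorBlock L M h2 h1 h4 hc2 hc1, xorAt_ne, xorAt_ne]
  · rintro rfl; exact ha hW2
  · rintro rfl; exact ha hW1

/-- Compute by `C`, change the sign if bit `0` of word `t` of the result is set, uncompute. -/
def signBlock (C : List (Gate w)) (t : BitVec w) : List (Gate w) :=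
  C ++ [.had t 0, .imm 1#w t, .had t 0] ++ C.reverse

/-- The identity H X H = Z on bit 0. -/
theorem circ_phase (hw : 0 < w) (t : BitVec w) (ψ : QState w) :
    circ L M [.had t 0, .imm 1#w t, .had t 0] ψ =
      fun x => if (x t).getLsbD 0 then -ψ x else ψ x := by
  have h1 : BitVec.twoPow w 0 = 1#w := by simp [BitVec.twoPow]
  have h2 := sqrt_two_mul_self
  have h3 : (Real.sqrt 2 : ℂ) ≠ 0 := by
    intro h; rw [h] at h2; norm_num at h2
  have h4 : ∀ v : BitVec w, (v ^^^ 1#w).getLsbD 0 = !v.getLsbD 0 := by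
    intro v; rw [← h1, getLsbD_xor_twoPow_self hw]
  funext x
  simp only [circ_cons, circ_nil, Gate.lin, Gate.apply, LinearMap.coe_mk, AddHom.coe_mk, hw,
    if_true, h1, xorAt_xorAt, xorAt_same, h4]
  cases (x t).getLsbD 0 <;> simp <;> field_simp <;> ring_nf <;> rw [← sq] at h2 <;> rw [h2]

theorem circ_signBlock (hw : 0 < w) {C : List (Gate w)} (hC : ∀ g ∈ C, g.IsPerm) (t : BitVec w)
    (ψ : QState w) :
    circ L M (signBlock C t) ψ =
      fun x => if (run L M C x t).getLsbD 0 then -ψ x else ψ x := by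
  have hCr : ∀ g ∈ C.reverse, g.IsPerm := fun g hg => hC g (List.mem_reverse.1 hg)
  rw [signBlock, circ_append, circ_append, circ_phase L M hw, circ_of_isPerm L M hC,
    circ_of_isPerm L M hCr]
  funext x
  simp only [Function.comp, List.reverse_reverse, run_reverse_run]

/-! ### Hadamard layers -/

/-- Hadamard gates on the lowest `n` bits of word `a`. -/
def hadLayer (a : BitVec w) : ℕ → List (Gate w)
  | 0 => []
  | n + 1 => Gate.had a n :: hadLayer a n

theorem Loc.hadLayer (a : BitVec w) (n : ℕ) : Loc L M {a} (hadLayer a n) := by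
  induction n with
  | zero => exact Loc.nil _
  | succ n ih => exact (Loc.had a n).append ih

theorem had_ket (a : BitVec w) {n : ℕ} (hn : n < w) (x : WordMem w)
    (hx : (x a).getLsbD n = false) :
    (Gate.had a n).lin L M (ket x) =
      (1 / (Real.sqrt 2 : ℂ)) • (ket x + ket (xorAt x a (BitVec.twoPow w n))) := by
  have hne : xorAt x a (BitVec.twoPow w n) ≠ x := by
    intro e
    have := congrArg (fun y => (y a).getLsbD n) e
    simp only [xorAt_same, getLsbD_xor_twoPow_self hn, hx] at this
    simp at this
  funext y
  simp only [Gate.lin, Gate.apply, LinearMap.coe_mk, AddHom.coe_mk, hn, if_true, Pi.smul_apply,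
    Pi.add_apply, smul_eq_mul]
  by_cases h1 : y = x
  · subst h1
    simp [hx, ket_self, ket_ne hne, ket_ne (Ne.symm hne)]
  · by_cases h2 : y = xorAt x a (BitVec.twoPow w n)
    · subst h2
      simp [ket_self, ket_ne h1, xorAt_xorAt]
    · have h3 : xorAt y a (BitVec.twoPow w n) ≠ x := by
        intro e; apply h2; rw [← e, xorAt_xorAt]
      simp [ket_ne h1, ket_ne h2, ket_ne h3]

/-- Bit n of u is clear, so XOR with that bit is addition without carry. -/
theorem ofNat_xor_twoPow {n u : ℕ} (hu : 2 ^ (n + 1) ∣ u) :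
    BitVec.ofNat w u ^^^ BitVec.twoPow w n = BitVec.ofNat w (u + 2 ^ n) := by
  obtain ⟨k, rfl⟩ := hu
  have h : 2 ^ (n + 1) * k + 2 ^ n = (2 ^ (n + 1) * k) ^^^ 2 ^ n := by
    apply Nat.eq_of_testBit_eq
    intro i
    rw [Nat.testBit_two_pow_mul_add _ (Nat.pow_lt_pow_right (by norm_num) (Nat.lt_succ_self n)),
      Nat.testBit_xor, Nat.testBit_two_pow_mul, Nat.testBit_two_pow]
    by_cases hi : i < n + 1
    · have : ¬ n + 1 ≤ i := by omega
      simp [hi, this]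
    · have h1 : n + 1 ≤ i := by omega
      have h2 : n ≠ i := by omega
      simp [hi, h1, h2]
  rw [h]
  apply BitVec.eq_of_getLsbD_eq
  intro i hi
  simp only [BitVec.getLsbD_xor, BitVec.getLsbD_ofNat, BitVec.getLsbD_twoPow, Nat.testBit_xor,
    Nat.testBit_two_pow]
  simp [hi]
  omega

/-- The highest bit is treated first, and in one of the two branches it is set afterwards. The
induction therefore has to allow an offset u whose n low bits vanish. -/
theorem circ_hadLayer_aux (a : BitVec w) (n : ℕ) (hn : n ≤ w) :
    ∀ (x : WordMem w) (u : ℕ), 2 ^ n ∣ u → x a = BitVec.ofNat w u →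
    circ L M (hadLayer a n) (ket x) = (1 / (Real.sqrt 2 : ℂ)) ^ n •
      ∑ v ∈ Finset.range (2 ^ n), ket (Function.update x a (BitVec.ofNat w (u + v))) := by
  induction n with
  | zero => intro x u _ hx; simp [hadLayer, ← hx]
  | succ n ih =>
    intro x u hu hx
    have hb : (x a).getLsbD n = false := by
      obtain ⟨k, rfl⟩ := hu
      rw [hx, BitVec.getLsbD_ofNat, Nat.testBit_two_pow_mul]
      simp
    have hu' : 2 ^ n ∣ u := (pow_dvd_pow 2 (Nat.le_succ n)).trans hu
    have hx2 : xorAt x a (BitVec.twoPow w n) = Function.update x a (BitVec.ofNat w (u + 2 ^ n)) := by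
      rw [xorAt, hx, ofNat_xor_twoPow hu]
    rw [hadLayer, circ_cons, had_ket L M a (by omega) x hb, map_smul, map_add,
      ih (by omega) x u hu' hx, hx2,
      ih (by omega) _ (u + 2 ^ n) (hu'.add (dvd_refl _)) (by simp), ← smul_add, smul_smul,
      pow_succ', pow_succ, mul_two, Finset.sum_range_add]
    simp [add_assoc]

theorem circ_hadLayer (a : BitVec w) {n : ℕ} (hn : n ≤ w) (x : WordMem w) (hx : x a = 0#w) :
    circ L M (hadLayer a n) (ket x) = (1 / (Real.sqrt 2 : ℂ)) ^ n •
      ∑ v ∈ Finset.range (2 ^ n), ket (Function.update x a (BitVec.ofNat w v)) := by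
  simpa using circ_hadLayer_aux L M a n hn x 0 (dvd_zero _) hx

/-! ### Amplitude amplification -/

open Classical in
/-- The part of a state vector on a set of basis states. -/
noncomputable def restr (g : WordMem w → Prop) (ψ : QState w) : QState w :=
  fun x => if g x then ψ x else 0

theorem ip_restr (g : WordMem w → Prop) (ψ : QState w) :
    ip ψ (restr g ψ) = (nsq (restr g ψ) : ℂ) := by
  rw [← ip_self]
  refine Finset.sum_congr rfl fun x _ => ?_
  by_cases h : g x <;> simp [restr, h]

/-- By locality the reversed B leaves the words outside W as they are in x, and among such basis
states z singles out x. So S changes the sign of the amplitude of x alone, and this amplitude is the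
inner product of B|x⟩ with φ. -/
theorem circ_reflect {W : Set (BitVec w)} {B S : List (Gate w)}
    (hB : Loc L M W B) {x : WordMem w} {z : WordMem w → Prop} [DecidablePred z]
    (hS : ∀ ψ, circ L M S ψ = fun y => if z y then -ψ y else ψ y)
    (hz : ∀ y, (∀ a, a ∉ W → y a = x a) → (z y ↔ y = x)) {φ : QState w}
    (hφ : ∀ y, φ y ≠ 0 → ∀ a, a ∉ W → y a = x a) :
    circ L M S (circ L M B.reverse φ) =
      circ L M B.reverse φ - (2 * ip (circ L M B (ket x)) φ) • ket x := by
  have hs := hB.reverse.support (ψ := φ) (Q := fun y => ∀ a, a ∉ W → y a = x a)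
    (fun y y' h => forall_congr' fun a => imp_congr_right fun ha => by rw [h a ha]) hφ
  rw [ip_circ, ip_ket, hS]
  set θ := circ L M B.reverse φ
  funext y
  simp only [Pi.sub_apply, Pi.smul_apply, smul_eq_mul]
  by_cases hy : y = x
  · subst hy
    rw [if_pos ((hz y fun _ _ => rfl).2 rfl), ket_self]; ring
  · rw [ket_ne hy]
    by_cases h0 : θ y = 0
    · simp [h0]
    · rw [if_neg fun h => hy ((hz y (hs y h0)).1 h)]; simp

/-- One Grover round. Write ψ = B|x⟩ and let g be the weight of its good part. The first reflection
gives ψ - 2·good, whose inner product with ψ is 1 - 2g, and the second subtracts 2(1 - 2g)ψ. Up to a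
sign, good amplitudes are scaled by 3 - 4g and the others by 1 - 4g. -/
theorem circ_amplify {W : Set (BitVec w)} {B S G : List (Gate w)}
    (hB : Loc L M W B) {x : WordMem w} {z g : WordMem w → Prop} [DecidablePred z] [DecidablePred g]
    (hS : ∀ ψ, circ L M S ψ = fun y => if z y then -ψ y else ψ y)
    (hz : ∀ y, (∀ a, a ∉ W → y a = x a) → (z y ↔ y = x))
    (hG : ∀ ψ, circ L M G ψ = fun y => if g y then -ψ y else ψ y) :
    circ L M (B ++ G ++ B.reverse ++ S ++ B) (ket x) =
      -((1 - 4 * (nsq (restr g (circ L M B (ket x))) : ℂ)) • circ L M B (ket x)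
        + (2 : ℂ) • restr g (circ L M B (ket x))) := by
  set ψ := circ L M B (ket x) with hψ
  have hsupp := hB.support_ket x
  rw [← hψ] at hsupp
  have e1 : circ L M G ψ = ψ - (2 : ℂ) • restr g ψ := by
    rw [hG]; funext y
    by_cases h : g y <;> simp [restr, h]; ring
  have hs2 : ∀ y, (ψ - (2 : ℂ) • restr g ψ) y ≠ 0 → ∀ a, a ∉ W → y a = x a := by
    intro y hy
    refine hsupp y fun h0 => hy ?_
    simp [restr, h0]
  rw [circ_append, circ_append, circ_append, circ_append, ← hψ, e1,
    circ_reflect L M hB hS hz hs2, map_sub, circ_circ_reverse, map_smul, ← hψ]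
  have e2 : ip ψ (ψ - (2 : ℂ) • restr g ψ) = 1 - 2 * (nsq (restr g ψ) : ℂ) := by
    have : ip ψ (ψ - (2 : ℂ) • restr g ψ) = ip ψ ψ - 2 * ip ψ (restr g ψ) := by
      simp only [ip, Pi.sub_apply, Pi.smul_apply, smul_eq_mul, mul_sub, Finset.sum_sub_distrib,
        Finset.mul_sum]
      congr 1
      exact Finset.sum_congr rfl fun y _ => by ring
    rw [this, ip_restr, ip_self, hψ, nsq_circ, nsq_ket]; norm_num
  rw [e2]
  module

end blocks

/-! ## Merging two lists -/

section merge
variable {l m : ℕ} (L : Fin l → ℤ) (M : Fin m → ℤ)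

/-- The first `c` entries of `L` are among the first `p` entries of the merged list, in which
entries of `L` precede equal entries of `M`. -/
def Before (p c : ℕ) : Prop :=
  c = 0 ∨ c ≤ l ∧ c ≤ p ∧ ∀ (h1 : c - 1 < l) (h2 : p - c < m), L ⟨c - 1, h1⟩ ≤ M ⟨p - c, h2⟩

open Classical in
/-- The number of entries of `L` among the first `p` entries of the merged list. -/
noncomputable def splitPos (p : ℕ) : ℕ := Nat.findGreatest (Before L M p) l

variable {L M}

/-- Lowering c decreases the entry of L and increases the entry of M in the defining inequality. -/
theorem Before.of_succ (hL : Monotone L) (hM : Monotone M) {p c : ℕ} (h : Before L M p (c + 1)) :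
    Before L M p c := by
  rcases Nat.eq_zero_or_pos c with hc | hc
  · exact Or.inl hc
  rcases h with h | ⟨h1, h2, h3⟩
  · omega
  refine Or.inr ⟨by omega, by omega, fun h4 h5 => ?_⟩
  calc L ⟨c - 1, h4⟩ ≤ L ⟨c + 1 - 1, by omega⟩ := hL (by simp)
    _ ≤ M ⟨p - (c + 1), by omega⟩ := h3 _ _
    _ ≤ M ⟨p - c, h5⟩ := hM (by simp only [Fin.mk_le_mk]; omega)

theorem Before.succ_left (hM : Monotone M) {p c : ℕ} (h : Before L M p c) :
    Before L M (p + 1) c := by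
  rcases h with h | ⟨h1, h2, h3⟩
  · exact Or.inl h
  refine Or.inr ⟨h1, by omega, fun h4 h5 => ?_⟩
  exact (h3 h4 (by omega)).trans (hM (by simp only [Fin.mk_le_mk]; omega))

theorem Before.pred_pred (hL : Monotone L) {p c : ℕ} (h : Before L M (p + 1) (c + 1)) :
    Before L M p c := by
  rcases Nat.eq_zero_or_pos c with hc | hc
  · exact Or.inl hc
  rcases h with h | ⟨h1, h2, h3⟩
  · omega
  refine Or.inr ⟨by omega, by omega, fun h4 h5 => ?_⟩
  calc L ⟨c - 1, h4⟩ ≤ L ⟨c + 1 - 1, by omega⟩ := hL (by simp)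
    _ ≤ M ⟨p + 1 - (c + 1), by omega⟩ := h3 _ _
    _ = M ⟨p - c, h5⟩ := by congr 2; omega

/-- `Before` is downward closed in c, so its greatest solution is a threshold. Comparing one entry
of each list thus decides on which side of the split c lies, which is what binary search needs. -/
theorem before_iff_le_splitPos (hL : Monotone L) (hM : Monotone M) {p c : ℕ} :
    Before L M p c ↔ c ≤ splitPos L M p := by
  classical
  constructor
  · intro h
    rcases h with rfl | h
    · exact Nat.zero_le _
    · exact Nat.le_findGreatest h.1 (Or.inr h)
  · intro h
    have h0 : Before L M p (splitPos L M p) :=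
      Nat.findGreatest_spec (P := Before L M p) (Nat.zero_le l) (Or.inl rfl)
    exact Nat.decreasingInduction (motive := fun k _ => Before L M p k)
      (fun k _ hk => hk.of_succ hL hM) h0 h

theorem splitPos_le (p : ℕ) : splitPos L M p ≤ l := by
  classical
  unfold splitPos; exact Nat.findGreatest_le _

theorem splitPos_le_self (hL : Monotone L) (hM : Monotone M) (p : ℕ) : splitPos L M p ≤ p := by
  rcases (before_iff_le_splitPos hL hM).2 (le_refl (splitPos L M p)) with h | h
  · omega
  · exact h.2.1

theorem splitPos_zero (hL : Monotone L) (hM : Monotone M) : splitPos L M 0 = 0 :=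
  Nat.le_zero.1 (splitPos_le_self hL hM 0)

theorem splitPos_le_add (hL : Monotone L) (hM : Monotone M) (p q : ℕ) :
    splitPos L M p ≤ splitPos L M (p + q) := by
  induction q with
  | zero => exact le_rfl
  | succ q ih =>
    refine ih.trans ((before_iff_le_splitPos hL hM).1 ?_)
    exact Before.succ_left hM ((before_iff_le_splitPos hL hM).2 le_rfl)

/-- Each further position of the merged list adds at most one entry of L. Hence a split is known up
to the distance from a position whose split is known, and the cost of updating it depends on the
length of the block only. -/
theorem splitPos_add_le (hL : Monotone L) (hM : Monotone M) (p q : ℕ) :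
    splitPos L M (p + q) ≤ splitPos L M p + q := by
  induction q with
  | zero => exact le_rfl
  | succ q ih =>
    rcases Nat.eq_zero_or_pos (splitPos L M (p + (q + 1))) with h | h
    · omega
    · have h1 : Before L M (p + q + 1) (splitPos L M (p + (q + 1)) - 1 + 1) := by
        rw [Nat.sub_add_cancel h]; exact (before_iff_le_splitPos hL hM).2 le_rfl
      have := (before_iff_le_splitPos hL hM).1 (h1.pred_pred hL)
      omega

variable (L M)

/-- The entries next to each other at position `p` of the merged list are equal, and the first comes
from `L`, the second from `M`. -/
def FoundAt (p : ℕ) : Prop :=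
  ∃ (i : Fin l) (j : Fin m), splitPos L M p = i + 1 ∧ p = i + 1 + j ∧ L i = M j

variable {L M}

/-- Take the last occurrence i in L and the first occurrence j in M of a common value. Since ties
put L first, they are neighbours in the merged list. -/
theorem exists_foundAt (hL : Monotone L) (hM : Monotone M) (h : ∃ i j, L i = M j) :
    ∃ p < l + m, FoundAt L M p := by
  obtain ⟨i₀, j₀, h0⟩ := h
  obtain ⟨i, hi, himax⟩ := (Finset.univ.filter fun i => L i = M j₀).exists_max_image id
    ⟨i₀, by simp [h0]⟩
  obtain ⟨j, hj, hjmin⟩ := (Finset.univ.filter fun j => M j = M j₀).exists_min_image id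
    ⟨j₀, by simp⟩
  simp only [Finset.mem_filter, Finset.mem_univ, true_and, id] at hi himax hj hjmin
  have hi' := i.2
  have hj' := j.2
  refine ⟨i + 1 + j, by omega, i, j, ?_, rfl, hi.trans hj.symm⟩
  have hge : (i : ℕ) + 1 ≤ splitPos L M (i + 1 + j) := by
    refine (before_iff_le_splitPos hL hM).1 (Or.inr ⟨hi', by omega, fun h1 h2 => ?_⟩)
    have e1 : (⟨i + 1 - 1, h1⟩ : Fin l) = i := Fin.ext (by simp)
    have e2 : (⟨i + 1 + j - (i + 1), h2⟩ : Fin m) = j := Fin.ext (by simp)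
    rw [e1, e2, hi, hj]
  refine le_antisymm ?_ hge
  -- A larger split would mean L (i + 1) ≤ M (j - 1), but the left side lies above the common value
  -- and the right side below it.
  by_contra! hlt
  rcases (before_iff_le_splitPos hL hM).2 (show (i : ℕ) + 2 ≤ splitPos L M (i + 1 + j) by omega)
    with h | ⟨h1, h2, h3⟩
  · omega
  have h4 := h3 (by omega) (by omega)
  have h5 : L ⟨i + 2 - 1, by omega⟩ ≠ M j₀ := fun e => by
    have := himax _ e
    rw [Fin.le_def] at this
    simp at this
  have h6 : M ⟨i + 1 + j - (i + 2), by omega⟩ ≠ M j₀ := fun e => by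
    have := hjmin _ e
    rw [Fin.le_def] at this
    simp only at this
    omega
  have h7 : L i ≤ L ⟨i + 2 - 1, by omega⟩ := hL (by rw [Fin.le_def]; simp)
  have h8 : M ⟨i + 1 + j - (i + 2), by omega⟩ ≤ M j := hM (by rw [Fin.le_def]; simp only; omega)
  rw [hi] at h7
  rw [hj] at h8
  have := lt_of_le_of_ne h7 (Ne.symm h5)
  have := lt_of_le_of_ne h8 h6
  linarith

end merge

/-! ## The recursion for the success probability -/

/-- The success probability after a round of amplification of success probability `p`, where the
reflection about the good states is suspended with probability `η`. -/
noncomputable def amplified (η p : ℝ) : ℝ :=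
  (3 - 4 * ((1 - η) * p)) ^ 2 * ((1 - η) * p) +
    (1 - 4 * ((1 - η) * p)) ^ 2 * (p - (1 - η) * p)

theorem amplified_nonneg {η p : ℝ} (h0 : 0 ≤ η) (h1 : η ≤ 1) (hp : 0 ≤ p) : 0 ≤ amplified η p := by
  have h2 : 0 ≤ (1 - η) * p := mul_nonneg (by linarith) hp
  have h3 : 0 ≤ p - (1 - η) * p := by nlinarith
  unfold amplified; positivity

/-- Three regimes of q = (1 - η)p. Up to 1/4 the cubic (3 - 4q)²q is increasing, so the lower bound
v on p may be inserted. Between 1/4 and 1/2 the reflected part alone yields 1/4. Beyond 1/2 it may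
vanish, at q = 3/4, but the suspended part has weight ηp ≥ η/2 and is not diminished, as (1 - 4q)² ≥
1. Only a lower bound on p is ever needed. -/
theorem le_amplified {η p v u : ℝ} (h0 : 0 ≤ η) (h1 : η ≤ 1 / 2) (hv : 0 ≤ v) (hv' : v ≤ 1 / 4)
    (hp : v ≤ p) (hu1 : u ≤ (1 - η) * v * (9 - 24 * v)) (hu2 : u ≤ 1 / 4) (hu3 : u ≤ η / 2) :
    u ≤ amplified η p := by
  unfold amplified
  set q := (1 - η) * p with hq
  set v' := (1 - η) * v with hv1
  have hv'0 : 0 ≤ v' := mul_nonneg (by linarith) hv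
  have hv'v : v' ≤ v := by nlinarith
  have hqv : v' ≤ q := mul_le_mul_of_nonneg_left hp (by linarith)
  have h3 : p - q = η * p := by rw [hq]; ring
  have hp0 : 0 ≤ p := hv.trans hp
  have h4 : 0 ≤ (1 - 4 * q) ^ 2 * (p - q) := by rw [h3]; positivity
  have h5 : 0 ≤ (3 - 4 * q) ^ 2 * q := mul_nonneg (sq_nonneg _) (hv'0.trans hqv)
  by_cases hq1 : q ≤ 1 / 4
  · have h6 : v' * (9 - 24 * v) ≤ v' * (9 - 24 * v') :=
      mul_le_mul_of_nonneg_left (by linarith) hv'0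
    have h7 : (3 - 4 * q) ^ 2 * q - (3 - 4 * v') ^ 2 * v' =
        (q - v') * (3 * (1 - 2 * (q + v')) * (3 - 2 * (q + v')) + 4 * (q - v') ^ 2) := by ring
    have h8 : 0 ≤ (q - v') * (3 * (1 - 2 * (q + v')) * (3 - 2 * (q + v')) + 4 * (q - v') ^ 2) := by
      have : 0 ≤ 3 * (1 - 2 * (q + v')) * (3 - 2 * (q + v')) :=
        mul_nonneg (by linarith) (by linarith)
      have h9 := sq_nonneg (q - v')
      exact mul_nonneg (by linarith) (by linarith)
    have h9 : (3 - 4 * v') ^ 2 * v' = v' * (9 - 24 * v') + 16 * v' ^ 3 := by ring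
    have h10 : 0 ≤ 16 * v' ^ 3 := by positivity
    linarith
  · push Not at hq1
    by_cases hq2 : q ≤ 1 / 2
    · have : 1 * (1 / 4) ≤ (3 - 4 * q) ^ 2 * q := by
        refine mul_le_mul ?_ hq1.le (by norm_num) (sq_nonneg _)
        nlinarith
      linarith
    · push Not at hq2
      have hqp : q ≤ p := by nlinarith
      have : 1 * (η / 2) ≤ (1 - 4 * q) ^ 2 * (p - q) := by
        refine mul_le_mul ?_ ?_ (by linarith) (sq_nonneg _)
        · nlinarith
        · rw [h3]; nlinarith
      linarith

/-- The number of random bits of level `k`, which suspend the reflection if they are all zero. -/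
def coinBits (D k : ℕ) : ℕ := min k (D - k) + 4

/-- The number of bits of level `k` that choose a part of the block. -/
def digitBits (K k : ℕ) : ℕ := if k ≤ K then 5 else 0

open Classical in
/-- The probability that the search of level `k` in the block at position `q` succeeds. -/
noncomputable def succProb (K D : ℕ) (found : ℕ → Prop) : ℕ → ℕ → ℝ
  | 0, q => if found q then 1 else 0
  | k + 1, q => amplified ((1 / 2) ^ coinBits D (k + 1)) ((1 / 2) ^ digitBits K (k + 1) *
      ∑ d ∈ Finset.range (2 ^ digitBits K (k + 1)), succProb K D found k (q + d * 32 ^ k))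

theorem succProb_nonneg (K D : ℕ) (found : ℕ → Prop) (k q : ℕ) : 0 ≤ succProb K D found k q := by
  induction k generalizing q with
  | zero => unfold succProb; split <;> norm_num
  | succ k ih =>
    refine amplified_nonneg (by positivity) (pow_le_one₀ (by norm_num) (by norm_num)) ?_
    exact mul_nonneg (by positivity) (Finset.sum_nonneg fun d _ => ih _)

/-- Bound the power with the minimum by the sum of both powers; the two geometric series contribute
at most 1 and 2. -/
theorem sum_half_pow_min_le (D : ℕ) :
    ∑ j ∈ Finset.range D, (1 / 2 : ℝ) ^ min (j + 1) (D - (j + 1)) ≤ 3 := by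
  have hg : ∀ n, ∑ j ∈ Finset.range n, (1 / 2 : ℝ) ^ j ≤ 2 := fun n => by
    rw [geom_sum_eq (by norm_num)]
    have : (0 : ℝ) ≤ (1 / 2) ^ n := by positivity
    rw [div_le_iff_of_neg (by norm_num)]; linarith
  have h1 : ∑ j ∈ Finset.range D, (1 / 2 : ℝ) ^ min (j + 1) (D - (j + 1)) ≤
      ∑ j ∈ Finset.range D, ((1 / 2 : ℝ) * (1 / 2) ^ j + (1 / 2) ^ (D - 1 - j)) := by
    refine Finset.sum_le_sum fun j _ => ?_
    have e : D - (j + 1) = D - 1 - j := by omega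
    rw [e]
    have p1 : (0 : ℝ) ≤ (1 / 2) * (1 / 2) ^ j := by positivity
    have p2 : (0 : ℝ) ≤ (1 / 2) ^ (D - 1 - j) := by positivity
    rcases min_choice (j + 1) (D - 1 - j) with h | h <;> rw [h]
    · rw [pow_succ']; linarith
    · linarith
  refine h1.trans ?_
  rw [Finset.sum_add_distrib, ← Finset.mul_sum, Finset.sum_range_reflect (fun j => (1 / 2 : ℝ) ^ j) D]
  have := hg D
  linarith

/-- One level costs a factor 32 while digits are chosen and gains 9(1 - η)(1 - 8v/3). With η = b/16
the relative loss is at most b/12, and these losses add up to at most 1/4. The constant 1/320 makes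
every target at most 9b/320, below η/2 = b/32, so the overshooting case of `le_amplified` is
covered. -/
theorem le_succProb {K D : ℕ} (found : ℕ → Prop) (h1 : 9 ^ D ≤ 9 * 32 ^ K) :
    ∀ k ≤ D, ∀ q p₀, q ≤ p₀ → p₀ < q + 32 ^ min k K → found p₀ →
      1 / 320 * (1 - ∑ j ∈ Finset.range k, (1 / 2 : ℝ) ^ min (j + 1) (D - (j + 1)) / 12) *
        (9 ^ k / 32 ^ min k K) ≤ succProb K D found k q := by
  intro k
  induction k with
  | zero =>
    intro _ q p₀ hq hp hf
    have : p₀ = q := by simp at hp; omega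
    subst this
    simp [succProb, hf]
    norm_num
  | succ k ih =>
    intro hk q p₀ hq hp hf
    set b : ℝ := (1 / 2) ^ min (k + 1) (D - (k + 1)) with hb
    have hb0 : 0 < b := by positivity
    have hb1 : b ≤ 1 := pow_le_one₀ (by norm_num) (by norm_num)
    set s := ∑ j ∈ Finset.range k, (1 / 2 : ℝ) ^ min (j + 1) (D - (j + 1)) / 12 with hs
    have hs0 : 0 ≤ s := Finset.sum_nonneg fun j _ => by positivity
    have hs1 : s + b / 12 ≤ 1 / 4 := by
      have e : s + b / 12 = (∑ j ∈ Finset.range (k + 1),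
          (1 / 2 : ℝ) ^ min (j + 1) (D - (j + 1))) / 12 := by
        rw [Finset.sum_range_succ, add_div, Finset.sum_div]
      have h2 : ∑ j ∈ Finset.range (k + 1), (1 / 2 : ℝ) ^ min (j + 1) (D - (j + 1)) ≤ 3 :=
        (Finset.sum_le_sum_of_subset_of_nonneg (Finset.range_subset_range.2 hk)
          fun j _ _ => by positivity).trans (sum_half_pow_min_le D)
      rw [e]; linarith
    set R : ℝ := 9 ^ (k + 1) / 32 ^ min (k + 1) K with hR
    have hR0 : 0 < R := by positivity
    -- While blocks are divided, R = (9/32)^(k+1) ≤ 2^-(k+1). Later R grows by 9 per level up to a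
    -- final value of at most 9, so seen from the top it is at most 9 · 9^-(D-k-1). The two cases
    -- account for the two arguments of the minimum in `coinBits`.
    have hRb : R ≤ 9 * b := by
      by_cases hkK : k + 1 ≤ K
      · have e1 : R = (9 / 32) ^ (k + 1) := by rw [hR, min_eq_left hkK, div_pow]
        have e2 : R ≤ (1 / 2) ^ (k + 1) := by
          rw [e1]; exact pow_le_pow_left₀ (by norm_num) (by norm_num) _
        have e3 : (1 / 2 : ℝ) ^ (k + 1) ≤ b :=
          pow_le_pow_of_le_one (by norm_num) (by norm_num) (min_le_left _ _)
        linarith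
      · have hr : (9 : ℝ) ^ D / 32 ^ K ≤ 9 := by
          rw [div_le_iff₀ (by positivity)]; exact_mod_cast h1
        have e1 : R = 9 ^ D / 32 ^ K * (1 / 9) ^ (D - (k + 1)) := by
          rw [hR, min_eq_right (by omega)]
          have : (9 : ℝ) ^ D = 9 ^ (k + 1) * 9 ^ (D - (k + 1)) := by
            rw [← pow_add]; congr 1; omega
          rw [this, div_pow, one_pow]; field_simp
        have e2 : (1 / 9 : ℝ) ^ (D - (k + 1)) ≤ b :=
          (pow_le_pow_left₀ (by norm_num) (by norm_num) _).trans
            (pow_le_pow_of_le_one (by norm_num) (by norm_num) (min_le_right _ _))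
        rw [e1]
        exact mul_le_mul hr e2 (by positivity) (by norm_num)
    have hη : ((1 / 2 : ℝ) ^ coinBits D (k + 1)) = b / 16 := by
      rw [coinBits, pow_add, ← hb]; norm_num; ring
    rw [succProb, hη, Finset.sum_range_succ, ← hs, ← hb]
    set v : ℝ := 1 / 320 * (1 - s) * (R / 9) with hv
    have hv0 : 0 ≤ v := by
      refine mul_nonneg (mul_nonneg (by norm_num) (by linarith)) (by positivity)
    have hvb : v ≤ 1 / 320 * b := by
      rw [hv]
      refine mul_le_mul (by linarith) (by linarith) (by positivity) (by norm_num)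
    refine le_amplified (v := v) (by positivity) (by linarith) hv0 (by linarith) ?_ ?_ ?_ ?_
    -- Of the average over all parts only the part that contains the match p₀ is kept.
    · have key : ∀ d₀ < 2 ^ digitBits K (k + 1), q + d₀ * 32 ^ k ≤ p₀ →
          p₀ < q + d₀ * 32 ^ k + 32 ^ min k K →
          R / 9 = (1 / 2) ^ digitBits K (k + 1) * (9 ^ k / 32 ^ min k K) →
          v ≤ (1 / 2) ^ digitBits K (k + 1) *
            ∑ d ∈ Finset.range (2 ^ digitBits K (k + 1)), succProb K D found k (q + d * 32 ^ k) := by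
        intro d₀ hd h2 h3 hRd
        have h4 := ih (by omega) _ _ h2 h3 hf
        have h5 := Finset.single_le_sum
          (f := fun d => succProb K D found k (q + d * 32 ^ k))
          (fun d _ => succProb_nonneg _ _ _ _ _) (Finset.mem_range.2 hd)
        calc v = (1 / 2) ^ digitBits K (k + 1) *
              (1 / 320 * (1 - s) * (9 ^ k / 32 ^ min k K)) := by rw [hv, hRd]; ring
          _ ≤ _ := mul_le_mul_of_nonneg_left (h4.trans h5) (by positivity)
      by_cases hkK : k + 1 ≤ K
      · have hdig : digitBits K (k + 1) = 5 := by simp [digitBits, hkK]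
        have hm : min (k + 1) K = k + 1 := min_eq_left hkK
        have hm' : min k K = k := min_eq_left (by omega)
        rw [hm] at hp
        rw [hdig, hm'] at key
        have hpos : 0 < 32 ^ k := by positivity
        have h6 := Nat.div_add_mod (p₀ - q) (32 ^ k)
        have h7 := Nat.mod_lt (p₀ - q) hpos
        rw [hdig]
        refine key ((p₀ - q) / 32 ^ k) ?_ ?_ ?_ ?_
        · rw [Nat.div_lt_iff_lt_mul hpos]
          rw [pow_succ] at hp
          omega
        · rw [mul_comm]; omega
        · rw [mul_comm ((p₀ - q) / 32 ^ k)]; omega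
        · rw [hR, hm, pow_succ, pow_succ]; norm_num; field_simp
      · have hdig : digitBits K (k + 1) = 0 := by simp [digitBits, hkK]
        have hm : min (k + 1) K = K := min_eq_right (by omega)
        have hm' : min k K = K := min_eq_right (by omega)
        rw [hm] at hp
        rw [hdig, hm'] at key
        rw [hdig]
        refine key 0 (by norm_num) (by simpa using hq) (by simpa using hp) ?_
        rw [hR, hm, pow_succ]; field_simp
    · have e1 : (1 - b / 16) * v * (9 - 24 * v) =
          1 / 320 * R * ((1 - s) * ((1 - b / 16) * (1 - 8 / 3 * v))) := by rw [hv]; ring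
      have e2 : 1 / 320 * (1 - (s + b / 12)) * R = 1 / 320 * R * (1 - s - b / 12) := by ring
      rw [e1, e2]
      refine mul_le_mul_of_nonneg_left ?_ (by positivity)
      -- With v ≤ b/320 the two losses are b/16 and b/120, together less than b/13.
      have e3 : 1 - b / 13 ≤ (1 - b / 16) * (1 - 8 / 3 * v) := by
        have : 0 ≤ b / 16 * (8 / 3 * v) := by positivity
        nlinarith
      have e4 : (1 - s) * (1 - b / 13) ≤ (1 - s) * ((1 - b / 16) * (1 - 8 / 3 * v)) :=
        mul_le_mul_of_nonneg_left e3 (by linarith)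
      have e5 : 0 ≤ s * b := by positivity
      nlinarith
    · have : 1 / 320 * (1 - (s + b / 12)) * R ≤ 1 / 320 * (9 * b) :=
        mul_le_mul (by linarith) hRb hR0.le (by norm_num)
      linarith
    · have : 1 / 320 * (1 - (s + b / 12)) * R ≤ 1 / 320 * (9 * b) :=
        mul_le_mul (by linarith) hRb hR0.le (by norm_num)
      linarith

/-- At the top level the block covers all positions and 9^D/32^K is at least 1/32. The bound 2^-14
is a round number below 1/320 · 3/4 · 1/32. -/
theorem const_le_succProb {K D : ℕ} (found : ℕ → Prop) (hKD : K ≤ D) (h1 : 9 ^ D ≤ 9 * 32 ^ K)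
    (h2 : 32 ^ K ≤ 32 * 9 ^ D) {p₀ : ℕ} (hp : p₀ < 32 ^ K) (hf : found p₀) :
    1 / 16384 ≤ succProb K D found D 0 := by
  refine le_trans ?_ (le_succProb found h1 D le_rfl 0 p₀ (Nat.zero_le _)
    (by rwa [min_eq_right hKD, zero_add]) hf)
  have e1 : ∑ j ∈ Finset.range D, (1 / 2 : ℝ) ^ min (j + 1) (D - (j + 1)) / 12 ≤ 1 / 4 := by
    rw [← Finset.sum_div]
    have := sum_half_pow_min_le D
    linarith
  have e2 : (1 : ℝ) / 32 ≤ 9 ^ D / 32 ^ min D K := by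
    rw [min_eq_right hKD, div_le_div_iff₀ (by norm_num) (by positivity)]
    have : (32 : ℝ) ^ K ≤ 32 * 9 ^ D := by exact_mod_cast h2
    linarith
  calc (1 : ℝ) / 16384 ≤ 1 / 320 * (1 - 1 / 4) * (1 / 32) := by norm_num
    _ ≤ _ := mul_le_mul (by linarith) e2 (by norm_num) (by linarith)

/-! ## The circuits of the algorithm -/

/-- Addresses in the quantum memory: three constants at `C`, the words of the levels from `B` on, and
the scratch words from `T` on; the number of levels is `D`, and `K` of them choose a part of a
block. -/
structure Layout : Type where
  C : ℕ
  B : ℕ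
  T : ℕ
  D : ℕ
  K : ℕ

/-- The layout fits into a memory of words of `w` bits, with lists of lengths `l`, `m`. -/
structure Layout.Fits (Y : Layout) (w l m : ℕ) : Prop where
  hC : Y.C + 3 ≤ Y.B
  hB : Y.B + 4 * Y.D + 4 ≤ Y.T
  hT : Y.T + 84 * Y.D + 40 < 2 ^ w
  hl : l + m + 2 * 32 ^ Y.D < 2 ^ w
  hD : Y.D + 5 ≤ w

section gates
variable {w : ℕ}

/-- An arithmetic gate with addresses given as numbers. -/
def gOp (o : WordOp) (a b c : ℕ) : Gate w :=
  .arith o (BitVec.ofNat w a) (BitVec.ofNat w b) (BitVec.ofNat w c)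

/-- A constant gate with numbers as arguments. -/
def gImm (v c : ℕ) : Gate w := .imm (BitVec.ofNat w v) (BitVec.ofNat w c)

/-- A query to the first list with addresses given as numbers. -/
def gL (a c : ℕ) : Gate w := .queryL (BitVec.ofNat w a) (BitVec.ofNat w c)

/-- A query to the second list with addresses given as numbers. -/
def gM (a c : ℕ) : Gate w := .queryM (BitVec.ofNat w a) (BitVec.ofNat w c)

variable (Y : Layout)

/-- Computes whether the position in the words of level `0` is a match, and the common entry. -/
def leafC : List (Gate w) :=
  [gOp .sub (Y.B + 2) (Y.B + 3) (Y.T + 1), gOp .ult (Y.T + 1) (Y.C + 2) (Y.T + 2),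
    gOp .ult Y.T (Y.B + 3) (Y.T + 3), gOp .sub (Y.B + 3) Y.C (Y.T + 4),
    gL (Y.T + 4) (Y.T + 5), gM (Y.T + 1) (Y.T + 6), gOp .eq (Y.T + 5) (Y.T + 6) (Y.T + 7),
    gOp .and (Y.T + 2) (Y.T + 3) (Y.T + 8), gOp .and (Y.T + 7) (Y.T + 8) (Y.T + 9),
    gOp .sub Y.T (Y.T + 9) (Y.T + 10), gOp .and (Y.T + 5) (Y.T + 10) (Y.T + 11)]

/-- Stores the flag and the common entry computed by `leafC`. -/
def leafG : List (Gate w) :=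
  xorBlock (leafC Y) (BitVec.ofNat w (Y.T + 9)) (BitVec.ofNat w Y.B)
    (BitVec.ofNat w (Y.T + 11)) (BitVec.ofNat w (Y.B + 1))

/-- A step of binary search: adds `t` to the word at `Q`, if the result is not too large, and puts
the sum into the word at `Q + 16`. -/
def searchStep (t Q : ℕ) : List (Gate w) :=
  [gImm t (Q + 1), gOp .add Q (Q + 1) (Q + 2), gOp .ult (Y.C + 1) (Q + 2) (Q + 3),
    gOp .ult (Y.T + 2) (Q + 2) (Q + 4), gOp .sub (Y.T + 2) (Q + 2) (Q + 5),
    gOp .ult (Q + 5) (Y.C + 2) (Q + 6), gOp .sub (Q + 2) Y.C (Q + 7), gL (Q + 7) (Q + 8),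
    gM (Q + 5) (Q + 9), gOp .slt (Q + 9) (Q + 8) (Q + 10), gOp .and (Q + 6) (Q + 10) (Q + 11),
    gOp .or (Q + 3) (Q + 4) (Q + 12), gOp .or (Q + 11) (Q + 12) (Q + 13),
    gOp .sub (Q + 13) Y.C (Q + 14), gOp .and (Q + 1) (Q + 14) (Q + 15),
    gOp .add Q (Q + 15) (Q + 16)]

/-- Binary search in `n` steps. -/
def searchG : ℕ → ℕ → List (Gate w)
  | 0, _ => []
  | n + 1, Q => searchStep Y (2 ^ n) Q ++ searchG n (Q + 16)

/-- Computes the position of the part of a block of level `k` that its digit word chooses. -/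
def levelC (k : ℕ) : List (Gate w) :=
  [gImm (5 * k - 5) Y.T, gOp .shl (Y.B + 4 * k) Y.T (Y.T + 1),
    gOp .add (Y.B + 4 * k + 2) (Y.T + 1) (Y.T + 2),
    gOp .or (Y.B + 4 * k + 3) (Y.B + 4 * k + 3) (Y.T + 3)] ++ searchG Y (5 * k + 1) (Y.T + 3)

/-- Stores the position computed by `levelC` in the words of the level below. -/
def levelG (k : ℕ) : List (Gate w) :=
  xorBlock (levelC Y k) (BitVec.ofNat w (Y.T + 2)) (BitVec.ofNat w (Y.B + 4 * k - 2))
    (BitVec.ofNat w (Y.T + 3 + 16 * (5 * k + 1))) (BitVec.ofNat w (Y.B + 4 * k - 1))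

/-- Computes whether the flag and one of the coin bits of level `k` are set. -/
def signC (k : ℕ) : List (Gate w) :=
  [gOp .ult Y.T (Y.B + 4 * k + 1) (Y.T + 1), gOp .and Y.B (Y.T + 1) (Y.T + 2)]

/-- The reflection about the good states of level `k`. -/
def signG (k : ℕ) : List (Gate w) := signBlock (signC Y k) (BitVec.ofNat w (Y.T + 2))

/-- Computes the disjunction of the `n` words from address `A` on. -/
def orG : ℕ → ℕ → ℕ → List (Gate w)
  | 0, _, _ => []
  | n + 1, T, A => gOp .or T A (T + 1) :: orG n (T + 1) (A + 1)

/-- Computes whether the words of the levels up to `k` are zero. -/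
def zeroC (k : ℕ) : List (Gate w) :=
  orG (4 * k + 2) Y.T Y.B ++ [gOp .eq (Y.T + (4 * k + 2)) Y.T (Y.T + (4 * k + 2) + 1)]

/-- The reflection about the zero state of the words of the levels up to `k`. -/
def zeroG (k : ℕ) : List (Gate w) :=
  signBlock (zeroC Y k) (BitVec.ofNat w (Y.T + (4 * k + 2) + 1))

/-- The choice of a part of a block of level `k`. -/
def chooseG (k : ℕ) : List (Gate w) :=
  hadLayer (BitVec.ofNat w (Y.B + 4 * k + 1)) (coinBits Y.D k) ++
    (hadLayer (BitVec.ofNat w (Y.B + 4 * k)) (digitBits Y.K k) ++ levelG Y k)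

/-- The search of level `k`: at level `0` a test, at higher levels a round of amplitude
amplification applied to the search of a random part of the block. -/
def searchLevelG : ℕ → List (Gate w)
  | 0 => leafG Y
  | k + 1 => (chooseG Y (k + 1) ++ searchLevelG k) ++ signG Y (k + 1) ++
      (chooseG Y (k + 1) ++ searchLevelG k).reverse ++ zeroG Y (k + 1) ++
      (chooseG Y (k + 1) ++ searchLevelG k)

/-- Computes the next record from the record at `R + 2`, `R + 3` and the flag and the entry that have
been found. -/
def recordC (R : ℕ) : List (Gate w) :=
  [gOp .eq (R + 2) Y.T (Y.T + 1), gOp .sub Y.T (Y.T + 1) (Y.T + 2),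
    gOp .and (Y.B + 1) (Y.T + 2) (Y.T + 3), gOp .or (R + 2) Y.B (Y.T + 4),
    gOp .or (R + 3) (Y.T + 3) (Y.T + 5)]

/-- Stores the record computed by `recordC`. -/
def recordG (R : ℕ) : List (Gate w) :=
  xorBlock (recordC Y R) (BitVec.ofNat w (Y.T + 4)) (BitVec.ofNat w R)
    (BitVec.ofNat w (Y.T + 5)) (BitVec.ofNat w (R + 1))

/-- A round: search, record, undo the search, and reflect. -/
def roundG (R : ℕ) : List (Gate w) :=
  searchLevelG Y Y.D ++ recordG Y R ++ (searchLevelG Y Y.D).reverse ++ zeroG Y Y.D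

/-- The rounds whose records end at the words `0` and `1`. -/
def roundsG : ℕ → List (Gate w)
  | 0 => []
  | n + 1 => roundG Y (2 * n) ++ roundsG n

/-- The whole circuit. -/
def mainG (s l m : ℕ) : List (Gate w) :=
  [gImm 1 Y.C, gImm l (Y.C + 1), gImm m (Y.C + 2)] ++ roundsG Y s

end gates

/-! ## Their action on basis states -/

section semantics
variable {w l m : ℕ} {L : Fin l → ℤ} {M : Fin m → ℤ}

theorem ofNat_ne {a b : ℕ} (h : a ≠ b) (ha : a < 2 ^ w) (hb : b < 2 ^ w) :
    BitVec.ofNat w a ≠ BitVec.ofNat w b := by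
  intro e
  have := congrArg BitVec.toNat e
  simp only [BitVec.toNat_ofNat, Nat.mod_eq_of_lt ha, Nat.mod_eq_of_lt hb] at this
  exact h this

theorem map_gOp (o : WordOp) {a b c : ℕ} (x : WordMem w) (h1 : c ≠ a) (h2 : c ≠ b)
    (ha : a < 2 ^ w) (hb : b < 2 ^ w) (hc : c < 2 ^ w) :
    (gOp o a b c).map L M x =
      xorAt x (BitVec.ofNat w c) (o.eval (x (BitVec.ofNat w a)) (x (BitVec.ofNat w b))) := by
  simp [gOp, Gate.map, ofNat_ne h1 hc ha, ofNat_ne h2 hc hb]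

theorem map_gImm (v c : ℕ) (x : WordMem w) :
    (gImm v c).map L M x = xorAt x (BitVec.ofNat w c) (BitVec.ofNat w v) := rfl

theorem map_gL {a c : ℕ} (x : WordMem w) (h1 : c ≠ a) (ha : a < 2 ^ w) (hc : c < 2 ^ w) :
    (gL a c).map L M x =
      xorAt x (BitVec.ofNat w c) (entryWord w L (x (BitVec.ofNat w a)).toNat) := by
  simp [gL, Gate.map, ofNat_ne h1 hc ha]

theorem map_gM {a c : ℕ} (x : WordMem w) (h1 : c ≠ a) (ha : a < 2 ^ w) (hc : c < 2 ^ w) :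
    (gM a c).map L M x =
      xorAt x (BitVec.ofNat w c) (entryWord w M (x (BitVec.ofNat w a)).toNat) := by
  simp [gM, Gate.map, ofNat_ne h1 hc ha]

theorem xorAt_ofNat_ne {a c : ℕ} (x : WordMem w) (v : BitVec w) (h : a ≠ c) (ha : a < 2 ^ w)
    (hc : c < 2 ^ w) : xorAt x (BitVec.ofNat w c) v (BitVec.ofNat w a) = x (BitVec.ofNat w a) :=
  xorAt_ne _ _ (ofNat_ne h ha hc)

theorem toInt_entryWord (hw : 0 < w) (hL : FitsIn w L) {i : ℕ} (hi : i < l) :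
    (entryWord w L i).toInt = L ⟨i, hi⟩ := by
  rw [entryWord, dif_pos hi]
  have h := hL ⟨i, hi⟩
  rw [BitVec.toInt_ofInt]
  refine Int.bmod_eq_of_le ?_ ?_
  · have : ((2 ^ w : ℕ) : ℤ) = 2 * 2 ^ (w - 1) := by
      rw [← pow_succ', Nat.sub_add_cancel hw]; push_cast; rfl
    rw [this]; omega
  · have : ((2 ^ w : ℕ) : ℤ) = 2 * 2 ^ (w - 1) := by
      rw [← pow_succ', Nat.sub_add_cancel hw]; push_cast; rfl
    rw [this]; omega

variable {Y : Layout}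

/-- The constants are in place, and the scratch words are zero. -/
structure Ready (l m : ℕ) (Y : Layout) (x : WordMem w) : Prop where
  one : x (BitVec.ofNat w Y.C) = BitVec.ofNat w 1
  len₁ : x (BitVec.ofNat w (Y.C + 1)) = BitVec.ofNat w l
  len₂ : x (BitVec.ofNat w (Y.C + 2)) = BitVec.ofNat w m
  scratch : ∀ n, Y.T ≤ n → n < 2 ^ w → x (BitVec.ofNat w n) = 0#w

theorem ofNat_sub_ofNat' {a b : ℕ} (h : b ≤ a) :
    BitVec.ofNat w a - BitVec.ofNat w b = BitVec.ofNat w (a - b) := by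
  have : BitVec.ofNat w a = BitVec.ofNat w (a - b) + BitVec.ofNat w b := by
    rw [← BitVec.ofNat_add, Nat.sub_add_cancel h]
  rw [this, BitVec.add_sub_cancel]

theorem zero_sub_one_and (v : BitVec w) : v &&& (0#w - 1#w) = v := by
  have : (0#w - 1#w) = BitVec.allOnes w := by
    rw [BitVec.zero_sub, BitVec.neg_one_eq_allOnes]
  rw [this, BitVec.and_allOnes]

theorem toNat_ofNat_of_lt {a : ℕ} (h : a < 2 ^ w) : (BitVec.ofNat w a).toNat = a := by
  rw [BitVec.toNat_ofNat, Nat.mod_eq_of_lt h]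

/-- The candidates are entry split - 1 of L and entry q - split of M. Queries beyond the end of a
list return 0, so a match also requires split > 0 and q - split < m; the bound split - 1 < l holds
anyway. Subtracting the flag from 0 gives a mask of all ones or zeros, so the entry is output only
together with the flag. -/
theorem run_leafC (hY : Y.Fits w l m) (hL : Monotone L) (hM : Monotone M) (fL : FitsIn w L)
    (fM : FitsIn w M) {x : WordMem w} (hx : Ready l m Y x) {q : ℕ} (hq : q < 2 ^ w)
    (hp : x (BitVec.ofNat w (Y.B + 2)) = BitVec.ofNat w q)
    (hi : x (BitVec.ofNat w (Y.B + 3)) = BitVec.ofNat w (splitPos L M q)) :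
    (FoundAt L M q → run L M (leafC Y) x (BitVec.ofNat w (Y.T + 9)) = 1#w ∧
      IsAnswer L M (some (run L M (leafC Y) x (BitVec.ofNat w (Y.T + 11))).toInt)) ∧
    (¬ FoundAt L M q → run L M (leafC Y) x (BitVec.ofNat w (Y.T + 9)) = 0#w ∧
      run L M (leafC Y) x (BitVec.ofNat w (Y.T + 11)) = 0#w) := by
  have h1 := hY.hC
  have h2 := hY.hB
  have h3 := hY.hT
  have h4 := hY.hl
  have hw : 0 < w := by have := hY.hD; omega
  have hT := hx.scratch
  have hs := splitPos_le_self hL hM q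
  have hsl : splitPos L M q ≤ l := splitPos_le q
  simp (disch := omega) only [leafC, run_cons, run_nil, map_gOp, map_gL, map_gM, xorAt_same,
    xorAt_ofNat_ne, hT, BitVec.zero_xor, WordOp.eval, hx.one, hx.len₂, hp, hi]
  rw [ofNat_sub_ofNat' hs]
  simp (disch := omega) only [toNat_ofNat_of_lt]
  constructor
  · rintro ⟨i, j, hc, hqj, hij⟩
    have hi' := i.2
    have hj' := j.2
    have e1 : (BitVec.ofNat w (splitPos L M q) - 1#w).toNat = i := by
      rw [hc, ofNat_sub_ofNat' (by omega), toNat_ofNat_of_lt (by omega)]; rfl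
    have e2 : q - splitPos L M q = j := by omega
    have e3 : entryWord w L i = entryWord w M j := by
      rw [entryWord, entryWord, dif_pos hi', dif_pos hj', Fin.eta, Fin.eta, hij]
    rw [e1, e2, if_pos e3, if_pos hj', if_pos (by omega)]
    simp only [BitVec.and_self, zero_sub_one_and, true_and]
    rw [toInt_entryWord hw fL hi']
    exact ⟨⟨i, rfl⟩, ⟨j, hij.symm⟩⟩
  · intro hf
    have e : ((if entryWord w L (BitVec.ofNat w (splitPos L M q) - 1#w).toNat =
        entryWord w M (q - splitPos L M q) then 1#w else 0#w) &&&
        ((if q - splitPos L M q < m then 1#w else 0#w) &&&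
          if 0 < splitPos L M q then 1#w else 0#w)) = 0#w := by
      by_cases hc : 0 < splitPos L M q
      · by_cases hj : q - splitPos L M q < m
        · rw [if_neg]
          · exact BitVec.zero_and
          · intro he
            have e1 : (BitVec.ofNat w (splitPos L M q) - 1#w).toNat = splitPos L M q - 1 := by
              rw [ofNat_sub_ofNat' (by omega), toNat_ofNat_of_lt (by omega)]
            rw [e1] at he
            have hi' : splitPos L M q - 1 < l := by omega
            have := congrArg BitVec.toInt he
            rw [toInt_entryWord hw fL hi', toInt_entryWord hw fM hj] at this
            exact hf ⟨⟨_, hi'⟩, ⟨_, hj⟩, by simp only; omega, by simp only; omega, this⟩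
        · simp [hj]
      · simp [hc]
    rw [e]
    simp

/-- The word at Q + 13 is the negation of `Before` for c + t. The subtraction q - (c + t) may wrap
around, but then the test q < c + t already decides. -/
theorem run_searchStep (hY : Y.Fits w l m) (hL : Monotone L) (hM : Monotone M) (fL : FitsIn w L)
    (fM : FitsIn w M) {x : WordMem w} {q c t Q : ℕ} (hq : q < 2 ^ w) (hc : c + t < 2 ^ w)
    (ht : 0 < t) (hQ : Y.T + 3 ≤ Q) (hQ' : Q + 16 < 2 ^ w)
    (h1 : x (BitVec.ofNat w Y.C) = BitVec.ofNat w 1)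
    (h2 : x (BitVec.ofNat w (Y.C + 1)) = BitVec.ofNat w l)
    (h3 : x (BitVec.ofNat w (Y.C + 2)) = BitVec.ofNat w m)
    (hT : ∀ n, Q < n → n < 2 ^ w → x (BitVec.ofNat w n) = 0#w)
    (hp : x (BitVec.ofNat w (Y.T + 2)) = BitVec.ofNat w q)
    (hi : x (BitVec.ofNat w Q) = BitVec.ofNat w c) :
    run L M (searchStep Y t Q) x (BitVec.ofNat w (Q + 16)) =
      BitVec.ofNat w (if c + t ≤ splitPos L M q then c + t else c) := by
  have hC := hY.hC
  have hB := hY.hB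
  have hl := hY.hl
  have hw : 0 < w := by have := hY.hD; omega
  simp (disch := omega) only [searchStep, run_cons, run_nil, map_gOp, map_gL, map_gM, map_gImm,
    xorAt_same, xorAt_ofNat_ne, hT, BitVec.zero_xor, WordOp.eval, h1, h2, h3, hp, hi]
  rw [← BitVec.ofNat_add, ofNat_sub_ofNat' (show 1 ≤ c + t by omega)]
  simp (disch := omega) only [toNat_ofNat_of_lt]
  have hiff := before_iff_le_splitPos hL hM (p := q) (c := c + t)
  -- Here b - 1 is the mask that keeps t if the test passes and clears it otherwise.
  have key : ∀ b : BitVec w, b = (if c + t ≤ splitPos L M q then 0#w else 1#w) →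
      BitVec.ofNat w c + (BitVec.ofNat w t &&& b - BitVec.ofNat w 1) =
        BitVec.ofNat w (if c + t ≤ splitPos L M q then c + t else c) := by
    rintro b rfl
    split
    · rw [zero_sub_one_and, BitVec.ofNat_add]
    · simp
  refine key _ ?_
  by_cases hcl : c + t ≤ l
  · by_cases hcq : c + t ≤ q
    · rw [if_neg (show ¬ l < c + t by omega), if_neg (show ¬ q < c + t by omega),
        ofNat_sub_ofNat' hcq, toNat_ofNat_of_lt (by omega)]
      by_cases hm : q - (c + t) < m
      · rw [if_pos hm, toInt_entryWord hw fM hm, toInt_entryWord hw fL (show c + t - 1 < l by omega)]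
        have : c + t ≤ splitPos L M q ↔
            ¬ M ⟨q - (c + t), hm⟩ < L ⟨c + t - 1, by omega⟩ := by
          rw [← hiff, not_lt]
          constructor
          · rintro (h | ⟨_, _, h⟩)
            · omega
            · exact h _ _
          · exact fun h => Or.inr ⟨hcl, hcq, fun _ _ => h⟩
        by_cases hlt : M ⟨q - (c + t), hm⟩ < L ⟨c + t - 1, by omega⟩
        · rw [if_pos hlt, if_neg (fun h => this.1 h hlt)]; simp
        · rw [if_neg hlt, if_pos (this.2 hlt)]; simp
      · rw [if_neg hm, if_pos (hiff.1 (Or.inr ⟨hcl, hcq, fun _ h => absurd h hm⟩))]; simp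
    · have : ¬ c + t ≤ splitPos L M q := fun h => hcq (h.trans (splitPos_le_self hL hM q))
      rw [if_neg (show ¬ l < c + t by omega), if_pos (show q < c + t by omega), if_neg this]
      split <;> split <;> simp
  · have : ¬ c + t ≤ splitPos L M q := fun h => hcl (h.trans (splitPos_le q))
    rw [if_pos (show l < c + t by omega), if_neg this]
    split <;> split <;> split <;> simp

/-- The gates change only words with addresses from `a` to `b`. -/
def TargetsIn (a b : ℕ) (gs : List (Gate w)) : Prop :=
  ∀ g ∈ gs, ∃ n, a ≤ n ∧ n ≤ b ∧ g.target = BitVec.ofNat w n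

theorem run_eq_of_targetsIn {a b : ℕ} {gs : List (Gate w)} (h : TargetsIn a b gs)
    (hb : b < 2 ^ w) (x : WordMem w) {n : ℕ} (hn : n < 2 ^ w) (hn' : n < a ∨ b < n) :
    run L M gs x (BitVec.ofNat w n) = x (BitVec.ofNat w n) := by
  refine run_of_ne_target L M (fun g hg => ?_) x
  obtain ⟨k, h1, h2, h3⟩ := h g hg
  rw [h3]
  exact ofNat_ne (by omega) hn (by omega)

theorem targetsIn_searchStep (t Q : ℕ) :
    TargetsIn (w := w) (Q + 1) (Q + 16) (searchStep Y t Q) := by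
  intro g hg
  simp only [searchStep, List.mem_cons, List.not_mem_nil, or_false] at hg
  rcases hg with rfl | rfl | rfl | rfl | rfl | rfl | rfl | rfl | rfl | rfl | rfl | rfl | rfl | rfl |
    rfl | rfl <;> exact ⟨_, by omega, by omega, rfl⟩

/-- The invariant is c ≤ split < c + 2^n. Each step uses sixteen fresh scratch words, because gates
can only XOR into their targets. -/
theorem run_searchG (hY : Y.Fits w l m) (hL : Monotone L) (hM : Monotone M) (fL : FitsIn w L)
    (fM : FitsIn w M) {q : ℕ} (hq : q < 2 ^ w) (n : ℕ) : ∀ (c Q : ℕ) (x : WordMem w),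
    c + 2 ^ n ≤ 2 ^ w → Y.T + 3 ≤ Q → Q + 16 * n < 2 ^ w →
    x (BitVec.ofNat w Y.C) = BitVec.ofNat w 1 →
    x (BitVec.ofNat w (Y.C + 1)) = BitVec.ofNat w l →
    x (BitVec.ofNat w (Y.C + 2)) = BitVec.ofNat w m →
    (∀ n, Q < n → n < 2 ^ w → x (BitVec.ofNat w n) = 0#w) →
    x (BitVec.ofNat w (Y.T + 2)) = BitVec.ofNat w q →
    x (BitVec.ofNat w Q) = BitVec.ofNat w c → c ≤ splitPos L M q → splitPos L M q < c + 2 ^ n →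
    run L M (searchG Y n Q) x (BitVec.ofNat w (Q + 16 * n)) = BitVec.ofNat w (splitPos L M q) := by
  have hC := hY.hC
  have hB := hY.hB
  induction n with
  | zero =>
    intro c Q x _ _ _ _ _ _ _ _ hi h1 h2
    have : c = splitPos L M q := by simp at h2; omega
    simp [searchG, hi, this]
  | succ n ih =>
    intro c Q x hc hQ hQn h1 h2 h3 hT hp hi hc1 hc2
    have hpos : 0 < 2 ^ n := by positivity
    rw [pow_succ] at hc hc2
    have hout : ∀ k, k < 2 ^ w → (k < Q + 1 ∨ Q + 16 < k) →
        run L M (searchStep Y (2 ^ n) Q) x (BitVec.ofNat w k) = x (BitVec.ofNat w k) :=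
      fun k hk hk' => run_eq_of_targetsIn (targetsIn_searchStep _ _) (by omega) x hk hk'
    have hstep := run_searchStep hY hL hM fL fM hq (by omega : c + 2 ^ n < 2 ^ w) hpos hQ
      (by omega) h1 h2 h3 hT hp hi
    rw [searchG, run_append, show Q + 16 * (n + 1) = Q + 16 + 16 * n by ring]
    refine ih (if c + 2 ^ n ≤ splitPos L M q then c + 2 ^ n else c) (Q + 16) _ ?_ (by omega)
      (by omega) ?_ ?_ ?_ ?_ ?_ hstep ?_ ?_
    · split <;> omega
    · rw [hout _ (by omega) (by omega), h1]
    · rw [hout _ (by omega) (by omega), h2]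
    · rw [hout _ (by omega) (by omega), h3]
    · intro k hk hk'
      rw [hout _ hk' (by omega), hT _ (by omega) hk']
    · rw [hout _ (by omega) (by omega), hp]
    · split <;> omega
    · split <;> omega

/-- The search starts from the split of the enclosing block, and the new split exceeds it by at most
d · 32^k < 32^(k+1). Therefore 5(k+1) + 1 steps suffice, however long the lists are. -/
theorem run_levelC (hY : Y.Fits w l m) (hL : Monotone L) (hM : Monotone M) (fL : FitsIn w L)
    (fM : FitsIn w M) {x : WordMem w} (hx : Ready l m Y x) {k q d : ℕ} (hk : k + 1 ≤ Y.D)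
    (hq : q + 32 ^ (k + 1) ≤ 32 ^ Y.D) (hd : d < 32)
    (hdig : x (BitVec.ofNat w (Y.B + 4 * (k + 1))) = BitVec.ofNat w d)
    (hp : x (BitVec.ofNat w (Y.B + 4 * (k + 1) + 2)) = BitVec.ofNat w q)
    (hi : x (BitVec.ofNat w (Y.B + 4 * (k + 1) + 3)) = BitVec.ofNat w (splitPos L M q)) :
    run L M (levelC Y (k + 1)) x (BitVec.ofNat w (Y.T + 2)) = BitVec.ofNat w (q + d * 32 ^ k) ∧
    run L M (levelC Y (k + 1)) x (BitVec.ofNat w (Y.T + 3 + 16 * (5 * (k + 1) + 1))) =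
      BitVec.ofNat w (splitPos L M (q + d * 32 ^ k)) := by
  have hC := hY.hC
  have hB := hY.hB
  have hT := hY.hT
  have hl := hY.hl
  have hD := hY.hD
  have hs := hx.scratch
  have hw : 5 * k < 2 ^ w := by omega
  have h32 : 32 ^ (k + 1) = 32 * 32 ^ k := by rw [pow_succ']
  have hdk : d * 32 ^ k + 32 ^ k ≤ 32 ^ (k + 1) := by
    rw [h32, ← Nat.succ_mul]; exact Nat.mul_le_mul_right _ hd
  have e5 : 5 * (k + 1) - 5 = 5 * k := by omega
  have hshl : BitVec.ofNat w d <<< BitVec.ofNat w (5 * k) = BitVec.ofNat w (d * 32 ^ k) := by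
    rw [BitVec.shiftLeft_eq', toNat_ofNat_of_lt hw]
    apply BitVec.eq_of_toNat_eq
    rw [BitVec.toNat_shiftLeft, BitVec.toNat_ofNat, BitVec.toNat_ofNat, Nat.shiftLeft_eq,
      pow_mul]
    norm_num [Nat.mod_mul_mod]
  set P : List (Gate w) := [gImm (5 * (k + 1) - 5) Y.T,
    gOp .shl (Y.B + 4 * (k + 1)) Y.T (Y.T + 1),
    gOp .add (Y.B + 4 * (k + 1) + 2) (Y.T + 1) (Y.T + 2),
    gOp .or (Y.B + 4 * (k + 1) + 3) (Y.B + 4 * (k + 1) + 3) (Y.T + 3)] with hP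
  have hPt : TargetsIn (w := w) Y.T (Y.T + 3) P := by
    intro g hg
    simp only [hP, List.mem_cons, List.not_mem_nil, or_false] at hg
    rcases hg with rfl | rfl | rfl | rfl <;> exact ⟨_, by omega, by omega, rfl⟩
  have hout : ∀ n, n < 2 ^ w → (n < Y.T ∨ Y.T + 3 < n) →
      run L M P x (BitVec.ofNat w n) = x (BitVec.ofNat w n) :=
    fun n hn hn' => run_eq_of_targetsIn hPt (by omega) x hn hn'
  have hp2 : run L M P x (BitVec.ofNat w (Y.T + 2)) = BitVec.ofNat w (q + d * 32 ^ k) := by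
    simp (disch := omega) only [hP, run_cons, run_nil, map_gOp, map_gImm, xorAt_same,
      xorAt_ofNat_ne, hs, BitVec.zero_xor, WordOp.eval, hdig, hp, hi, e5, hshl]
    rw [BitVec.ofNat_add]
  have hp3 : run L M P x (BitVec.ofNat w (Y.T + 3)) = BitVec.ofNat w (splitPos L M q) := by
    simp (disch := omega) only [hP, run_cons, run_nil, map_gOp, map_gImm, xorAt_same,
      xorAt_ofNat_ne, hs, BitVec.zero_xor, WordOp.eval, hdig, hp, hi, BitVec.or_self]
  have hst : TargetsIn (w := w) (Y.T + 4) (Y.T + 3 + 16 * (5 * (k + 1) + 1))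
      (searchG Y (5 * (k + 1) + 1) (Y.T + 3)) := by
    have : ∀ n Q, TargetsIn (w := w) (Q + 1) (Q + 16 * n) (searchG Y n Q) := by
      intro n
      induction n with
      | zero => intro Q g hg; simp [searchG] at hg
      | succ n ih =>
        intro Q g hg
        rw [searchG, List.mem_append] at hg
        rcases hg with hg | hg
        · obtain ⟨a, h1, h2, h3⟩ := targetsIn_searchStep _ _ g hg
          exact ⟨a, by omega, by omega, h3⟩
        · obtain ⟨a, h1, h2, h3⟩ := ih _ g hg
          exact ⟨a, by omega, by omega, h3⟩
    exact this _ _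
  have hpow : 2 ^ (5 * (k + 1) + 1) = 2 * 32 ^ (k + 1) := by
    rw [pow_succ', pow_mul]; norm_num
  have hsq : splitPos L M q ≤ l := splitPos_le q
  rw [levelC, run_append, ← hP]
  constructor
  · rw [run_eq_of_targetsIn hst (by omega) _ (by omega) (by omega), hp2]
  · refine run_searchG hY hL hM fL fM (by omega) _ (splitPos L M q) _ _ ?_ (by omega) (by omega)
      ?_ ?_ ?_ ?_ hp2 hp3 (splitPos_le_add hL hM _ _) ?_
    · rw [hpow]; omega
    · rw [hout _ (by omega) (by omega), hx.one]
    · rw [hout _ (by omega) (by omega), hx.len₁]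
    · rw [hout _ (by omega) (by omega), hx.len₂]
    · intro n hn hn'
      rw [hout _ hn' (by omega), hs _ (by omega) hn']
    · have := splitPos_add_le (L := L) (M := M) hL hM q (d * 32 ^ k)
      have hpos : 0 < 32 ^ k := by positivity
      rw [hpow]; omega

theorem run_signC (hY : Y.Fits w l m) {x : WordMem w} (hx : Ready l m Y x) {k : ℕ} (hk : k ≤ Y.D) :
    run L M (signC Y k) x (BitVec.ofNat w (Y.T + 2)) = x (BitVec.ofNat w Y.B) &&&
      if x (BitVec.ofNat w (Y.B + 4 * k + 1)) = 0#w then 0#w else 1#w := by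
  have hC := hY.hC
  have hB := hY.hB
  have hT := hY.hT
  have hs := hx.scratch
  simp (disch := omega) only [signC, run_cons, run_nil, map_gOp, xorAt_same, xorAt_ofNat_ne, hs,
    BitVec.zero_xor, WordOp.eval]
  congr 1
  by_cases h : x (BitVec.ofNat w (Y.B + 4 * k + 1)) = 0#w
  · simp [h]
  · rw [if_neg h, if_pos]
    rw [BitVec.toNat_ofNat, Nat.zero_mod]
    rcases Nat.eq_zero_or_pos (x (BitVec.ofNat w (Y.B + 4 * k + 1))).toNat with h0 | h0
    · exact absurd (BitVec.eq_of_toNat_eq (by simpa using h0)) h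
    · exact h0

theorem targetsIn_orG (n : ℕ) : ∀ T A, TargetsIn (w := w) (T + 1) (T + n) (orG n T A) := by
  induction n with
  | zero => intro T A g hg; simp [orG] at hg
  | succ n ih =>
    intro T A g hg
    rw [orG, List.mem_cons] at hg
    rcases hg with rfl | hg
    · exact ⟨_, by omega, by omega, rfl⟩
    · obtain ⟨a, h1, h2, h3⟩ := ih _ _ g hg
      exact ⟨a, by omega, by omega, h3⟩

theorem run_orG (n : ℕ) : ∀ (T A : ℕ) (x : WordMem w), A + n ≤ T → T + n < 2 ^ w →
    (∀ k, T < k → k < 2 ^ w → x (BitVec.ofNat w k) = 0#w) →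
    (run L M (orG n T A) x (BitVec.ofNat w (T + n)) = 0#w ↔
      x (BitVec.ofNat w T) = 0#w ∧ ∀ k < n, x (BitVec.ofNat w (A + k)) = 0#w) := by
  induction n with
  | zero => intro T A x _ _ _; simp [orG]
  | succ n ih =>
    intro T A x hA hT hx
    have e : (gOp .or T A (T + 1)).map L M x = xorAt x (BitVec.ofNat w (T + 1))
        (x (BitVec.ofNat w T) ||| x (BitVec.ofNat w A)) :=
      map_gOp _ _ (by omega) (by omega) (by omega) (by omega) (by omega)
    rw [orG, run_cons, e, show T + (n + 1) = T + 1 + n by ring,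
      ih (T + 1) (A + 1) _ (by omega) (by omega)]
    · rw [xorAt_same, hx _ (by omega) (by omega), BitVec.zero_xor]
      constructor
      · rintro ⟨h1, h2⟩
        have h3 := BitVec.or_eq_zero_iff.1 h1
        refine ⟨h3.1, fun k hk => ?_⟩
        rcases k with _ | k
        · exact h3.2
        · have := h2 k (by omega)
          rwa [xorAt_ofNat_ne _ _ (by omega) (by omega) (by omega),
            show A + 1 + k = A + (k + 1) by ring] at this
      · rintro ⟨h1, h2⟩
        refine ⟨BitVec.or_eq_zero_iff.2 ⟨h1, h2 0 (by omega)⟩, fun k hk => ?_⟩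
        rw [xorAt_ofNat_ne _ _ (by omega) (by omega) (by omega),
          show A + 1 + k = A + (k + 1) by ring]
        exact h2 _ (by omega)
    · intro k hk hk'
      rw [xorAt_ofNat_ne _ _ (by omega) hk' (by omega), hx _ (by omega) hk']

theorem run_zeroC (hY : Y.Fits w l m) {x : WordMem w} (hx : Ready l m Y x) {k : ℕ} (hk : k ≤ Y.D) :
    (run L M (zeroC Y k) x (BitVec.ofNat w (Y.T + (4 * k + 2) + 1))).getLsbD 0 = true ↔
      ∀ n < 4 * k + 2, x (BitVec.ofNat w (Y.B + n)) = 0#w := by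
  have hC := hY.hC
  have hB := hY.hB
  have hT := hY.hT
  have hs := hx.scratch
  have hw : 0 < w := by have := hY.hD; omega
  have h1 := run_orG (L := L) (M := M) (4 * k + 2) Y.T Y.B x (by omega) (by omega)
    (fun n hn hn' => hs n (by omega) hn')
  have ht := targetsIn_orG (w := w) (4 * k + 2) Y.T Y.B
  have h2 : run L M (orG (4 * k + 2) Y.T Y.B) x (BitVec.ofNat w (Y.T + (4 * k + 2) + 1)) = 0#w := by
    rw [run_eq_of_targetsIn ht (by omega) x (by omega) (by omega), hs _ (by omega) (by omega)]
  have h3 : run L M (orG (4 * k + 2) Y.T Y.B) x (BitVec.ofNat w Y.T) = 0#w := by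
    rw [run_eq_of_targetsIn ht (by omega) x (by omega) (by omega), hs _ (by omega) (by omega)]
  rw [zeroC, run_append, run_cons, run_nil,
    map_gOp _ _ (by omega) (by omega) (by omega) (by omega) (by omega), xorAt_same, h2, h3,
    BitVec.zero_xor, WordOp.eval]
  rw [hs _ le_rfl (by omega)] at h1
  simp only [true_and] at h1
  rw [← h1]
  split
  · rename_i h; simp [h, hw]
  · rename_i h; simp [h]

end semantics

/-! ## The search of one level -/

section level
variable {w l m : ℕ} {L : Fin l → ℤ} {M : Fin m → ℤ} {Y : Layout}

/-! ### Words read and changed by the circuits -/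

theorem avoids_gOp (o : WordOp) {a b c r : ℕ} (ha : a ≠ r) (hb : b ≠ r) (hc : c ≠ r)
    (ha' : a < 2 ^ w) (hb' : b < 2 ^ w) (hc' : c < 2 ^ w) (hr : r < 2 ^ w) :
    (gOp o a b c).Avoids (BitVec.ofNat w r) :=
  ⟨ofNat_ne ha ha' hr, ofNat_ne hb hb' hr, ofNat_ne hc hc' hr⟩

theorem avoids_gImm (v : ℕ) {c r : ℕ} (hc : c ≠ r) (hc' : c < 2 ^ w) (hr : r < 2 ^ w) :
    (gImm v c).Avoids (BitVec.ofNat w r) := ofNat_ne hc hc' hr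

theorem avoids_gL {a c r : ℕ} (ha : a ≠ r) (hc : c ≠ r)
    (ha' : a < 2 ^ w) (hc' : c < 2 ^ w) (hr : r < 2 ^ w) :
    (gL a c).Avoids (BitVec.ofNat w r) := ⟨ofNat_ne ha ha' hr, ofNat_ne hc hc' hr⟩

theorem forall_mem_cons_of {α : Type*} {p : α → Prop} {a : α} {s : List α} (h : p a)
    (hs : ∀ b ∈ s, p b) : ∀ b ∈ a :: s, p b := List.forall_mem_cons.2 ⟨h, hs⟩

theorem forall_mem_append_of {α : Type*} {p : α → Prop} {s t : List α} (h : ∀ b ∈ s, p b)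
    (ht : ∀ b ∈ t, p b) : ∀ b ∈ s ++ t, p b := List.forall_mem_append.2 ⟨h, ht⟩

theorem leafC_isPerm : ∀ g ∈ leafC (w := w) Y, g.IsPerm := by
  unfold leafC
  repeat' first
    | exact fun _ h => absurd h List.not_mem_nil
    | refine forall_mem_cons_of trivial ?_

theorem searchG_isPerm (n Q : ℕ) : ∀ g ∈ searchG (w := w) Y n Q, g.IsPerm := by
  induction n generalizing Q with
  | zero => exact fun _ h => absurd h List.not_mem_nil
  | succ n ih =>
    refine forall_mem_append_of ?_ (ih _)
    unfold searchStep
    repeat' first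
      | exact fun _ h => absurd h List.not_mem_nil
      | refine forall_mem_cons_of trivial ?_

theorem levelC_isPerm (k : ℕ) : ∀ g ∈ levelC (w := w) Y k, g.IsPerm := by
  refine forall_mem_append_of ?_ (searchG_isPerm _ _)
  repeat' first
    | exact fun _ h => absurd h List.not_mem_nil
    | refine forall_mem_cons_of trivial ?_

theorem signC_isPerm (k : ℕ) : ∀ g ∈ signC (w := w) Y k, g.IsPerm :=
  forall_mem_cons_of trivial (forall_mem_cons_of trivial fun _ h => absurd h List.not_mem_nil)

theorem orG_isPerm (n T A : ℕ) : ∀ g ∈ orG (w := w) n T A, g.IsPerm := by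
  induction n generalizing T A with
  | zero => exact fun _ h => absurd h List.not_mem_nil
  | succ n ih => exact forall_mem_cons_of trivial (ih _ _)

theorem zeroC_isPerm (k : ℕ) : ∀ g ∈ zeroC (w := w) Y k, g.IsPerm :=
  forall_mem_append_of (orG_isPerm _ _ _)
    (forall_mem_cons_of trivial fun _ h => absurd h List.not_mem_nil)

theorem recordC_isPerm (R : ℕ) : ∀ g ∈ recordC (w := w) Y R, g.IsPerm := by
  unfold recordC
  repeat' first
    | exact fun _ h => absurd h List.not_mem_nil
    | refine forall_mem_cons_of trivial ?_

theorem leafC_avoids (hY : Y.Fits w l m) {r : ℕ} (h1 : Y.B ≤ r) (h2 : r < Y.B + 2) :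
    ∀ g ∈ leafC (w := w) Y, g.Avoids (BitVec.ofNat w r) := by
  have hC := hY.hC
  have hB := hY.hB
  have hT := hY.hT
  unfold leafC
  repeat' first
    | exact fun _ h => absurd h List.not_mem_nil
    | refine forall_mem_cons_of ?_ ?_
  all_goals first
    | (apply avoids_gOp <;> omega)
    | (apply avoids_gL <;> omega)

theorem searchG_avoids (hY : Y.Fits w l m) {r : ℕ} (h1 : Y.B ≤ r) (h2 : r < Y.T) (n Q : ℕ)
    (hQ : Y.T ≤ Q) (hQ' : Q + 16 * n < 2 ^ w) :
    ∀ g ∈ searchG (w := w) Y n Q, g.Avoids (BitVec.ofNat w r) := by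
  have hC := hY.hC
  have hB := hY.hB
  have hT := hY.hT
  induction n generalizing Q with
  | zero => exact fun _ h => absurd h List.not_mem_nil
  | succ n ih =>
    refine forall_mem_append_of ?_ (ih _ (by omega) (by omega))
    unfold searchStep
    repeat' first
      | exact fun _ h => absurd h List.not_mem_nil
      | refine forall_mem_cons_of ?_ ?_
    all_goals first
      | (apply avoids_gOp <;> omega)
      | (apply avoids_gL <;> omega)
        | (apply avoids_gImm <;> omega)

theorem levelC_avoids (hY : Y.Fits w l m) {k r : ℕ} (hk : k + 1 ≤ Y.D) (h1 : Y.B + 4 * k + 2 ≤ r)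
    (h2 : r < Y.B + 4 * k + 4) :
    ∀ g ∈ levelC (w := w) Y (k + 1), g.Avoids (BitVec.ofNat w r) := by
  have hC := hY.hC
  have hB := hY.hB
  have hT := hY.hT
  refine forall_mem_append_of ?_
    (searchG_avoids hY (by omega) (by omega) _ _ (by omega) (by omega))
  repeat' first
    | exact fun _ h => absurd h List.not_mem_nil
    | refine forall_mem_cons_of ?_ ?_
  all_goals first
    | (apply avoids_gOp <;> omega)
    | (apply avoids_gImm <;> omega)

theorem recordC_avoids (hY : Y.Fits w l m) {R r : ℕ} (hR : R + 3 < Y.C) (h1 : R ≤ r)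
    (h2 : r < R + 2) : ∀ g ∈ recordC (w := w) Y R, g.Avoids (BitVec.ofNat w r) := by
  have hC := hY.hC
  have hB := hY.hB
  have hT := hY.hT
  unfold recordC
  repeat' first
    | exact fun _ h => absurd h List.not_mem_nil
    | refine forall_mem_cons_of ?_ ?_
  all_goals (apply avoids_gOp <;> omega)

/-- The words of the levels up to `k`. -/
def levelSet (w : ℕ) (Y : Layout) (k : ℕ) : Set (BitVec w) :=
  {a | ∃ n, Y.B ≤ n ∧ n < Y.B + 4 * k + 2 ∧ a = BitVec.ofNat w n}

theorem mem_levelSet {k n : ℕ} (h1 : Y.B ≤ n) (h2 : n < Y.B + 4 * k + 2) :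
    BitVec.ofNat w n ∈ levelSet w Y k := ⟨n, h1, h2, rfl⟩

theorem not_mem_levelSet (hY : Y.Fits w l m) {k n : ℕ} (hk : k ≤ Y.D)
    (h : n < Y.B ∨ Y.B + 4 * k + 2 ≤ n) (hn : n < 2 ^ w) : BitVec.ofNat w n ∉ levelSet w Y k := by
  have hB := hY.hB
  have hT := hY.hT
  rintro ⟨n', h1, h2, h3⟩
  exact ofNat_ne (by omega) hn (by omega) h3

theorem levelSet_mono {j k : ℕ} (h : j ≤ k) : levelSet w Y j ⊆ levelSet w Y k := by
  rintro a ⟨n, h1, h2, h3⟩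
  exact ⟨n, h1, by omega, h3⟩

theorem loc_leafG (hY : Y.Fits w l m) : Loc L M (levelSet w Y 0) (leafG Y) := by
  have hC := hY.hC
  have hB := hY.hB
  have hT := hY.hT
  refine Loc.xorBlock L M leafC_isPerm ?_ ?_ ?_ (leafC_avoids hY ?_ ?_) (leafC_avoids hY ?_ ?_)
    (mem_levelSet ?_ ?_) (mem_levelSet ?_ ?_)
  all_goals first | omega | (apply ofNat_ne <;> omega)

theorem loc_levelG (hY : Y.Fits w l m) {k : ℕ} (hk : k + 1 ≤ Y.D) :
    Loc L M (levelSet w Y (k + 1)) (levelG Y (k + 1)) := by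
  have hC := hY.hC
  have hB := hY.hB
  have hT := hY.hT
  refine Loc.xorBlock L M (levelC_isPerm _) ?_ ?_ ?_ (levelC_avoids hY hk ?_ ?_)
    (levelC_avoids hY hk ?_ ?_) (mem_levelSet ?_ ?_) (mem_levelSet ?_ ?_)
  all_goals first | omega | (apply ofNat_ne <;> omega)

theorem loc_chooseG (hY : Y.Fits w l m) {k : ℕ} (hk : k + 1 ≤ Y.D) :
    Loc L M (levelSet w Y (k + 1)) (chooseG Y (k + 1)) := by
  refine ((Loc.hadLayer L M _ _).mono ?_).append
    (((Loc.hadLayer L M _ _).mono ?_).append (loc_levelG hY hk))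
  · rw [Set.singleton_subset_iff]; exact mem_levelSet (by omega) (by omega)
  · rw [Set.singleton_subset_iff]; exact mem_levelSet (by omega) (by omega)

theorem Layout.Fits.pos (hY : Y.Fits w l m) : 0 < w := by have := hY.hD; omega

theorem loc_signG (hY : Y.Fits w l m) (k : ℕ) (W : Set (BitVec w)) :
    Loc L M W (signG Y k) := Loc.of_diag (circ_signBlock L M hY.pos (signC_isPerm k) _) W

theorem loc_zeroG (hY : Y.Fits w l m) (k : ℕ) (W : Set (BitVec w)) :
    Loc L M W (zeroG Y k) := Loc.of_diag (circ_signBlock L M hY.pos (zeroC_isPerm k) _) W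

theorem loc_searchLevelG (hY : Y.Fits w l m) : ∀ k ≤ Y.D,
    Loc L M (levelSet w Y k) (searchLevelG Y k) := by
  intro k
  induction k with
  | zero => exact fun _ => loc_leafG hY
  | succ k ih =>
    intro hk
    have hB : Loc L M (levelSet w Y (k + 1)) (chooseG Y (k + 1) ++ searchLevelG Y k) :=
      (loc_chooseG hY hk).append ((ih (by omega)).mono (levelSet_mono (Nat.le_succ k)))
    exact (((hB.append (loc_signG hY _ _)).append hB.reverse).append (loc_zeroG hY _ _)).append hB

theorem Ready.congr (hY : Y.Fits w l m) {x y : WordMem w} (hx : Ready l m Y x)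
    (h : ∀ a, a ∉ levelSet w Y Y.D → y a = x a) : Ready l m Y y := by
  have hC := hY.hC
  have hB := hY.hB
  have hT := hY.hT
  refine ⟨?_, ?_, ?_, fun n hn hn' => ?_⟩
  · rw [h _ (not_mem_levelSet hY le_rfl (by omega) (by omega)), hx.one]
  · rw [h _ (not_mem_levelSet hY le_rfl (by omega) (by omega)), hx.len₁]
  · rw [h _ (not_mem_levelSet hY le_rfl (by omega) (by omega)), hx.len₂]
  · rw [h _ (not_mem_levelSet hY le_rfl (by omega) hn'), hx.scratch n hn hn']

variable (L M)

/-- The words for the levels below `k` are zero, and the words of level `k` hold the position `q` in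
the merged list. -/
structure Context (Y : Layout) (k q : ℕ) (x : WordMem w) : Prop where
  ready : Ready l m Y x
  zero : ∀ n < 4 * k + 2, x (BitVec.ofNat w (Y.B + n)) = 0#w
  pos : x (BitVec.ofNat w (Y.B + 4 * k + 2)) = BitVec.ofNat w q
  split : x (BitVec.ofNat w (Y.B + 4 * k + 3)) = BitVec.ofNat w (splitPos L M q)

/-- The flag and the entry that are stored are right. -/
def Sound (Y : Layout) (x : WordMem w) : Prop :=
  (x (BitVec.ofNat w Y.B) = 0#w ∧ x (BitVec.ofNat w (Y.B + 1)) = 0#w) ∨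
  (x (BitVec.ofNat w Y.B) = 1#w ∧ IsAnswer L M (some (x (BitVec.ofNat w (Y.B + 1))).toInt))

/-- The flag is set. -/
def FlagSet (Y : Layout) (x : WordMem w) : Prop := x (BitVec.ofNat w Y.B) ≠ 0#w

variable {L M}

open Classical in
theorem nsq_restr_ket (g : WordMem w → Prop) (x : WordMem w) :
    nsq (restr g (ket x)) = if g x then 1 else 0 := by
  rw [nsq, Finset.sum_eq_single x]
  · by_cases h : g x <;> simp [restr, h, ket_self]
  · intro y _ h; simp [restr, ket_ne h]
  · simp

theorem xorAt_eq_update {x : WordMem w} {a : BitVec w} (h : x a = 0#w) (v : BitVec w) :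
    Function.update x a v = xorAt x a v := by
  rw [xorAt, h, BitVec.zero_xor]

/-- At every basis state at most one summand is nonzero, so the branches do not interfere and
probabilities add. -/
theorem nsq_restr_sum {ι : Type*} (s : Finset ι) (φ : ι → QState w) (g : WordMem w → Prop) (a : ℂ)
    (h : ∀ i ∈ s, ∀ j ∈ s, ∀ y, φ i y ≠ 0 → φ j y ≠ 0 → i = j) :
    nsq (restr g (a • ∑ i ∈ s, φ i)) = ‖a‖ ^ 2 * ∑ i ∈ s, nsq (restr g (φ i)) := by
  classical
  have h1 : ∀ y, ‖∑ i ∈ s, φ i y‖ ^ 2 = ∑ i ∈ s, ‖φ i y‖ ^ 2 := by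
    intro y
    by_cases hy : ∃ i ∈ s, φ i y ≠ 0
    · obtain ⟨i, hi, hne⟩ := hy
      have h0 : ∀ j ∈ s, j ≠ i → φ j y = 0 := fun j hj hji => by
        by_contra hne'; exact hji (h j hj i hi y hne' hne)
      rw [Finset.sum_eq_single_of_mem i hi h0,
        Finset.sum_eq_single_of_mem i hi fun j hj hji => by simp [h0 j hj hji]]
    · push Not at hy
      rw [Finset.sum_eq_zero hy, Finset.sum_eq_zero fun i hi => by simp [hy i hi]]
      simp
  simp only [nsq]
  rw [Finset.sum_comm, Finset.mul_sum]
  refine Finset.sum_congr rfl fun y _ => ?_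
  by_cases hg : g y
  · simp only [restr, hg, if_true, Pi.smul_apply, Finset.sum_apply, smul_eq_mul, norm_mul, mul_pow,
      h1]
  · simp [restr, hg]

theorem searchLevelG_spec_zero (hY : Y.Fits w l m) (hL : Monotone L) (hM : Monotone M)
    (fL : FitsIn w L) (fM : FitsIn w M) {q : ℕ} (hq : q < 2 ^ w) {x : WordMem w}
    (hx : Context L M Y 0 q x) :
    nsq (restr (FlagSet Y) (circ L M (searchLevelG Y 0) (ket x))) =
      succProb Y.K Y.D (FoundAt L M) 0 q ∧
    ∀ y, circ L M (searchLevelG Y 0) (ket x) y ≠ 0 → Sound L M Y y := by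
  have hC := hY.hC
  have hB := hY.hB
  have hT := hY.hT
  have hw := hY.pos
  have h := run_leafC hY hL hM fL fM hx.ready hq hx.pos hx.split
  rw [searchLevelG, leafG, circ_ket_of_isPerm L M (xorBlock_isPerm leafC_isPerm _ _ _ _),
    run_xorBlock L M (by apply ofNat_ne <;> omega) (by apply ofNat_ne <;> omega)
      (by apply ofNat_ne <;> omega) (leafC_avoids hY (by omega) (by omega))
      (leafC_avoids hY (by omega) (by omega))]
  set f := run L M (leafC Y) x (BitVec.ofNat w (Y.T + 9))
  set v := run L M (leafC Y) x (BitVec.ofNat w (Y.T + 11))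
  set y := xorAt (xorAt x (BitVec.ofNat w Y.B) f) (BitVec.ofNat w (Y.B + 1)) v with hy
  have e1 : y (BitVec.ofNat w Y.B) = f := by
    have h0 : x (BitVec.ofNat w Y.B) = 0#w := hx.zero 0 (by omega)
    rw [hy, xorAt_ofNat_ne _ _ (by omega) (by omega) (by omega), xorAt_same, h0, BitVec.zero_xor]
  have e2 : y (BitVec.ofNat w (Y.B + 1)) = v := by
    have h0 := hx.zero 1 (by omega)
    rw [hy, xorAt_same, xorAt_ofNat_ne _ _ (by omega) (by omega) (by omega), h0, BitVec.zero_xor]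
  constructor
  · rw [nsq_restr_ket, FlagSet, e1, succProb]
    by_cases hf : FoundAt L M q
    · rw [(h.1 hf).1, if_pos hf, if_pos]
      intro h01
      have := congrArg BitVec.toNat h01
      have h1w := Nat.one_lt_two_pow hw.ne'
      rw [BitVec.toNat_ofNat, BitVec.toNat_ofNat, Nat.mod_eq_of_lt h1w] at this
      simp at this
    · rw [(h.2 hf).1, if_neg hf, if_neg (by simp)]
  · intro z hz
    have : z = y := by by_contra hne; exact hz (ket_ne hne)
    rw [this, Sound, e1, e2]
    by_cases hf : FoundAt L M q
    · exact Or.inr (h.1 hf)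
    · exact Or.inl (h.2 hf)

end level

/-! ### The inductive step: branching and amplification -/

section step
variable {w l m : ℕ} {L : Fin l → ℤ} {M : Fin m → ℤ} {Y : Layout}

variable (L M) in
/-- The memory after the choice of coin bits `i.1` and of the part `i.2` of the block at `q`. -/
noncomputable def branch (Y : Layout) (k q : ℕ) (x : WordMem w) (i : ℕ × ℕ) : WordMem w :=
  xorAt (xorAt (xorAt (xorAt x (BitVec.ofNat w (Y.B + 4 * (k + 1) + 1)) (BitVec.ofNat w i.1))
    (BitVec.ofNat w (Y.B + 4 * (k + 1))) (BitVec.ofNat w i.2))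
    (BitVec.ofNat w (Y.B + 4 * (k + 1) - 2)) (BitVec.ofNat w (q + i.2 * 32 ^ k)))
    (BitVec.ofNat w (Y.B + 4 * (k + 1) - 1)) (BitVec.ofNat w (splitPos L M (q + i.2 * 32 ^ k)))

theorem branch_of_ne (hY : Y.Fits w l m) {k q n : ℕ} (hk : k + 1 ≤ Y.D) (x : WordMem w) (i : ℕ × ℕ)
    (hn : n < 2 ^ w) (h : n < Y.B + 4 * k + 2 ∨ Y.B + 4 * k + 6 ≤ n) :
    branch L M Y k q x i (BitVec.ofNat w n) = x (BitVec.ofNat w n) := by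
  have hB := hY.hB
  have hT := hY.hT
  simp (disch := omega) only [branch, xorAt_ofNat_ne]

theorem branch_coin (hY : Y.Fits w l m) {k q : ℕ} (hk : k + 1 ≤ Y.D) {x : WordMem w} (i : ℕ × ℕ)
    (h0 : x (BitVec.ofNat w (Y.B + 4 * (k + 1) + 1)) = 0#w) :
    branch L M Y k q x i (BitVec.ofNat w (Y.B + 4 * (k + 1) + 1)) = BitVec.ofNat w i.1 := by
  have hB := hY.hB
  have hT := hY.hT
  simp (disch := omega) only [branch, xorAt_ofNat_ne, xorAt_same, h0, BitVec.zero_xor]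

theorem branch_digit (hY : Y.Fits w l m) {k q : ℕ} (hk : k + 1 ≤ Y.D) {x : WordMem w} (i : ℕ × ℕ)
    (h0 : x (BitVec.ofNat w (Y.B + 4 * (k + 1))) = 0#w) :
    branch L M Y k q x i (BitVec.ofNat w (Y.B + 4 * (k + 1))) = BitVec.ofNat w i.2 := by
  have hB := hY.hB
  have hT := hY.hT
  simp (disch := omega) only [branch, xorAt_ofNat_ne, xorAt_same, h0, BitVec.zero_xor]

theorem Context.branch (hY : Y.Fits w l m) {k q : ℕ} (hk : k + 1 ≤ Y.D) {x : WordMem w}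
    (hx : Context L M Y (k + 1) q x) (i : ℕ × ℕ) :
    Context L M Y k (q + i.2 * 32 ^ k) (branch L M Y k q x i) := by
  have hC := hY.hC
  have hB := hY.hB
  have hT := hY.hT
  have h2 := hx.zero (4 * (k + 1) - 2) (by omega)
  have h3 := hx.zero (4 * (k + 1) - 1) (by omega)
  -- The two words written by level k + 1 are the position words read by level k.
  have e2 : Y.B + 4 * (k + 1) - 2 = Y.B + 4 * k + 2 := by omega
  have e3 : Y.B + 4 * (k + 1) - 1 = Y.B + 4 * k + 3 := by omega
  rw [← Nat.add_sub_assoc (by omega), e2] at h2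
  rw [← Nat.add_sub_assoc (by omega), e3] at h3
  refine ⟨⟨?_, ?_, ?_, fun n hn hn' => ?_⟩, fun n hn => ?_, ?_, ?_⟩
  · rw [branch_of_ne hY hk _ _ (by omega) (by omega), hx.ready.one]
  · rw [branch_of_ne hY hk _ _ (by omega) (by omega), hx.ready.len₁]
  · rw [branch_of_ne hY hk _ _ (by omega) (by omega), hx.ready.len₂]
  · rw [branch_of_ne hY hk _ _ (by omega) (by omega), hx.ready.scratch n hn hn']
  · rw [branch_of_ne hY hk _ _ (by omega) (by omega), hx.zero n (by omega)]
  · simp (disch := omega) only [_root_.branch, e2, e3, xorAt_ofNat_ne, xorAt_same, h2,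
      BitVec.zero_xor]
  · simp (disch := omega) only [_root_.branch, e2, e3, xorAt_ofNat_ne, xorAt_same, h3,
      BitVec.zero_xor]

theorem coinBits_le (hY : Y.Fits w l m) (k : ℕ) : coinBits Y.D (k + 1) ≤ w := by
  have := hY.hD
  unfold coinBits
  have := min_le_right (k + 1) (Y.D - (k + 1))
  omega

theorem digitBits_le_five (K k : ℕ) : digitBits K k ≤ 5 := by
  unfold digitBits; split <;> omega

theorem run_levelG_branch (hY : Y.Fits w l m) (hL : Monotone L) (hM : Monotone M)
    (fL : FitsIn w L) (fM : FitsIn w M) {k q : ℕ} (hk : k + 1 ≤ Y.D)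
    (hq : q + 32 ^ (k + 1) ≤ 32 ^ Y.D) {x : WordMem w} (hx : Context L M Y (k + 1) q x)
    (c v : ℕ) (hv : v < 32) :
    run L M (levelG Y (k + 1)) (xorAt (xorAt x (BitVec.ofNat w (Y.B + 4 * (k + 1) + 1))
      (BitVec.ofNat w c)) (BitVec.ofNat w (Y.B + 4 * (k + 1))) (BitVec.ofNat w v)) =
    branch L M Y k q x (c, v) := by
  have hC := hY.hC
  have hB := hY.hB
  have hT := hY.hT
  set z := xorAt (xorAt x (BitVec.ofNat w (Y.B + 4 * (k + 1) + 1))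
      (BitVec.ofNat w c)) (BitVec.ofNat w (Y.B + 4 * (k + 1))) (BitVec.ofNat w v) with hz
  have hne : ∀ n, n < 2 ^ w → (n < Y.B + 4 * (k + 1) ∨ Y.B + 4 * (k + 1) + 2 ≤ n) →
      z (BitVec.ofNat w n) = x (BitVec.ofNat w n) := by
    intro n hn hn'
    simp (disch := omega) only [hz, xorAt_ofNat_ne]
  have hr : Ready l m Y z := by
    refine ⟨?_, ?_, ?_, fun n hn hn' => ?_⟩
    · rw [hne _ (by omega) (by omega), hx.ready.one]
    · rw [hne _ (by omega) (by omega), hx.ready.len₁]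
    · rw [hne _ (by omega) (by omega), hx.ready.len₂]
    · rw [hne _ hn' (by omega), hx.ready.scratch n hn hn']
  have h0 := hx.zero (4 * (k + 1)) (by omega)
  have hd : z (BitVec.ofNat w (Y.B + 4 * (k + 1))) = BitVec.ofNat w v := by
    simp (disch := omega) only [hz, xorAt_ofNat_ne, xorAt_same, h0, BitVec.zero_xor]
  have hrun := run_levelC hY hL hM fL fM hr hk hq hv hd
    (by rw [hne _ (by omega) (by omega), hx.pos])
    (by rw [hne _ (by omega) (by omega), hx.split])
  rw [levelG, run_xorBlock L M (by apply ofNat_ne <;> omega) (by apply ofNat_ne <;> omega)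
    (by apply ofNat_ne <;> omega) (levelC_avoids hY hk (by omega) (by omega))
    (levelC_avoids hY hk (by omega) (by omega)), hrun.1, hrun.2]
  rfl

theorem circ_chooseG (hY : Y.Fits w l m) (hL : Monotone L) (hM : Monotone M) (fL : FitsIn w L)
    (fM : FitsIn w M) {k q : ℕ} (hk : k + 1 ≤ Y.D) (hq : q + 32 ^ (k + 1) ≤ 32 ^ Y.D)
    {x : WordMem w} (hx : Context L M Y (k + 1) q x) :
    circ L M (chooseG Y (k + 1)) (ket x) =
      (1 / (Real.sqrt 2 : ℂ)) ^ (coinBits Y.D (k + 1) + digitBits Y.K (k + 1)) •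
        ∑ i ∈ Finset.range (2 ^ coinBits Y.D (k + 1)) ×ˢ
          Finset.range (2 ^ digitBits Y.K (k + 1)), ket (branch L M Y k q x i) := by
  have hB := hY.hB
  have hT := hY.hT
  have hD := hY.hD
  have h0 := hx.zero (4 * (k + 1)) (by omega)
  have h1 := hx.zero (4 * (k + 1) + 1) (by omega)
  rw [← add_assoc] at h1
  have h5 := digitBits_le_five Y.K (k + 1)
  rw [chooseG, circ_append, circ_hadLayer L M _ (coinBits_le hY k) x h1, map_smul, map_sum,
    pow_add, mul_smul, Finset.sum_product]
  congr 1
  rw [Finset.smul_sum]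
  refine Finset.sum_congr rfl fun c _ => ?_
  rw [xorAt_eq_update h1, circ_append, circ_hadLayer L M _ (by omega), map_smul, map_sum]
  · congr 1
    refine Finset.sum_congr rfl fun v hv => ?_
    have hv' : v < 32 := (Finset.mem_range.1 hv).trans_le
      ((Nat.pow_le_pow_right (by norm_num) h5).trans (by norm_num))
    rw [xorAt_eq_update, levelG, circ_ket_of_isPerm L M (xorBlock_isPerm (levelC_isPerm _) _ _ _ _),
      ← levelG, run_levelG_branch hY hL hM fL fM hk hq hx c v hv']
    rw [xorAt_ofNat_ne _ _ (by omega) (by omega) (by omega), h0]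
  · rw [xorAt_ofNat_ne _ _ (by omega) (by omega) (by omega), h0]

theorem norm_inv_sqrt_two_pow (n : ℕ) : ‖(1 / (Real.sqrt 2 : ℂ)) ^ n‖ ^ 2 = (1 / 2 : ℝ) ^ n := by
  rw [norm_pow, ← pow_mul, mul_comm, pow_mul, norm_div, norm_one, Complex.norm_real,
    Real.norm_of_nonneg (Real.sqrt_nonneg 2), div_pow, Real.sq_sqrt (by norm_num), one_pow]

theorem restr_congr {g h : WordMem w → Prop} {ψ : QState w}
    (H : ∀ y, ψ y ≠ 0 → (g y ↔ h y)) : restr g ψ = restr h ψ := by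
  funext y
  by_cases hy : ψ y = 0
  · simp [restr, hy]
  · classical exact if_congr (H y hy) rfl rfl

/-- Flagged states where the reflection is active are scaled by a + 2, flagged states where it is
suspended by a. With a = 1 - 4q these are the two terms of `amplified`. -/
theorem nsq_restr_amplified {g h : WordMem w → Prop} (ψ : QState w) (a : ℝ) :
    nsq (restr g (-((a : ℂ) • ψ + (2 : ℂ) • restr (fun y => g y ∧ h y) ψ))) =
      (a + 2) ^ 2 * nsq (restr (fun y => g y ∧ h y) ψ) +
        a ^ 2 * (nsq (restr g ψ) - nsq (restr (fun y => g y ∧ h y) ψ)) := by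
  classical
  have e : nsq (restr g ψ) = nsq (restr (fun y => g y ∧ h y) ψ) +
      nsq (restr (fun y => g y ∧ ¬ h y) ψ) := by
    rw [nsq, nsq, nsq, ← Finset.sum_add_distrib]
    refine Finset.sum_congr rfl fun y _ => ?_
    by_cases h1 : g y <;> by_cases h2 : h y <;> simp [restr, h1, h2]
  rw [e, add_sub_cancel_left, nsq, nsq, nsq, Finset.mul_sum, Finset.mul_sum,
    ← Finset.sum_add_distrib]
  refine Finset.sum_congr rfl fun y _ => ?_
  by_cases h1 : g y
  · by_cases h2 : h y
    · have : (a : ℂ) * ψ y + 2 * ψ y = ((a + 2 : ℝ) : ℂ) * ψ y := by push_cast; ring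
      simp only [restr, h1, h2, and_self, if_true, Pi.neg_apply, Pi.add_apply, Pi.smul_apply,
        smul_eq_mul, norm_neg, this, norm_mul, mul_pow, Complex.norm_real, Real.norm_eq_abs, sq_abs,
        not_true, and_false, if_false, norm_zero]
      ring
    · simp only [restr, h1, h2, and_false, if_true, Pi.neg_apply, Pi.add_apply, Pi.smul_apply,
        smul_eq_mul, norm_neg, norm_mul, mul_pow, Complex.norm_real, Real.norm_eq_abs, sq_abs,
        not_false_iff, and_true, if_false, norm_zero, mul_zero, add_zero]
      ring
  · simp [restr, h1]

/-- Soundness confines the flag word to 0 or 1, so bit 0 of the conjunction decides. -/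
theorem sign_iff (hY : Y.Fits w l m) {k : ℕ} (hk : k ≤ Y.D) {y : WordMem w} (hy : Ready l m Y y)
    (hs : Sound L M Y y) :
    (run L M (signC Y k) y (BitVec.ofNat w (Y.T + 2))).getLsbD 0 = true ↔
      FlagSet Y y ∧ y (BitVec.ofNat w (Y.B + 4 * k + 1)) ≠ 0#w := by
  have hw := hY.pos
  have h10 : (1#w : BitVec w) ≠ 0#w := by
    intro h
    have := congrArg (fun v => v.getLsbD 0) h
    simp [hw] at this
  rw [run_signC hY hy hk, FlagSet]
  rcases hs with ⟨h1, _⟩ | ⟨h1, _⟩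
  · simp [h1]
  · by_cases h2 : y (BitVec.ofNat w (Y.B + 4 * k + 1)) = 0#w
    · simp [h1, h2]
    · simp [h1, h2, h10, hw]

/-- Only the words of the levels up to k can differ from x, and in x they are zero. A test for zero
is thus a test for the start state itself, whatever block position q the remaining words hold. -/
theorem zero_iff (hY : Y.Fits w l m) {k q : ℕ} (hk : k ≤ Y.D) {x : WordMem w}
    (hx : Context L M Y k q x) {y : WordMem w} (hy : ∀ a, a ∉ levelSet w Y k → y a = x a) :
    (run L M (zeroC Y k) y (BitVec.ofNat w (Y.T + (4 * k + 2) + 1))).getLsbD 0 = true ↔ y = x := by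
  have hr : Ready l m Y y := hx.ready.congr hY fun a ha => hy a fun h => ha (levelSet_mono hk h)
  rw [run_zeroC hY hr hk]
  constructor
  · intro h
    funext a
    by_cases ha : a ∈ levelSet w Y k
    · obtain ⟨n, h1, h2, rfl⟩ := ha
      have e := h (n - Y.B) (by omega)
      have e' := hx.zero (n - Y.B) (by omega)
      rw [Nat.add_sub_cancel' h1] at e e'
      rw [e, e']
    · exact hy a ha
  · rintro rfl n hn
    exact hx.zero n hn

/-- The lower search leaves the coin and digit words alone, so its branches have disjoint supports
and success averages over the digits. The branches with all coins zero carry a share 2^-γ of the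
weight and escape the sign change. `circ_amplify` then gives the recursion of `succProb`. -/
theorem searchLevelG_spec (hY : Y.Fits w l m) (hL : Monotone L) (hM : Monotone M)
    (fL : FitsIn w L) (fM : FitsIn w M) : ∀ k ≤ Y.D, ∀ (q : ℕ) (x : WordMem w),
    q + 32 ^ k ≤ 32 ^ Y.D → Context L M Y k q x →
    nsq (restr (FlagSet Y) (circ L M (searchLevelG Y k) (ket x))) =
      succProb Y.K Y.D (FoundAt L M) k q ∧
    ∀ y, circ L M (searchLevelG Y k) (ket x) y ≠ 0 → Sound L M Y y := by
  have hB := hY.hB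
  have hT := hY.hT
  have hl := hY.hl
  intro k
  induction k with
  | zero =>
    intro _ q x hq hx
    exact searchLevelG_spec_zero hY hL hM fL fM (by omega) hx
  | succ k ih =>
    intro hk q x hq hx
    have hkD : k ≤ Y.D := by omega
    set γ := coinBits Y.D (k + 1) with hγ
    set δ := digitBits Y.K (k + 1) with hδ
    set S := Finset.range (2 ^ γ) ×ˢ Finset.range (2 ^ δ) with hS
    have hγw : γ ≤ w := coinBits_le hY k
    have hδ5 : 2 ^ δ ≤ 32 :=
      (Nat.pow_le_pow_right (by norm_num) (digitBits_le_five Y.K (k + 1))).trans (by norm_num)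
    have h32 : (2 : ℕ) ^ 5 ≤ 2 ^ w :=
      Nat.pow_le_pow_right (by norm_num) (by have := hY.hD; omega)
    set a : ℂ := (1 / (Real.sqrt 2 : ℂ)) ^ (γ + δ) with ha
    set B : List (Gate w) := chooseG Y (k + 1) ++ searchLevelG Y k with hBdef
    let φ : ℕ × ℕ → QState w := fun i => circ L M (searchLevelG Y k) (ket (branch L M Y k q x i))
    have hψ : circ L M B (ket x) = a • ∑ i ∈ S, φ i := by
      rw [hBdef, circ_append, circ_chooseG hY hL hM fL fM hk hq hx, map_smul, map_sum]
    have hloc : Loc L M (levelSet w Y (k + 1)) B :=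
      (loc_chooseG hY hk).append ((loc_searchLevelG hY k hkD).mono (levelSet_mono (Nat.le_succ k)))
    have hc0 := hx.zero (4 * (k + 1) + 1) (by omega)
    have hd0 := hx.zero (4 * (k + 1)) (by omega)
    rw [← add_assoc] at hc0
    have hφs : ∀ i y, φ i y ≠ 0 → ∀ b, b ∉ levelSet w Y k → y b = branch L M Y k q x i b :=
      fun i => (loc_searchLevelG hY k hkD).support_ket _
    have hφc : ∀ i y, φ i y ≠ 0 →
        y (BitVec.ofNat w (Y.B + 4 * (k + 1) + 1)) = BitVec.ofNat w i.1 := fun i y hy => by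
      rw [hφs i y hy _ (not_mem_levelSet hY hkD (by omega) (by omega)), branch_coin hY hk i hc0]
    have hφd : ∀ i y, φ i y ≠ 0 →
        y (BitVec.ofNat w (Y.B + 4 * (k + 1))) = BitVec.ofNat w i.2 := fun i y hy => by
      rw [hφs i y hy _ (not_mem_levelSet hY hkD (by omega) (by omega)), branch_digit hY hk i hd0]
    have hinj : ∀ c c', c < 2 ^ w → c' < 2 ^ w → BitVec.ofNat w c = BitVec.ofNat w c' → c = c' :=
      fun c c' hc hc' h => by by_contra hne; exact ofNat_ne hne hc hc' h
    have hSlt : ∀ i ∈ S, i.1 < 2 ^ w ∧ i.2 < 32 := by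
      intro i hi
      rw [hS, Finset.mem_product, Finset.mem_range, Finset.mem_range] at hi
      exact ⟨hi.1.trans_le (Nat.pow_le_pow_right (by norm_num) hγw), hi.2.trans_le hδ5⟩
    have hdisj : ∀ i ∈ S, ∀ j ∈ S, ∀ y, φ i y ≠ 0 → φ j y ≠ 0 → i = j := by
      intro i hi j hj y h1 h2
      have hi' := hSlt i hi
      have hj' := hSlt j hj
      exact Prod.ext (hinj _ _ hi'.1 hj'.1 ((hφc i y h1).symm.trans (hφc j y h2)))
        (hinj _ _ (by omega) (by omega) ((hφd i y h1).symm.trans (hφd j y h2)))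
    have hpos : ∀ i ∈ S, q + i.2 * 32 ^ k + 32 ^ k ≤ 32 ^ Y.D := by
      intro i hi
      have := Nat.mul_le_mul_right (32 ^ k) (hSlt i hi).2
      rw [Nat.succ_mul] at this
      rw [pow_succ'] at hq
      omega
    have hih := fun i (hi : i ∈ S) => ih hkD _ _ (hpos i hi) (hx.branch hY hk i)
    set ψ := circ L M B (ket x) with hψdef
    have hψs : ∀ y, ψ y ≠ 0 → ∃ i ∈ S, φ i y ≠ 0 := by
      intro y hy
      by_contra! hn
      apply hy
      rw [hψ, Pi.smul_apply, Finset.sum_apply, Finset.sum_eq_zero hn, smul_zero]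
    have hsound : ∀ y, ψ y ≠ 0 → Sound L M Y y := by
      intro y hy
      obtain ⟨i, hi, hne⟩ := hψs y hy
      exact (hih i hi).2 y hne
    have hready : ∀ y, ψ y ≠ 0 → Ready l m Y y := fun y hy =>
      hx.ready.congr hY fun b hb => hloc.support_ket x y hy b fun h => hb (levelSet_mono hk h)
    set act : WordMem w → Prop := fun y => y (BitVec.ofNat w (Y.B + 4 * (k + 1) + 1)) ≠ 0#w
    set tot := ∑ d ∈ Finset.range (2 ^ δ), succProb Y.K Y.D (FoundAt L M) k (q + d * 32 ^ k)
    have ha2 : ‖a‖ ^ 2 = (1 / 2) ^ γ * (1 / 2) ^ δ := by rw [ha, norm_inv_sqrt_two_pow, pow_add]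
    have hhalf : ((1 / 2 : ℝ)) ^ γ * 2 ^ γ = 1 := by rw [← mul_pow]; norm_num
    have hp : nsq (restr (FlagSet Y) ψ) = (1 / 2) ^ δ * tot := by
      rw [hψ, nsq_restr_sum S φ _ a hdisj, ha2,
        Finset.sum_congr rfl fun i hi => (hih i hi).1, hS, Finset.sum_product]
      change _ * ∑ _c ∈ Finset.range (2 ^ γ), tot = _
      rw [Finset.sum_const, Finset.card_range, nsmul_eq_mul]
      push_cast
      calc _ = ((1 / 2) ^ γ * 2 ^ γ) * ((1 / 2) ^ δ * tot) := by ring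
        _ = _ := by rw [hhalf, one_mul]
    -- Success in the lower search does not depend on the coins, so suspension removes the exact
    -- fraction 2^-γ of it.
    have hq1 : nsq (restr (fun y => FlagSet Y y ∧ act y) ψ) =
        (1 - (1 / 2) ^ γ) * ((1 / 2) ^ δ * tot) := by
      have hterm : ∀ i ∈ S, nsq (restr (fun y => FlagSet Y y ∧ act y) (φ i)) =
          if i.1 = 0 then 0 else succProb Y.K Y.D (FoundAt L M) k (q + i.2 * 32 ^ k) := by
        intro i hi
        by_cases h0 : i.1 = 0
        · rw [if_pos h0]
          refine Finset.sum_eq_zero fun y _ => ?_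
          by_cases hy : φ i y = 0
          · simp [restr, hy]
          · have := hφc i y hy
            rw [h0] at this
            simp [restr, act, this]
        · rw [if_neg h0, ← (hih i hi).1]
          congr 1
          refine restr_congr fun y hy => and_iff_left ?_
          simp only [act]
          rw [hφc i y hy]
          exact ofNat_ne h0 (hSlt i hi).1 (by positivity)
      rw [hψ, nsq_restr_sum S φ _ a hdisj, ha2, Finset.sum_congr rfl hterm, hS, Finset.sum_product]
      have hin : ∀ c ∈ Finset.range (2 ^ γ), (∑ d ∈ Finset.range (2 ^ δ),
          if c = 0 then 0 else succProb Y.K Y.D (FoundAt L M) k (q + d * 32 ^ k)) =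
          tot - if c = 0 then tot else 0 := by
        intro c _
        by_cases h0 : c = 0 <;> simp [h0, tot]
      rw [Finset.sum_congr rfl hin, Finset.sum_sub_distrib, Finset.sum_const, Finset.card_range,
        Finset.sum_ite_eq' , if_pos (Finset.mem_range.2 (by positivity)), nsmul_eq_mul]
      push_cast
      calc _ = ((1 / 2) ^ γ * 2 ^ γ) * ((1 / 2) ^ δ * tot) - (1 / 2) ^ γ * ((1 / 2) ^ δ * tot) := by
            ring
        _ = _ := by rw [hhalf]; ring
    have hamp := circ_amplify L M (S := zeroG Y (k + 1)) (G := signG Y (k + 1)) hloc (x := x)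
      (circ_signBlock L M hY.pos (zeroC_isPerm _) _) (fun y hy => zero_iff hY hk hx hy)
      (circ_signBlock L M hY.pos (signC_isPerm _) _)
    rw [← hψdef, restr_congr (h := fun y => FlagSet Y y ∧ act y)
      fun y hy => sign_iff hY hk (hready y hy) (hsound y hy)] at hamp
    rw [show searchLevelG Y (k + 1) = B ++ signG Y (k + 1) ++ B.reverse ++ zeroG Y (k + 1) ++ B
      from rfl, hamp]
    constructor
    · have hcast : (1 - 4 * (nsq (restr (fun y => FlagSet Y y ∧ act y) ψ) : ℂ)) =
          ((1 - 4 * nsq (restr (fun y => FlagSet Y y ∧ act y) ψ) : ℝ) : ℂ) := by push_cast; rfl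
      rw [hcast, nsq_restr_amplified, hp, hq1, succProb, amplified]
      ring
    -- The amplified state combines ψ with a restriction of ψ, so no basis state outside the support
    -- of ψ appears.
    · intro y hy
      refine hsound y fun h0 => hy ?_
      simp [restr, h0]

end step

/-! ## Rounds of search -/

section rounds
variable {w l m : ℕ} {L : Fin l → ℤ} {M : Fin m → ℤ} {Y : Layout}

theorem circ_support_of_isPerm {gs : List (Gate w)} (h : ∀ g ∈ gs, g.IsPerm) {φ : QState w}
    {P Q : WordMem w → Prop} (hφ : ∀ y, φ y ≠ 0 → P y) (hPQ : ∀ y, P y → Q (run L M gs y)) :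
    ∀ y, circ L M gs φ y ≠ 0 → Q y := by
  intro y hy
  rw [circ_of_isPerm L M h] at hy
  have := hPQ _ (hφ _ hy)
  have e := run_reverse_run L M gs.reverse y
  rw [List.reverse_reverse] at e
  rwa [e] at this

theorem circ_eq_self_of_isPerm {gs : List (Gate w)} (h : ∀ g ∈ gs, g.IsPerm) {φ : QState w}
    (hφ : ∀ y, φ y ≠ 0 → run L M gs y = y) : circ L M gs φ = φ := by
  rw [circ_of_isPerm L M h]
  funext y
  have e := run_reverse_run L M gs.reverse y
  rw [List.reverse_reverse] at e
  have e' := run_reverse_run L M gs y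
  by_cases hy : φ y = 0
  · by_contra hne
    rw [hy] at hne
    have h1 := hφ _ hne
    rw [e] at h1
    rw [Function.comp, ← h1] at hne
    exact hne hy
  · rw [hφ y hy] at e'
    rw [Function.comp, e']

/-- The new flag is the OR of the old flag and the new find. The found entry is masked out if a
record exists already, so an older answer is passed on undamaged. -/
theorem run_recordG (hY : Y.Fits w l m) {R : ℕ} (hR : R + 3 < Y.C) {y : WordMem w}
    (hy : Ready l m Y y) :
    run L M (recordG Y R) y = xorAt (xorAt y (BitVec.ofNat w R)
      (y (BitVec.ofNat w (R + 2)) ||| y (BitVec.ofNat w Y.B))) (BitVec.ofNat w (R + 1))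
      (y (BitVec.ofNat w (R + 3)) ||| (y (BitVec.ofNat w (Y.B + 1)) &&&
        (0#w - if y (BitVec.ofNat w (R + 2)) = 0#w then 1#w else 0#w))) := by
  have hC := hY.hC
  have hB := hY.hB
  have hT := hY.hT
  have hs := hy.scratch
  rw [recordG, run_xorBlock L M (by apply ofNat_ne <;> omega) (by apply ofNat_ne <;> omega)
    (by apply ofNat_ne <;> omega) (recordC_avoids hY hR (by omega) (by omega))
    (recordC_avoids hY hR (by omega) (by omega))]
  congr 1
  · congr 1
    simp (disch := omega) only [recordC, run_cons, run_nil, map_gOp, xorAt_same, xorAt_ofNat_ne,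
      hs, BitVec.zero_xor, WordOp.eval]
  · simp (disch := omega) only [recordC, run_cons, run_nil, map_gOp, xorAt_same, xorAt_ofNat_ne,
      hs, BitVec.zero_xor, WordOp.eval]

variable (L M) in
/-- The record at the words `2 n` and `2 n + 1` holds a right answer. -/
structure Recorded (Y : Layout) (n : ℕ) (y : WordMem w) : Prop where
  ready : Ready l m Y y
  done : y (BitVec.ofNat w (2 * n)) ≠ 0#w
  answer : IsAnswer L M (some (y (BitVec.ofNat w (2 * n + 1))).toInt)
  zero : ∀ k < 2 * n, y (BitVec.ofNat w k) = 0#w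

theorem Ready.xorAt_record (hY : Y.Fits w l m) {R : ℕ} (hR : R + 3 < Y.C) {y : WordMem w}
    (hy : Ready l m Y y) (u v : BitVec w) :
    Ready l m Y (xorAt (xorAt y (BitVec.ofNat w R) u) (BitVec.ofNat w (R + 1)) v) := by
  have hC := hY.hC
  have hB := hY.hB
  have hT := hY.hT
  refine ⟨?_, ?_, ?_, fun n hn hn' => ?_⟩ <;>
    (rw [xorAt_ofNat_ne _ _ (by omega) (by omega) (by omega),
      xorAt_ofNat_ne _ _ (by omega) (by omega) (by omega)])
  · exact hy.one
  · exact hy.len₁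
  · exact hy.len₂
  · exact hy.scratch n hn hn'

theorem Recorded.run_recordG (hY : Y.Fits w l m) {n : ℕ} (hn : 2 * n + 3 < Y.C) {y : WordMem w}
    (hy : Recorded L M Y (n + 1) y) : Recorded L M Y n (run L M (recordG Y (2 * n)) y) := by
  have hC := hY.hC
  have hB := hY.hB
  have hT := hY.hT
  have hd := hy.done
  have ha := hy.answer
  rw [show 2 * (n + 1) = 2 * n + 2 by ring] at hd
  rw [show 2 * (n + 1) + 1 = 2 * n + 3 by ring] at ha
  have h0 := hy.zero (2 * n) (by omega)
  have h1 := hy.zero (2 * n + 1) (by omega)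
  rw [_root_.run_recordG hY hn hy.ready, if_neg hd]
  refine ⟨hy.ready.xorAt_record hY hn _ _, ?_, ?_, fun k hk => ?_⟩
  · rw [xorAt_ofNat_ne _ _ (by omega) (by omega) (by omega), xorAt_same, h0, BitVec.zero_xor]
    exact fun h => hd (BitVec.or_eq_zero_iff.1 h).1
  · rw [xorAt_same, xorAt_ofNat_ne _ _ (by omega) (by omega) (by omega), h1, BitVec.zero_xor]
    simpa using ha
  · rw [xorAt_ofNat_ne _ _ (by omega) (by omega) (by omega),
      xorAt_ofNat_ne _ _ (by omega) (by omega) (by omega), hy.zero k (by omega)]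

theorem Sound.recorded_run_recordG (hY : Y.Fits w l m) {n : ℕ} (hn : 2 * n + 3 < Y.C)
    {y : WordMem w} (hy : Sound L M Y y) (hr : Ready l m Y y)
    (hz : ∀ k < Y.C, y (BitVec.ofNat w k) = 0#w) (hf : FlagSet Y y) :
    Recorded L M Y n (run L M (recordG Y (2 * n)) y) := by
  have hC := hY.hC
  have hB := hY.hB
  have hT := hY.hT
  rw [run_recordG hY hn hr, if_pos (hz (2 * n + 2) (by omega)), hz (2 * n + 2) (by omega),
    hz (2 * n + 3) (by omega), zero_sub_one_and, BitVec.zero_or, BitVec.zero_or]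
  rcases hy with ⟨h, _⟩ | ⟨_, ha⟩
  · exact absurd h hf
  refine ⟨hr.xorAt_record hY hn _ _, ?_, ?_, fun k hk => ?_⟩
  · rw [xorAt_ofNat_ne _ _ (by omega) (by omega) (by omega), xorAt_same, hz _ (by omega),
      BitVec.zero_xor]
    exact hf
  · rw [xorAt_same, xorAt_ofNat_ne _ _ (by omega) (by omega) (by omega), hz _ (by omega),
      BitVec.zero_xor]
    exact ha
  · rw [xorAt_ofNat_ne _ _ (by omega) (by omega) (by omega),
      xorAt_ofNat_ne _ _ (by omega) (by omega) (by omega), hz k (by omega)]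

/-- The entry word vanishes together with the flag, so recording leaves the failed part of the state
untouched and undoing the search still acts on it coherently. -/
theorem Sound.run_recordG_eq_self (hY : Y.Fits w l m) {n : ℕ} (hn : 2 * n + 3 < Y.C)
    {y : WordMem w} (hy : Sound L M Y y) (hr : Ready l m Y y)
    (hz : ∀ k < Y.C, y (BitVec.ofNat w k) = 0#w) (hf : ¬ FlagSet Y y) :
    run L M (recordG Y (2 * n)) y = y := by
  rcases hy with ⟨h1, h2⟩ | ⟨h, _⟩
  · rw [run_recordG hY hn hr, h1, h2, hz (2 * n + 2) (by omega), hz (2 * n + 3) (by omega)]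
    simp [xorAt_zero]
  · have h0 : y (BitVec.ofNat w Y.B) = 0#w := not_not.1 hf
    have hw := hY.pos
    rw [h0] at h
    have := congrArg (fun v => v.getLsbD 0) h
    simp [hw] at this

theorem Recorded.congr (hY : Y.Fits w l m) {n : ℕ} (hn : 2 * n + 1 < Y.C) {x y : WordMem w}
    (h : ∀ a, a ∉ levelSet w Y Y.D → x a = y a) (hx : Recorded L M Y n x) :
    Recorded L M Y n y := by
  have hC := hY.hC
  have hB := hY.hB
  have hT := hY.hT
  have h' : ∀ k < Y.C, y (BitVec.ofNat w k) = x (BitVec.ofNat w k) := fun k hk =>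
    (h _ (not_mem_levelSet hY le_rfl (by omega) (by omega))).symm
  refine ⟨hx.ready.congr hY fun a ha => (h a ha).symm, ?_, ?_, fun k hk => ?_⟩
  · rw [h' _ (by omega)]; exact hx.done
  · rw [h' _ (by omega)]; exact hx.answer
  · rw [h' _ (by omega)]; exact hx.zero k hk

theorem recorded_congr (hY : Y.Fits w l m) {n : ℕ} (hn : 2 * n + 1 < Y.C) (x y : WordMem w)
    (h : ∀ a, a ∉ levelSet w Y Y.D → x a = y a) : Recorded L M Y n x ↔ Recorded L M Y n y :=
  ⟨Recorded.congr hY hn h, Recorded.congr hY hn fun a ha => (h a ha).symm⟩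

theorem restr_add_restr_not (g : WordMem w → Prop) (ψ : QState w) :
    restr g ψ + restr (fun y => ¬ g y) ψ = ψ := by
  funext y
  by_cases h : g y <;> simp [restr, h]

theorem nsq_restr_add_nsq_restr_not (g : WordMem w → Prop) (ψ : QState w) :
    nsq (restr g ψ) + nsq (restr (fun y => ¬ g y) ψ) = nsq ψ := by
  rw [nsq, nsq, nsq, ← Finset.sum_add_distrib]
  refine Finset.sum_congr rfl fun y _ => ?_
  by_cases h : g y <;> simp [restr, h]

theorem nsq_smul (a : ℂ) (ψ : QState w) : nsq (a • ψ) = ‖a‖ ^ 2 * nsq ψ := by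
  simp [nsq, mul_pow, Finset.mul_sum]

theorem ip_smul_right (a : ℂ) (ψ φ : QState w) : ip ψ (a • φ) = a * ip ψ φ := by
  simp only [ip, Finset.mul_sum, Pi.smul_apply, smul_eq_mul]
  exact Finset.sum_congr rfl fun y _ => by ring

variable (L M) in
/-- A state before a round: a part without a record, with amplitude `c` for not finding an answer, and
a part with a right answer recorded. -/
def RoundState (Y : Layout) (x : WordMem w) (n : ℕ) (c b : ℝ) (Φ : QState w) : Prop :=
  ∃ (N G : QState w) (α β : ℂ), Φ = N + G ∧ α + β = c ∧ nsq N = b ∧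
    circ L M (searchLevelG Y Y.D) N = α • circ L M (searchLevelG Y Y.D) (ket x) +
      β • restr (fun y => ¬ FlagSet Y y) (circ L M (searchLevelG Y Y.D) (ket x)) ∧
    (∀ y, N y ≠ 0 → ∀ a, a ∉ levelSet w Y Y.D → y a = x a) ∧
    ∀ y, G y ≠ 0 → Recorded L M Y n y

/-- After the search the unrecorded part is α times the good states plus c = α + β times the bad
ones. Recording moves the good part into G and leaves c·bad, of weight c²(1 - p). Undoing the search
alone would make the next search fail again with certainty; the reflection mixes the start state in
and restores a good component. -/
theorem RoundState.round (hY : Y.Fits w l m) {x : WordMem w} (hx : Context L M Y Y.D 0 x)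
    (hxz : ∀ k < Y.C, x (BitVec.ofNat w k) = 0#w) {p : ℝ}
    (hp : nsq (restr (FlagSet Y) (circ L M (searchLevelG Y Y.D) (ket x))) = p)
    (hs : ∀ y, circ L M (searchLevelG Y Y.D) (ket x) y ≠ 0 → Sound L M Y y)
    {n : ℕ} (hn : 2 * n + 3 < Y.C) {c b : ℝ} {Φ : QState w}
    (h : RoundState L M Y x (n + 1) c b Φ) :
    RoundState L M Y x n ((2 * p - 1) * c) (c ^ 2 * (1 - p)) (circ L M (roundG Y (2 * n)) Φ) := by
  have hC := hY.hC
  have hB := hY.hB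
  have hT := hY.hT
  obtain ⟨N, G, α, β, rfl, hc, -, hAN, hN, hG⟩ := h
  set A : List (Gate w) := searchLevelG Y Y.D with hA
  set ψ := circ L M A (ket x) with hψ
  set bad := restr (fun y => ¬ FlagSet Y y) ψ with hbad
  have hloc : Loc L M (levelSet w Y Y.D) A := loc_searchLevelG hY _ le_rfl
  have hψs := hloc.support_ket x
  rw [← hψ] at hψs
  have hψr : ∀ y, ψ y ≠ 0 → Ready l m Y y := fun y hy => hx.ready.congr hY (hψs y hy)
  have hψz : ∀ y, ψ y ≠ 0 → ∀ k < Y.C, y (BitVec.ofNat w k) = 0#w := fun y hy k hk => by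
    rw [hψs y hy _ (not_mem_levelSet hY le_rfl (by omega) (by omega)), hxz k hk]
  have hnb : nsq bad = 1 - p := by
    have := nsq_restr_add_nsq_restr_not (FlagSet Y) ψ
    rw [hp] at this
    have h1 : nsq ψ = 1 := by rw [hψ, nsq_circ, nsq_ket]
    linarith
  have hbads : ∀ y, bad y ≠ 0 → ψ y ≠ 0 ∧ ¬ FlagSet Y y := by
    intro y hy
    by_cases hf : FlagSet Y y
    · exact absurd (by simp [hbad, restr, hf]) hy
    · simp only [hbad, restr, hf, not_false_iff, if_true] at hy
      exact ⟨hy, hf⟩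
  set G₁ := α • restr (FlagSet Y) ψ + circ L M A G with hG₁
  have e1 : circ L M A (N + G) = (c : ℂ) • bad + G₁ := by
    have := restr_add_restr_not (FlagSet Y) ψ
    rw [map_add, hAN, ← hc, hG₁]
    nth_rewrite 1 [← this]
    rw [← hbad]
    module
  have hrec := xorBlock_isPerm (w := w) (recordC_isPerm (Y := Y) (2 * n))
  have e2 : circ L M (recordG Y (2 * n)) bad = bad :=
    circ_eq_self_of_isPerm (hrec _ _ _ _) fun y hy =>
      (hs y (hbads y hy).1).run_recordG_eq_self hY hn (hψr y (hbads y hy).1)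
        (hψz y (hbads y hy).1) (hbads y hy).2
  have hG₁s : ∀ y, G₁ y ≠ 0 → (ψ y ≠ 0 ∧ FlagSet Y y) ∨ Recorded L M Y (n + 1) y := by
    intro y hy
    by_cases h0 : circ L M A G y = 0
    · left
      by_cases hf : FlagSet Y y
      · refine ⟨fun h => hy ?_, hf⟩
        simp [hG₁, restr, h, h0]
      · exact absurd (by simp [hG₁, restr, hf, h0]) hy
    · exact Or.inr (hloc.support (recorded_congr hY (by omega)) hG y h0)
  have hG₂ : ∀ y, circ L M (recordG Y (2 * n)) G₁ y ≠ 0 → Recorded L M Y n y := by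
    refine circ_support_of_isPerm (hrec _ _ _ _) hG₁s fun y hy => ?_
    rcases hy with ⟨h1, h2⟩ | h
    · exact (hs y h1).recorded_run_recordG hY hn (hψr y h1) (hψz y h1) h2
    · exact h.run_recordG hY hn
  have hzl : Loc L M (levelSet w Y Y.D) (zeroG Y Y.D) := loc_zeroG hY _ _
  have hcb : ∀ y, ((c : ℂ) • bad) y ≠ 0 → ∀ a, a ∉ levelSet w Y Y.D → y a = x a := by
    intro y hy
    refine hψs y (hbads y fun h => hy ?_).1
    simp [h]
  have hrefl := circ_reflect L M (S := zeroG Y Y.D) hloc (x := x)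
    (circ_signBlock L M hY.pos (zeroC_isPerm _) _) (fun y hy => zero_iff hY le_rfl hx hy) hcb
  -- The reflection subtracts twice the inner product ⟨ψ, c·bad⟩ = c(1 - p) times the start state.
  -- So the next search gives -2c(1 - p)ψ + c·bad, and the two coefficients add up to (2p - 1)c.
  refine ⟨circ L M (zeroG Y Y.D) (circ L M A.reverse ((c : ℂ) • bad)),
    circ L M (zeroG Y Y.D) (circ L M A.reverse (circ L M (recordG Y (2 * n)) G₁)),
    -(2 * c * (1 - p)), c, ?_, ?_, ?_, ?_, ?_, ?_⟩
  · rw [roundG, circ_append, circ_append, circ_append, ← hA, e1, map_add, map_smul, e2, map_add,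
      map_add]
  · push_cast; ring
  · rw [nsq_circ, nsq_circ, nsq_smul, hnb, Complex.norm_real, Real.norm_eq_abs, sq_abs]
  · rw [hrefl, map_sub, circ_circ_reverse, map_smul, ← hψ, ip_smul_right, hbad, ip_restr, ← hbad,
      hnb]
    push_cast
    module
  · have hcong : ∀ y z : WordMem w, (∀ a, a ∉ levelSet w Y Y.D → y a = z a) →
        ((∀ a, a ∉ levelSet w Y Y.D → y a = x a) ↔ ∀ a, a ∉ levelSet w Y Y.D → z a = x a) :=
      fun y z h => forall_congr' fun a => imp_congr_right fun ha => by rw [h a ha]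
    exact hzl.support hcong (hloc.reverse.support hcong hcb)
  · exact hzl.support (recorded_congr hY (by omega))
      (hloc.reverse.support (recorded_congr hY (by omega)) hG₂)

theorem RoundState.rounds (hY : Y.Fits w l m) {x : WordMem w} (hx : Context L M Y Y.D 0 x)
    (hxz : ∀ k < Y.C, x (BitVec.ofNat w k) = 0#w) {p : ℝ}
    (hp : nsq (restr (FlagSet Y) (circ L M (searchLevelG Y Y.D) (ket x))) = p)
    (hs : ∀ y, circ L M (searchLevelG Y Y.D) (ket x) y ≠ 0 → Sound L M Y y) (n : ℕ) :
    2 * n + 3 < Y.C → ∀ {c b : ℝ} {Φ : QState w}, RoundState L M Y x (n + 1) c b Φ →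
    RoundState L M Y x 0 ((2 * p - 1) ^ (n + 1) * c) (((2 * p - 1) ^ n * c) ^ 2 * (1 - p))
      (circ L M (roundsG Y (n + 1)) Φ) := by
  induction n with
  | zero =>
    intro hn c b Φ h
    have := h.round hY hx hxz hp hs hn
    simpa [roundsG] using this
  | succ n ih =>
    intro hn c b Φ h
    have := ih (by omega) (h.round hY hx hxz hp hs hn)
    rw [roundsG, circ_append]
    convert this using 1 <;> ring

/-- For p ≥ 2/3 the factor 1 - p is small enough by itself. For c ≤ p < 2/3 one has (2p - 1)² ≤ 1 -
c, and its powers decay. One n serves all p, so the number of rounds can be built into the program.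
-/
theorem exists_rounds {c : ℝ} (hc : 0 < c) (hc' : c ≤ 1 / 4) :
    ∃ n : ℕ, ∀ p, c ≤ p → p ≤ 1 → ((2 * p - 1) ^ n) ^ 2 * (1 - p) ≤ 1 / 3 := by
  obtain ⟨n, hn⟩ := exists_pow_lt_of_lt_one (show (0 : ℝ) < 1 / 3 by norm_num)
    (show 1 - c < 1 by linarith)
  refine ⟨n, fun p h1 h2 => ?_⟩
  have h3 : 0 ≤ 1 - p := by linarith
  rw [← pow_mul, mul_comm n 2, pow_mul]
  have h0 : 0 ≤ (2 * p - 1) ^ 2 := sq_nonneg _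
  by_cases hp : 2 / 3 ≤ p
  · have : ((2 * p - 1) ^ 2) ^ n ≤ 1 := pow_le_one₀ h0 (by nlinarith)
    nlinarith [pow_nonneg h0 n]
  · push Not at hp
    have h4 : (2 * p - 1) ^ 2 ≤ 1 - c := by nlinarith
    have h5 : ((2 * p - 1) ^ 2) ^ n ≤ (1 - c) ^ n := pow_le_pow_left₀ h0 h4 n
    have h6 := pow_nonneg h0 n
    nlinarith

/-- Word 0 is zero on the support of N and nonzero on that of G, so the two parts do not interfere.
If a common integer exists, the success probability is at least the weight of G, which is 1 minus
that of N. If none exists, nothing can have been recorded, G vanishes, and "not found" is output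
with certainty. -/
theorem circuitSuccess_mainG (hY : Y.Fits w l m) (hL : Monotone L) (hM : Monotone M)
    (fL : FitsIn w L) (fM : FitsIn w M) {n : ℕ} (hn : 2 * n + 3 < Y.C) (hKD : Y.K ≤ Y.D)
    (h1 : 9 ^ Y.D ≤ 9 * 32 ^ Y.K) (h2 : 32 ^ Y.K ≤ 32 * 9 ^ Y.D) (h3 : l + m ≤ 32 ^ Y.K)
    (hrounds : ∀ p : ℝ, 1 / 16384 ≤ p → p ≤ 1 → ((2 * p - 1) ^ n) ^ 2 * (1 - p) ≤ 1 / 3) :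
    2 / 3 ≤ circuitSuccess L M (mainG (w := w) Y (n + 1) l m) := by
  classical
  have hC := hY.hC
  have hB := hY.hB
  have hT := hY.hT
  set I : List (Gate w) := [gImm 1 Y.C, gImm l (Y.C + 1), gImm m (Y.C + 2)] with hI
  set x := run L M I fun _ => 0#w with hx
  have hI' : ∀ g ∈ I, g.IsPerm := forall_mem_cons_of trivial (forall_mem_cons_of trivial
    (forall_mem_cons_of trivial fun _ h => absurd h List.not_mem_nil))
  have hx0 : ∀ k, k < 2 ^ w → (k < Y.C ∨ Y.C + 2 < k) → x (BitVec.ofNat w k) = 0#w := by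
    intro k hk hk'
    simp (disch := omega) only [hx, hI, run_cons, run_nil, map_gImm, xorAt_ofNat_ne]
  have hctx : Context L M Y Y.D 0 x := by
    refine ⟨⟨?_, ?_, ?_, fun n hn hn' => hx0 n hn' (by omega)⟩, fun n hn => hx0 _ (by omega)
      (by omega), hx0 _ (by omega) (by omega), ?_⟩
    · simp (disch := omega) only [hx, hI, run_cons, run_nil, map_gImm, xorAt_ofNat_ne, xorAt_same,
        BitVec.zero_xor]
    · simp (disch := omega) only [hx, hI, run_cons, run_nil, map_gImm, xorAt_ofNat_ne, xorAt_same,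
        BitVec.zero_xor]
    · simp (disch := omega) only [hx, hI, run_cons, run_nil, map_gImm, xorAt_ofNat_ne, xorAt_same,
        BitVec.zero_xor]
    · rw [splitPos_zero hL hM]; exact hx0 _ (by omega) (by omega)
  have hxz : ∀ k < Y.C, x (BitVec.ofNat w k) = 0#w := fun k hk => hx0 k (by omega) (by omega)
  have hspec := searchLevelG_spec hY hL hM fL fM Y.D le_rfl 0 x (by omega) hctx
  have hstart : RoundState L M Y x (n + 1) 1 1 (ket x) := by
    refine ⟨ket x, 0, 1, 0, by simp, by simp, nsq_ket x, by simp, ?_, ?_⟩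
    · intro y hy a _
      have : y = x := by by_contra hne; exact hy (ket_ne hne)
      rw [this]
    · intro y hy; simp at hy
  obtain ⟨N, G, α, β, hΦ, -, hN, -, hNs, hG⟩ :=
    hstart.rounds hY hctx hxz hspec.1 hspec.2 n hn
  have hstate : circuitState L M (mainG Y (n + 1) l m) = N + G := by
    rw [circuitState_eq, mainG, circ_append, ← hI, circ_ket_of_isPerm L M hI', ← hx, hΦ]
  have hnorm : nsq (N + G) = 1 := by
    rw [← hstate, circuitState_eq, nsq_circ, nsq_ket]
  have hN0 : ∀ y, N y ≠ 0 → y 0#w = 0#w := by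
    intro y hy
    have := hNs y hy (BitVec.ofNat w 0) (not_mem_levelSet hY le_rfl (by omega) (by omega))
    rw [hxz 0 (by omega)] at this
    exact this
  rw [circuitSuccess, hstate]
  by_cases hcommon : ∃ i j, L i = M j
  · obtain ⟨p₀, hp₀, hf⟩ := exists_foundAt hL hM hcommon
    have hlow := const_le_succProb (FoundAt L M) hKD h1 h2 (hp₀.trans_le h3) hf
    have hup : succProb Y.K Y.D (FoundAt L M) Y.D 0 ≤ 1 := by
      rw [← hspec.1]
      have h4 := nsq_restr_add_nsq_restr_not (FlagSet Y)
        (circ L M (searchLevelG Y Y.D) (ket x))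
      rw [nsq_circ, nsq_ket] at h4
      have h5 : 0 ≤ nsq (restr (fun y => ¬ FlagSet Y y)
          (circ L M (searchLevelG Y Y.D) (ket x))) :=
        Finset.sum_nonneg fun y _ => sq_nonneg _
      linarith
    have hfail := hrounds _ hlow hup
    rw [mul_one] at hN
    rw [← hN] at hfail
    have hsplit : nsq (N + G) = nsq N + nsq G := by
      rw [nsq, nsq, nsq, ← Finset.sum_add_distrib]
      refine Finset.sum_congr rfl fun y _ => ?_
      by_cases h4 : N y = 0
      · simp [h4]
      · by_cases h5 : G y = 0
        · simp [h5]
        · exact absurd (hN0 y h4) (hG y h5).done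
    have hle : nsq G ≤ ∑ y, if IsAnswer L M (readOutput y) then ‖(N + G) y‖ ^ 2 else 0 := by
      refine Finset.sum_le_sum fun y _ => ?_
      by_cases h5 : G y = 0
      · have h6 : ‖G y‖ ^ 2 = 0 := by simp [h5]
        rw [h6]
        split
        exacts [sq_nonneg _, le_rfl]
      · have hr := hG y h5
        have hd : y 0#w ≠ 0#w := hr.done
        have hz : N y = 0 := by by_contra h4; exact hd (hN0 y h4)
        have ha : IsAnswer L M (readOutput y) := by
          rw [readOutput, if_neg hd]; exact hr.answer
        rw [if_pos ha, Pi.add_apply, hz, zero_add]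
    refine le_trans ?_ hle
    linarith
  · have hnone : IsAnswer L M none := fun i j e => hcommon ⟨i, j, e⟩
    have hG0 : ∀ y, G y = 0 := by
      intro y
      by_contra hne
      obtain ⟨⟨i, hi⟩, ⟨j, hj⟩⟩ := (hG y hne).answer
      exact hcommon ⟨i, j, hi.trans hj.symm⟩
    have : nsq (N + G) = ∑ y, if IsAnswer L M (readOutput y) then ‖(N + G) y‖ ^ 2 else 0 := by
      refine Finset.sum_congr rfl fun y _ => ?_
      by_cases h4 : N y = 0
      · simp [h4, hG0 y]
      · rw [if_pos]
        rw [readOutput, if_pos (hN0 y h4)]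
        exact hnone
    rw [← this, hnorm]
    norm_num

end rounds

/-! ## Reasoning about programs -/

section programs

/-- Numbers in the first twelve registers; register `7` is zero. -/
structure Regs : Type where
  l : ℕ
  m : ℕ
  k : ℕ
  T : ℕ
  K : ℕ
  D : ℕ
  R : ℕ
  X : ℕ
  n : ℕ
  p : ℕ
  q : ℕ

namespace Regs

/-- The number in register `r`. -/
def get (e : Regs) : ℕ → ℕ
  | 0 => e.l
  | 1 => e.m
  | 2 => e.k
  | 3 => e.T
  | 4 => e.K
  | 5 => e.D
  | 6 => e.R
  | 8 => e.X
  | 9 => e.n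
  | 10 => e.p
  | 11 => e.q
  | _ => 0

/-- Puts the number `v` into register `r`. -/
def put (e : Regs) (r v : ℕ) : Regs :=
  match r with
  | 0 => { e with l := v }
  | 1 => { e with m := v }
  | 2 => { e with k := v }
  | 3 => { e with T := v }
  | 4 => { e with K := v }
  | 5 => { e with D := v }
  | 6 => { e with R := v }
  | 8 => { e with X := v }
  | 9 => { e with n := v }
  | 10 => { e with p := v }
  | 11 => { e with q := v }
  | _ => e

theorem get_put (e : Regs) {r a : ℕ} (hr : r < 12 ∧ r ≠ 7) (v : ℕ) (ha : a < 12) :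
    (e.put r v).get a = if a = r then v else e.get a := by
  obtain ⟨hr, h7⟩ := hr
  interval_cases r <;> interval_cases a <;> first | rfl | exact absurd rfl h7

/-- The registers below `N` hold the numbers given by `e`. -/
def Rep {w : ℕ} (e : Regs) (N : ℕ) (s : Control w) : Prop :=
  ∀ r, r < N → r < 12 → s.reg r = BitVec.ofNat w (e.get r)

variable {w N : ℕ} {e : Regs} {s : Control w}

theorem Rep.set (h : e.Rep N s) {r : ℕ} (hr : r < 12 ∧ r ≠ 7) (v : ℕ) :
    (e.put r v).Rep N (s.set r (BitVec.ofNat w v)) := by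
  intro a ha ha'
  rw [get_put e hr v ha']
  by_cases h1 : a = r
  · rw [h1]; simp [Control.set]
  · simp [Control.set, h1, h a ha ha']

theorem Rep.scratch (h : e.Rep N s) {r : ℕ} (hr : 12 ≤ r) (v : BitVec w) :
    e.Rep N (s.set r v) := by
  intro a ha ha'
  simp [Control.set, Function.update_of_ne (show a ≠ r by omega), h a ha ha']

end Regs

/-- Started with the numbers `e` in the registers below `N`, the command stops after at most `T`
steps with the numbers `e'` in these registers, and applies the gates `gs`. -/
def Does {w : ℕ} (P : Program) (N : ℕ) (c : Cmd) (e : Regs) (gs : List (Gate w)) (T : ℕ)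
    (e' : Regs) : Prop :=
  ∀ s : Control w, e.Rep N s → ∃ s' t, Exec P c s gs t s' ∧ t ≤ T ∧ e'.Rep N s'

variable {w N T T' : ℕ} {P : Program} {c d : Cmd} {e e' e'' : Regs} {gs hs : List (Gate w)}

theorem Does.of (h : Does P N c e gs T e') (hg : gs = hs) (hT : T ≤ T') (he : e' = e'') :
    Does P N c e hs T' e'' := by
  subst hg he
  intro s hs
  obtain ⟨s', t, h1, h2, h3⟩ := h s hs
  exact ⟨s', t, h1, h2.trans hT, h3⟩

theorem Does.from_eq {e₀ : Regs} (h : Does P N c e₀ gs T e') (he : e₀ = e) :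
    Does P N c e gs T e' :=
  he ▸ h

theorem Does.skip : Does (w := w) P N .skip e [] 1 e :=
  fun s hs => ⟨s, 1, .skip s, le_rfl, hs⟩

theorem Does.seq (h : Does P N c e gs T e') (h' : Does P N d e' hs T' e'') :
    Does P N (.seq c d) e (gs ++ hs) (T + T') e'' := by
  intro s hs
  obtain ⟨s', t, h1, h2, h3⟩ := h s hs
  obtain ⟨s'', u, h4, h5, h6⟩ := h' s' h3
  exact ⟨s'', t + u, .seq h1 h4, Nat.add_le_add h2 h5, h6⟩

theorem Does.adj (h : Does P N c e gs T e') : Does P N (.adj c) e gs.reverse (T + 1) e' := by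
  intro s hs
  obtain ⟨s', t, h1, h2, h3⟩ := h s hs
  exact ⟨s', t + 1, .adj h1, Nat.succ_le_succ h2, h3⟩

theorem Does.call {p : ℕ} (h : Does P N (P.getD p .skip) e gs T e') :
    Does P N (.call p) e gs (T + 1) e' := by
  intro s hs
  obtain ⟨s', t, h1, h2, h3⟩ := h s hs
  exact ⟨s', t + 1, .call h1, Nat.succ_le_succ h2, h3⟩

theorem ofNat_ne_zero {v : ℕ} (h : v ≠ 0) (hv : v < 2 ^ w) : BitVec.ofNat w v ≠ 0#w :=
  ofNat_ne h hv (by positivity)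

theorem Does.cond_true {r : ℕ} (hr : r < N ∧ r < 12) (h0 : e.get r ≠ 0) (hw : e.get r < 2 ^ w)
    (h : Does P N c e gs T e') : Does P N (.cond r c d) e gs (T + 1) e' := by
  intro s hs
  obtain ⟨s', t, h1, h2, h3⟩ := h s hs
  exact ⟨s', t + 1, .cond_true (by rw [hs r hr.1 hr.2]; exact ofNat_ne_zero h0 hw) h1,
    Nat.succ_le_succ h2, h3⟩

theorem Does.cond_false {r : ℕ} (hr : r < N ∧ r < 12) (h0 : e.get r = 0)
    (h : Does P N d e gs T e') : Does P N (.cond r c d) e gs (T + 1) e' := by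
  intro s hs
  obtain ⟨s', t, h1, h2, h3⟩ := h s hs
  exact ⟨s', t + 1, .cond_false (by rw [hs r hr.1 hr.2, h0]) h1, Nat.succ_le_succ h2, h3⟩

/-- A loop that counts down: `E i` are the numbers in the registers and `G i` the gates still to be
applied when `i` iterations are left. -/
theorem Does.loop {r : ℕ} (hr : r < N ∧ r < 12) (n : ℕ) (E : ℕ → Regs) (G : ℕ → List (Gate w))
    (g : ℕ → List (Gate w)) (h0 : (E 0).get r = 0) (hG0 : G 0 = [])
    (hE : ∀ i < n, (E (i + 1)).get r ≠ 0 ∧ (E (i + 1)).get r < 2 ^ w)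
    (hG : ∀ i < n, G (i + 1) = g i ++ G i)
    (h : ∀ i < n, Does P N c (E (i + 1)) (g i) T (E i)) :
    Does P N (.loop r c) (E n) (G n) ((T + 1) * n + 1) (E 0) := by
  induction n with
  | zero =>
    intro s hs
    rw [hG0]
    refine ⟨s, 1, ?_, by simp, hs⟩
    constructor
    rw [hs r hr.1 hr.2, h0]
  | succ n ih =>
    intro s hs
    obtain ⟨s', t, h1, h2, h3⟩ := h n n.lt_succ_self s hs
    obtain ⟨s'', u, h4, h5, h6⟩ := ih (fun i hi => hE i (hi.trans n.lt_succ_self))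
      (fun i hi => hG i (hi.trans n.lt_succ_self)) (fun i hi => h i (hi.trans n.lt_succ_self)) s' h3
    refine ⟨s'', t + u + 1, ?_, ?_, h6⟩
    · rw [hG n n.lt_succ_self]
      obtain ⟨h7, h8⟩ := hE n n.lt_succ_self
      exact .loop_step (by rw [hs r hr.1 hr.2]; exact ofNat_ne_zero h7 h8) h1 h4
    · rw [mul_add, mul_one]; omega

/-- A command that works whatever is in the registers from `8` on. -/
theorem Does.of_temporaries
    (h : ∀ X n p q, ∃ X' n' p' q', Does P 12 c { e with X := X, n := n, p := p, q := q } gs T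
      { e' with X := X', n := n', p := p', q := q' }) : Does P 8 c e gs T e' := by
  intro s hs
  obtain ⟨X', n', p', q', h1⟩ := h (s.reg 8).toNat (s.reg 9).toNat (s.reg 10).toNat
    (s.reg 11).toNat
  obtain ⟨s', t, h2, h3, h4⟩ := h1 s (by
    intro r _ hr
    by_cases h8 : r < 8
    · rw [hs r h8 hr]
      interval_cases r <;> rfl
    · interval_cases r <;> first | omega | simp [Regs.get])
  refine ⟨s', t, h2, h3, fun r h8 hr => ?_⟩
  rw [h4 r hr hr]
  interval_cases r <;> rfl

/-! ### Classical instructions -/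

theorem Does.const (r n : ℕ) (hr : r < 12 ∧ r ≠ 7 := by decide) :
    Does (w := w) P N (.const r n) e [] 1 (e.put r n) :=
  fun s hs => ⟨_, 1, .const r n s, le_rfl, hs.set hr n⟩

theorem Does.arith {o : WordOp} {r a b v : ℕ} (hr : r < 12 ∧ r ≠ 7) (ha : a < N ∧ a < 12)
    (hb : b < N ∧ b < 12)
    (hv : o.eval (BitVec.ofNat w (e.get a)) (BitVec.ofNat w (e.get b)) = BitVec.ofNat w v) :
    Does (w := w) P N (.arith o r a b) e [] 1 (e.put r v) := by
  intro s hs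
  refine ⟨_, 1, .arith o r a b s, le_rfl, ?_⟩
  rw [hs a ha.1 ha.2, hs b hb.1 hb.2, hv]
  exact hs.set hr v

/-- An arithmetic instruction with a literal. -/
def Cmd.arithI (o : WordOp) (r a n : ℕ) : Cmd := .seq (.const 12 n) (.arith o r a 12)

theorem Does.arithI {o : WordOp} {r a n v : ℕ} (hr : r < 12 ∧ r ≠ 7) (ha : a < N ∧ a < 12)
    (hv : o.eval (BitVec.ofNat w (e.get a)) (BitVec.ofNat w n) = BitVec.ofNat w v) :
    Does (w := w) P N (.arithI o r a n) e [] 2 (e.put r v) := by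
  intro s hs
  refine ⟨_, 2, .seq (.const 12 n s) (.arith o r a 12 _), le_rfl, ?_⟩
  have h1 : (s.set 12 (BitVec.ofNat w n)).reg a = BitVec.ofNat w (e.get a) := by
    simp [Control.set, Function.update_of_ne (show a ≠ 12 by omega), hs a ha.1 ha.2]
  have h2 : (s.set 12 (BitVec.ofNat w n)).reg 12 = BitVec.ofNat w n := by simp [Control.set]
  rw [h1, h2, hv]
  exact (hs.scratch le_rfl _).set hr v

theorem Does.addI (r a n : ℕ) (hr : r < 12 ∧ r ≠ 7 := by decide)
    (ha : a < N ∧ a < 12 := by decide) :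
    Does (w := w) P N (.arithI .add r a n) e [] 2 (e.put r (e.get a + n)) :=
  .arithI hr ha (BitVec.ofNat_add ..).symm

theorem Does.subI (r a n : ℕ) (h : n ≤ e.get a) (hr : r < 12 ∧ r ≠ 7 := by decide)
    (ha : a < N ∧ a < 12 := by decide) :
    Does (w := w) P N (.arithI .sub r a n) e [] 2 (e.put r (e.get a - n)) :=
  .arithI hr ha (ofNat_sub_ofNat' h)

theorem Does.mulI (r a n : ℕ) (hr : r < 12 ∧ r ≠ 7 := by decide)
    (ha : a < N ∧ a < 12 := by decide) :
    Does (w := w) P N (.arithI .mul r a n) e [] 2 (e.put r (e.get a * n)) :=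
  .arithI hr ha (BitVec.ofNat_mul ..).symm

theorem Does.halve (r a : ℕ) (h : e.get a < 2 ^ w) (hw : 1 < 2 ^ w)
    (hr : r < 12 ∧ r ≠ 7 := by decide) (ha : a < N ∧ a < 12 := by decide) :
    Does (w := w) P N (.arithI .shr r a 1) e [] 2 (e.put r (e.get a / 2)) := by
  refine .arithI hr ha (BitVec.eq_of_toNat_eq ?_)
  have h1 : e.get a / 2 < 2 ^ w := by omega
  simp [WordOp.eval, Nat.mod_eq_of_lt h, Nat.mod_eq_of_lt hw, Nat.mod_eq_of_lt h1,
    Nat.shiftRight_eq_div_pow]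

/-- Puts the power of two with the exponent in register `a` into register `r`. -/
def Cmd.powTwo (r a : ℕ) : Cmd := .seq (.const 12 1) (.arith .shl r 12 a)

theorem Does.powTwo (r a : ℕ) (h : e.get a < 2 ^ w) (hr : r < 12 ∧ r ≠ 7 := by decide)
    (ha : a < N ∧ a < 12 := by decide) :
    Does (w := w) P N (.powTwo r a) e [] 2 (e.put r (2 ^ e.get a)) := by
  intro s hs
  refine ⟨_, 2, .seq (.const 12 1 s) (.arith .shl r 12 a _), le_rfl, ?_⟩
  have h1 : (s.set 12 (BitVec.ofNat w 1)).reg a = BitVec.ofNat w (e.get a) := by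
    simp [Control.set, Function.update_of_ne (show a ≠ 12 by omega), hs a ha.1 ha.2]
  have h2 : (s.set 12 (BitVec.ofNat w 1)).reg 12 = BitVec.ofNat w 1 := by simp [Control.set]
  have h3 : WordOp.shl.eval (BitVec.ofNat w 1) (BitVec.ofNat w (e.get a)) =
      BitVec.ofNat w (2 ^ e.get a) := by
    apply BitVec.eq_of_toNat_eq
    simp [WordOp.eval, Nat.mod_eq_of_lt h, Nat.shiftLeft_eq, ← Nat.pow_mod]
  rw [h1, h2, h3]
  exact (hs.scratch le_rfl _).set hr _

theorem Does.ult (r a b : ℕ) (h : e.get a < 2 ^ w) (h' : e.get b < 2 ^ w)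
    (hr : r < 12 ∧ r ≠ 7 := by decide) (ha : a < N ∧ a < 12 := by decide)
    (hb : b < N ∧ b < 12 := by decide) :
    Does (w := w) P N (.arith .ult r a b) e [] 1
      (e.put r (if e.get a < e.get b then 1 else 0)) := by
  refine .arith hr ha hb ?_
  simp only [WordOp.eval, BitVec.toNat_ofNat, Nat.mod_eq_of_lt h, Nat.mod_eq_of_lt h']
  split <;> rfl

/-! ### Gates -/

/-- A gate whose operands are given by a register and an offset each. -/
inductive GateSpec : Type
  | op (o : WordOp) (a b c : ℕ × ℕ)
  | imm (v c : ℕ × ℕ)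
  | qL (a c : ℕ × ℕ)
  | qM (a c : ℕ × ℕ)

/-- The value of an operand. -/
def Regs.at (e : Regs) (a : ℕ × ℕ) : ℕ := e.get a.1 + a.2

/-- Puts the value of an operand into register `r`. -/
def Cmd.addr (r : ℕ) (a : ℕ × ℕ) : Cmd := .seq (.const r a.2) (.arith .add r a.1 r)

namespace GateSpec

/-- The command that applies the gate. -/
def cmd : GateSpec → Cmd
  | op o a b c => .seq (.addr 12 a) (.seq (.addr 13 b) (.seq (.addr 14 c) (.qarith o 12 13 14)))
  | imm v c => .seq (.addr 12 v) (.seq (.addr 13 c) (.qimm 12 13))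
  | qL a c => .seq (.addr 12 a) (.seq (.addr 13 c) (.qqueryL 12 13))
  | qM a c => .seq (.addr 12 a) (.seq (.addr 13 c) (.qqueryM 12 13))

/-- The gate that is applied. -/
def gate (e : Regs) : GateSpec → Gate w
  | op o a b c => gOp o (e.at a) (e.at b) (e.at c)
  | imm v c => gImm (e.at v) (e.at c)
  | qL a c => gL (e.at a) (e.at c)
  | qM a c => gM (e.at a) (e.at c)

/-- The registers used are among the first twelve. -/
def Ok : GateSpec → Prop
  | op _ a b c => a.1 < 12 ∧ b.1 < 12 ∧ c.1 < 12
  | imm v c => v.1 < 12 ∧ c.1 < 12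
  | qL a c => a.1 < 12 ∧ c.1 < 12
  | qM a c => a.1 < 12 ∧ c.1 < 12

end GateSpec

theorem exec_addr {s : Control w} (hs : e.Rep 12 s) {r : ℕ} (hr : 12 ≤ r) {a : ℕ × ℕ}
    (ha : a.1 < 12) :
    ∃ s' : Control w, Exec P (.addr r a) s [] 2 s' ∧ s'.reg r = BitVec.ofNat w (e.at a) ∧
      (∀ r', r' ≠ r → s'.reg r' = s.reg r') ∧ e.Rep 12 s' := by
  refine ⟨_, .seq (.const r a.2 s) (.arith .add r a.1 r _), ?_, fun r' h => ?_,
    (hs.scratch hr _).scratch hr _⟩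
  · have h1 : (s.set r (BitVec.ofNat w a.2)).reg a.1 = BitVec.ofNat w (e.get a.1) := by
      simp [Control.set, Function.update_of_ne (show a.1 ≠ r by omega), hs a.1 ha ha]
    have h2 : (s.set r (BitVec.ofNat w a.2)).reg r = BitVec.ofNat w a.2 := by simp [Control.set]
    rw [h1, h2]
    simp [Control.set, WordOp.eval, Regs.at, BitVec.ofNat_add]
  · simp [Control.set, Function.update_of_ne h]

/-- Two steps for each of at most three operand addresses, and one for the gate. -/
theorem Does.gate (g : GateSpec) (hg : g.Ok) : Does P 12 g.cmd e [g.gate (w := w) e] 7 e := by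
  intro s hs
  cases g with
  | op o a b c =>
    obtain ⟨ha, hb, hc⟩ := hg
    obtain ⟨s₁, x₁, a₁, -, r₁⟩ := exec_addr (P := P) hs (r := 12) (by omega) ha
    obtain ⟨s₂, x₂, a₂, k₂, r₂⟩ := exec_addr (P := P) r₁ (r := 13) (by omega) hb
    obtain ⟨s₃, x₃, a₃, k₃, r₃⟩ := exec_addr (P := P) r₂ (r := 14) (by omega) hc
    refine ⟨s₃, 7, ?_, le_rfl, r₃⟩
    have h := Exec.seq x₁ (.seq x₂ (.seq x₃ (.qarith o 12 13 14 s₃)))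
    rwa [k₃ 12 (by omega), k₂ 12 (by omega), k₃ 13 (by omega), a₁, a₂, a₃] at h
  | imm v c =>
    obtain ⟨ha, hb⟩ := hg
    obtain ⟨s₁, x₁, a₁, -, r₁⟩ := exec_addr (P := P) hs (r := 12) (by omega) ha
    obtain ⟨s₂, x₂, a₂, k₂, r₂⟩ := exec_addr (P := P) r₁ (r := 13) (by omega) hb
    refine ⟨s₂, 5, ?_, by omega, r₂⟩
    have h := Exec.seq x₁ (.seq x₂ (.qimm 12 13 s₂))
    rwa [k₂ 12 (by omega), a₁, a₂] at h
  | qL v c =>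
    obtain ⟨ha, hb⟩ := hg
    obtain ⟨s₁, x₁, a₁, -, r₁⟩ := exec_addr (P := P) hs (r := 12) (by omega) ha
    obtain ⟨s₂, x₂, a₂, k₂, r₂⟩ := exec_addr (P := P) r₁ (r := 13) (by omega) hb
    refine ⟨s₂, 5, ?_, by omega, r₂⟩
    have h := Exec.seq x₁ (.seq x₂ (.qqueryL 12 13 s₂))
    rwa [k₂ 12 (by omega), a₁, a₂] at h
  | qM v c =>
    obtain ⟨ha, hb⟩ := hg
    obtain ⟨s₁, x₁, a₁, -, r₁⟩ := exec_addr (P := P) hs (r := 12) (by omega) ha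
    obtain ⟨s₂, x₂, a₂, k₂, r₂⟩ := exec_addr (P := P) r₁ (r := 13) (by omega) hb
    refine ⟨s₂, 5, ?_, by omega, r₂⟩
    have h := Exec.seq x₁ (.seq x₂ (.qqueryM 12 13 s₂))
    rwa [k₂ 12 (by omega), a₁, a₂] at h

/-- The command that applies the gates of a list. -/
def Cmd.gates : List GateSpec → Cmd
  | [] => .skip
  | g :: L => .seq g.cmd (Cmd.gates L)

theorem Does.gates (L : List GateSpec) (hL : ∀ g ∈ L, g.Ok) :
    Does P 12 (.gates L) e (L.map (GateSpec.gate (w := w) e)) (7 * L.length + 1) e := by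
  induction L with
  | nil => exact .skip
  | cons g L ih =>
    refine ((Does.gate g (hL g (by simp))).seq (ih fun g' h => hL g' (by simp [h]))).of rfl ?_ rfl
    simp only [List.length_cons]
    omega

/-- Applies the Hadamard gate to the bit of word `a` whose number is in register `r`. -/
def Cmd.hadAt (a : ℕ × ℕ) (r : ℕ) : Cmd := .seq (.addr 12 a) (.qhad 12 r)

theorem Does.hadAt {a : ℕ × ℕ} {r : ℕ} (ha : a.1 < 12) (hr : r < 12) (h : e.get r < 2 ^ w) :
    Does P 12 (.hadAt a r) e [Gate.had (BitVec.ofNat w (e.at a)) (e.get r)] 3 e := by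
  intro s hs
  obtain ⟨s₁, x₁, a₁, -, r₁⟩ := exec_addr (P := P) hs (r := 12) (by omega) ha
  refine ⟨s₁, 3, ?_, le_rfl, r₁⟩
  have h1 := Exec.seq x₁ (.qhad 12 r s₁)
  rwa [a₁, r₁ r hr hr, BitVec.toNat_ofNat, Nat.mod_eq_of_lt h] at h1

/-- Applies Hadamard gates to as many bits of word `a` as the number in register `9` says. -/
def Cmd.hads (a : ℕ × ℕ) : Cmd := .loop 9 (.seq (.arithI .sub 9 9 1) (.hadAt a 9))

theorem Does.hads {a : ℕ × ℕ} (ha : a.1 < 12 ∧ a.1 ≠ 9) (h : e.n < 2 ^ w) :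
    Does P 12 (.hads a) e (hadLayer (BitVec.ofNat w (e.at a)) e.n) (6 * e.n + 1)
      { e with n := 0 } := by
  have hat : ∀ i, Regs.at { e with n := i } a = e.at a := fun i => by
    have := e.get_put (r := 9) (by decide) i ha.1
    rw [if_neg ha.2] at this
    exact congrArg (· + a.2) this
  refine Does.of (Does.loop (by decide) e.n (fun i => { e with n := i })
    (hadLayer (BitVec.ofNat w (e.at a))) (fun i => [Gate.had (BitVec.ofNat w (e.at a)) i]) rfl rfl
    (fun i hi => ⟨Nat.succ_ne_zero i, ?_⟩) (fun i hi => rfl) (T := 5) fun i hi => ?_) rfl le_rfl rfl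
  · show i + 1 < 2 ^ w
    omega
  · refine ((Does.subI 9 9 1 (by exact Nat.le_add_left 1 i)).seq (.hadAt ha.1 (by decide) ?_)).of ?_ le_rfl
      rfl
    · show i < 2 ^ w
      omega
    · show [] ++ [Gate.had (BitVec.ofNat w (Regs.at { e with n := i } a)) i] = _
      rw [hat, List.nil_append]

end programs

/-! ## The program -/

section blocks
variable {w T T' : ℕ} {P : Program} {c d : Cmd} {e e' e'' : Regs} {G : List (Gate w)}

theorem Regs.at_put (e : Regs) {r : ℕ} (hr : r < 12 ∧ r ≠ 7) (v : ℕ) {a : ℕ × ℕ}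
    (ha : a.1 < 12 ∧ a.1 ≠ r) : (e.put r v).at a = e.at a := by
  rw [Regs.at, e.get_put hr v ha.1, if_neg ha.2, Regs.at]

/-- The command for `xorBlock`. -/
def Cmd.xorBlock (c : Cmd) (a₁ c₁ a₂ c₂ : ℕ × ℕ) : Cmd :=
  .seq c (.seq (.gates [.op .or a₁ a₁ c₁, .op .or a₂ a₂ c₂]) (.adj c))

/-- Uncomputing executes the control of c a second time, from the registers left by the first run.
The second hypothesis asks that the same gates come out from there. -/
theorem Does.xorBlock {a₁ c₁ a₂ c₂ : ℕ × ℕ} (h : Does P 12 c e G T e')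
    (h' : Does P 12 c e' G T e'')
    (h₁ : a₁.1 < 12 ∧ c₁.1 < 12 := by simp) (h₂ : a₂.1 < 12 ∧ c₂.1 < 12 := by simp) :
    Does P 12 (.xorBlock c a₁ c₁ a₂ c₂) e
      (_root_.xorBlock G (BitVec.ofNat w (e'.at a₁)) (BitVec.ofNat w (e'.at c₁))
        (BitVec.ofNat w (e'.at a₂)) (BitVec.ofNat w (e'.at c₂))) (2 * T + 16) e'' := by
  refine (h.seq ((Does.gates _ ?_).seq h'.adj)).of ?_ ?_ rfl
  · simp [GateSpec.Ok, h₁, h₂]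
  · simp [_root_.xorBlock, GateSpec.gate, gOp]
  · simp only [List.length_cons, List.length_nil]
    omega

/-- The command for `signBlock`. -/
def Cmd.signBlock (c : Cmd) (t : ℕ × ℕ) : Cmd :=
  .seq c (.seq (.const 9 0) (.seq (.hadAt t 9) (.seq (.gates [.imm (7, 1) t])
    (.seq (.hadAt t 9) (.adj c)))))

theorem Does.signBlock {t : ℕ × ℕ} (h : Does P 12 c e G T e')
    (h' : Does P 12 c { e' with n := 0 } G T e'') (ht : t.1 < 12 ∧ t.1 ≠ 9 := by simp) :
    Does P 12 (.signBlock c t) e (_root_.signBlock G (BitVec.ofNat w (e'.at t))) (2 * T + 16)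
      e'' := by
  have h0 : Regs.at { e' with n := 0 } t = e'.at t := e'.at_put (r := 9) (by decide) 0 ht
  have hh : Does (w := w) P 12 (.hadAt t 9) { e' with n := 0 }
      [Gate.had (BitVec.ofNat w (e'.at t)) 0] 3 { e' with n := 0 } := by
    rw [← h0]
    exact Does.hadAt ht.1 (by decide) (by exact Nat.two_pow_pos w)
  refine (h.seq ((Does.const 9 0).seq (hh.seq ((Does.gates _ ?_).seq (hh.seq h'.adj))))).of ?_ ?_
    rfl
  · simp [GateSpec.Ok, ht.1]
  · simp [_root_.signBlock, GateSpec.gate, gImm, h0]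
    rfl
  · simp only [List.length_cons, List.length_nil]
    omega

variable (C B : ℕ)

/-- The layout given by the numbers in the registers. -/
def Regs.layout (e : Regs) : Layout := ⟨C, B, e.T, e.D, e.K⟩

/-- The command for `leafG`. -/
def leafCmd : Cmd :=
  .xorBlock (.gates [.op .sub (7, B + 2) (7, B + 3) (3, 1), .op .ult (3, 1) (7, C + 2) (3, 2),
    .op .ult (3, 0) (7, B + 3) (3, 3), .op .sub (7, B + 3) (7, C) (3, 4), .qL (3, 4) (3, 5),
    .qM (3, 1) (3, 6), .op .eq (3, 5) (3, 6) (3, 7), .op .and (3, 2) (3, 3) (3, 8),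
    .op .and (3, 7) (3, 8) (3, 9), .op .sub (3, 0) (3, 9) (3, 10),
    .op .and (3, 5) (3, 10) (3, 11)]) (3, 9) (7, B) (3, 11) (7, B + 1)

theorem does_leafCmd : Does P 12 (leafCmd C B) e (leafG (w := w) (e.layout C B)) 172 e := by
  refine (Does.xorBlock (Does.gates _ ?_) (Does.gates _ ?_)).of ?_ le_rfl rfl
  · simp [GateSpec.Ok]
  · simp [GateSpec.Ok]
  · simp [leafG, leafC, GateSpec.gate, Regs.at, Regs.get, Regs.layout]

/-- The command for `recordG`. -/
def recordCmd : Cmd :=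
  .xorBlock (.gates [.op .eq (6, 2) (3, 0) (3, 1), .op .sub (3, 0) (3, 1) (3, 2),
    .op .and (7, B + 1) (3, 2) (3, 3), .op .or (6, 2) (7, B) (3, 4),
    .op .or (6, 3) (3, 3) (3, 5)]) (3, 4) (6, 0) (3, 5) (6, 1)

theorem does_recordCmd :
    Does P 12 (recordCmd B) e (recordG (w := w) (e.layout C B) e.R) 88 e := by
  refine (Does.xorBlock (Does.gates _ ?_) (Does.gates _ ?_)).of ?_ le_rfl rfl
  · simp [GateSpec.Ok]
  · simp [GateSpec.Ok]
  · simp [recordG, recordC, GateSpec.gate, Regs.at, Regs.get, Regs.layout]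

/-- The command for `signG`. -/
def signCmd : Cmd :=
  .signBlock (.seq (.arithI .mul 8 2 4)
    (.gates [.op .ult (3, 0) (8, B + 1) (3, 1), .op .and (7, B) (3, 1) (3, 2)])) (3, 2)

theorem does_signCmd (C : ℕ) :
    Does P 12 (signCmd B) e (signG (w := w) (e.layout C B) e.k) 50
      { e with X := e.k * 4, n := 0 } := by
  have h : ∀ e : Regs, Does P 12 (.seq (.arithI .mul 8 2 4)
      (.gates [.op .ult (3, 0) (8, B + 1) (3, 1), .op .and (7, B) (3, 1) (3, 2)])) e
      (signC (w := w) (e.layout C B) e.k) 17 { e with X := e.k * 4 } := by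
    intro e
    refine ((Does.mulI 8 2 4).seq (Does.gates _ ?_)).of ?_ le_rfl rfl
    · simp [GateSpec.Ok]
    · simp [signC, GateSpec.gate, Regs.at, Regs.get, Regs.put, Regs.layout,
        show e.k * 4 + (B + 1) = B + 4 * e.k + 1 by omega]
  exact (Does.signBlock (h e) (h _)).of rfl le_rfl rfl

/-- The command for `zeroC`. -/
def zeroTest : Cmd :=
  .seq (.arithI .mul 9 2 4) (.seq (.arithI .add 9 9 2) (.seq (.arithI .add 11 3 0)
    (.seq (.const 10 B) (.seq (.loop 9 (.seq (.arithI .sub 9 9 1)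
      (.seq (.gates [.op .or (11, 0) (10, 0) (11, 1)])
        (.seq (.arithI .add 11 11 1) (.arithI .add 10 10 1)))))
      (.gates [.op .eq (11, 0) (3, 0) (11, 1)])))))

theorem does_zeroTest (h : 4 * e.k + 2 < 2 ^ w) :
    Does P 12 (zeroTest B) e (zeroC (w := w) (e.layout C B) e.k) (80 * (e.k + 1))
      { e with n := 0, p := B + (4 * e.k + 2), q := e.T + (4 * e.k + 2) } := by
  have hl := Does.loop (w := w) (P := P) (N := 12) (r := 9) (T := 15)
    (c := .seq (.arithI .sub 9 9 1) (.seq (.gates [.op .or (11, 0) (10, 0) (11, 1)])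
        (.seq (.arithI .add 11 11 1) (.arithI .add 10 10 1)))) (by decide)
    (4 * e.k + 2)
    (fun i => { e with
      n := i
      p := B + (4 * e.k + 2 - i)
      q := e.T + (4 * e.k + 2 - i) })
    (fun i => orG i (e.T + (4 * e.k + 2 - i)) (B + (4 * e.k + 2 - i)))
    (fun i => [gOp .or (e.T + (4 * e.k + 2 - (i + 1))) (B + (4 * e.k + 2 - (i + 1)))
      (e.T + (4 * e.k + 2 - i))]) rfl rfl
    (fun i hi => ⟨Nat.succ_ne_zero i, by show i + 1 < 2 ^ w; omega⟩)
    (fun i hi => by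
      have h1 : 4 * e.k + 2 - i = 4 * e.k + 2 - (i + 1) + 1 := by omega
      simp only [orG, h1, List.cons_append, List.nil_append, add_assoc])
    (fun i hi => by
      have h1 : 4 * e.k + 2 - i = 4 * e.k + 2 - (i + 1) + 1 := by omega
      refine ((Does.subI 9 9 1 (by exact Nat.le_add_left 1 i)).seq ((Does.gates _ ?_).seq
        ((Does.addI 11 11 1).seq (Does.addI 10 10 1)))).of ?_ ?_ ?_
      · simp [GateSpec.Ok]
      · simp [GateSpec.gate, Regs.at, Regs.get, Regs.put, h1, add_assoc]
      · simp
      · simp [Regs.get, Regs.put, h1, add_assoc])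
  refine ((Does.mulI 9 2 4).seq ((Does.addI 9 9 2).seq ((Does.addI 11 3 0).seq
    ((Does.const 10 B).seq (Does.seq (hl.from_eq ?_) (Does.gates _ ?_)))))).of ?_ ?_ ?_
  · simp [Regs.get, Regs.put, mul_comm]
  · simp [GateSpec.Ok]
  · simp [zeroC, GateSpec.gate, Regs.at, Regs.get, Regs.layout]
  · simp only [List.length_cons, List.length_nil]
    omega
  · simp

/-- The command for `zeroG`. -/
def zeroCmd : Cmd := .signBlock (zeroTest B) (11, 1)

theorem does_zeroCmd (h : 4 * e.k + 2 < 2 ^ w) :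
    Does P 12 (zeroCmd B) e (zeroG (w := w) (e.layout C B) e.k) (160 * (e.k + 1) + 16)
      { e with n := 0, p := B + (4 * e.k + 2), q := e.T + (4 * e.k + 2) } := by
  refine (Does.signBlock (does_zeroTest C B h) (does_zeroTest (e := Regs.mk ..) C B h)).of rfl ?_
    rfl
  omega

/-- The gates of `searchStep`. -/
def stepSpecs : List GateSpec :=
  [.imm (10, 0) (11, 1), .op .add (11, 0) (11, 1) (11, 2),
    .op .ult (7, C + 1) (11, 2) (11, 3), .op .ult (3, 2) (11, 2) (11, 4),
    .op .sub (3, 2) (11, 2) (11, 5), .op .ult (11, 5) (7, C + 2) (11, 6),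
    .op .sub (11, 2) (7, C) (11, 7), .qL (11, 7) (11, 8), .qM (11, 5) (11, 9),
    .op .slt (11, 9) (11, 8) (11, 10), .op .and (11, 6) (11, 10) (11, 11),
    .op .or (11, 3) (11, 4) (11, 12), .op .or (11, 11) (11, 12) (11, 13),
    .op .sub (11, 13) (7, C) (11, 14), .op .and (11, 1) (11, 14) (11, 15),
    .op .add (11, 0) (11, 15) (11, 16)]

/-- The command for `searchG`, with the number of steps in register `9`. -/
def binarySearch : Cmd :=
  .loop 9 (.seq (.arithI .sub 9 9 1) (.seq (.arithI .shr 10 10 1)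
    (.seq (.gates (stepSpecs C)) (.arithI .add 11 11 16))))

theorem does_binarySearch (hp : e.p = 2 ^ e.n) (h : e.n < w) :
    Does P 12 (binarySearch C) e (searchG (w := w) (e.layout C B) e.n e.q) (120 * e.n + 1)
      { e with n := 0, p := 1, q := e.q + 16 * e.n } := by
  have hlt : ∀ i < e.n, 2 ^ (i + 1) < 2 ^ w := fun i hi =>
    Nat.pow_lt_pow_right one_lt_two (by omega)
  have hl := Does.loop (w := w) (P := P) (N := 12) (r := 9) (T := 119)
    (c := .seq (.arithI .sub 9 9 1) (.seq (.arithI .shr 10 10 1)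
      (.seq (.gates (stepSpecs C)) (.arithI .add 11 11 16)))) (by decide) e.n
    (fun i => { e with
      n := i
      p := 2 ^ i
      q := e.q + 16 * (e.n - i) })
    (fun i => searchG (e.layout C B) i (e.q + 16 * (e.n - i)))
    (fun i => searchStep (e.layout C B) (2 ^ i) (e.q + 16 * (e.n - (i + 1)))) rfl rfl
    (fun i hi => ⟨Nat.succ_ne_zero i, (Nat.lt_two_pow_self).trans (hlt i hi)⟩)
    (fun i hi => by
      have h1 : 16 * (e.n - i) = 16 * (e.n - (i + 1)) + 16 := by omega
      simp only [searchG, h1, add_assoc])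
    (fun i hi => by
      have h1 : 16 * (e.n - i) = 16 * (e.n - (i + 1)) + 16 := by omega
      refine ((Does.subI 9 9 1 (by exact Nat.le_add_left 1 i)).seq ((Does.halve 10 10 (hlt i hi)
        (Nat.one_lt_two_pow (by omega))).seq ((Does.gates _ ?_).seq
          (Does.addI 11 11 16)))).of ?_ ?_ ?_
      · simp [stepSpecs, GateSpec.Ok]
      · simp [stepSpecs, searchStep, GateSpec.gate, Regs.at, Regs.get, Regs.put, Regs.layout,
          pow_succ]
      · simp [stepSpecs]
      · simp [Regs.get, Regs.put, h1, add_assoc, pow_succ])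
  refine (hl.from_eq ?_).of ?_ le_rfl ?_
  · simp [← hp]
  · simp
  · simp

/-- The command for `levelC`. -/
def levelPrep : Cmd :=
  .seq (.arithI .mul 9 2 5) (.seq (.arithI .sub 9 9 5) (.seq (.arithI .mul 8 2 4)
    (.seq (.gates [.imm (9, 0) (3, 0), .op .shl (8, B) (3, 0) (3, 1),
      .op .add (8, B + 2) (3, 1) (3, 2), .op .or (8, B + 3) (8, B + 3) (3, 3)])
      (.seq (.arithI .add 9 9 6) (.seq (.powTwo 10 9) (.seq (.arithI .add 11 3 3)
        (binarySearch C)))))))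

theorem does_levelPrep (hk : 1 ≤ e.k) (h : 5 * e.k + 1 < w) :
    Does P 12 (levelPrep C B) e (levelC (w := w) (e.layout C B) e.k) (600 * e.k + 164)
      { e with X := e.k * 4, n := 0, p := 1, q := e.T + 3 + 16 * (5 * e.k + 1) } := by
  have h1 : e.k * 5 - 5 + 6 = 5 * e.k + 1 := by omega
  have hs := does_binarySearch (w := w) (P := P) C B (e := { e with
      X := e.k * 4
      n := 5 * e.k + 1
      p := 2 ^ (5 * e.k + 1)
      q := e.T + 3 }) rfl h
  refine ((Does.mulI 9 2 5).seq ((Does.subI 9 9 5 ?_).seq ((Does.mulI 8 2 4).seq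
    ((Does.gates _ ?_).seq ((Does.addI 9 9 6).seq ((Does.powTwo 10 9 ?_).seq
      ((Does.addI 11 3 3).seq (hs.from_eq ?_)))))))).of ?_ ?_ rfl
  · show 5 ≤ e.k * 5
    omega
  · simp [GateSpec.Ok]
  · show e.k * 5 - 5 + 6 < 2 ^ w
    rw [h1]
    exact h.trans Nat.lt_two_pow_self
  · simp [Regs.get, Regs.put, h1]
  · simp [levelC, GateSpec.gate, Regs.at, Regs.get, Regs.put, Regs.layout, 
      show ∀ j, e.k * 4 + (B + j) = B + 4 * e.k + j by omega,
      show e.k * 4 + B = B + 4 * e.k by omega, mul_comm e.k 5]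
  · simp only [List.length_cons, List.length_nil]
    omega

/-- The command for `levelG`. -/
def levelCmd : Cmd := .xorBlock (levelPrep C B) (3, 2) (8, B - 2) (11, 0) (8, B - 1)

theorem does_levelCmd (hB : 2 ≤ B) (hk : 1 ≤ e.k) (h : 5 * e.k + 1 < w) :
    Does P 12 (levelCmd C B) e (levelG (w := w) (e.layout C B) e.k) (1200 * e.k + 344)
      { e with X := e.k * 4, n := 0, p := 1, q := e.T + 3 + 16 * (5 * e.k + 1) } := by
  refine (Does.xorBlock (does_levelPrep C B hk h)
    (does_levelPrep (e := Regs.mk ..) C B hk h)).of ?_ ?_ rfl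
  · simp [levelG, Regs.at, Regs.get, Regs.layout,
      show e.k * 4 + (B - 2) = B + 4 * e.k - 2 by omega,
      show e.k * 4 + (B - 1) = B + 4 * e.k - 1 by omega]
  · omega

/-- The Hadamard gates on the coin word. -/
def coinCmd : Cmd :=
  .seq (.arithI .mul 8 2 4) (.seq (.arith .sub 9 5 2) (.seq (.arith .ult 10 2 9)
    (.seq (.cond 10 (.arithI .add 9 2 0) .skip)
      (.seq (.arithI .add 9 9 4) (.hads (8, B + 1))))))

theorem does_coinCmd (hk : e.k ≤ e.D) (h : e.D + 4 < 2 ^ w) : ∃ p,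
    Does P 12 (coinCmd B) e (hadLayer (BitVec.ofNat w (B + 4 * e.k + 1)) (coinBits e.D e.k))
      (6 * e.k + 34) { e with X := e.k * 4, n := 0, p := p } := by
  have h1 : 1 < 2 ^ w := by omega
  have hu : (Regs.put (Regs.put e 8 (e.k * 4)) 9 (e.D - e.k)).get 9 = e.D - e.k := rfl
  have hsub : Does (w := w) P 12 (.arith .sub 9 5 2) (e.put 8 (e.k * 4)) [] 1
      ((e.put 8 (e.k * 4)).put 9 (e.D - e.k)) :=
    .arith (by decide) (by decide) (by decide) (ofNat_sub_ofNat' hk)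
  have hhads : ∀ n p, n < 2 ^ w → Does (w := w) P 12 (.hads (8, B + 1))
      { e with X := e.k * 4, n := n, p := p }
      (hadLayer (BitVec.ofNat w (B + 4 * e.k + 1)) n) (6 * n + 1)
      { e with X := e.k * 4, n := 0, p := p } := by
    intro n p hn
    refine (Does.hads (e := { e with X := e.k * 4, n := n, p := p }) (by simp) hn).of ?_ le_rfl rfl
    simp [Regs.at, Regs.get, show e.k * 4 + (B + 1) = B + 4 * e.k + 1 by omega]
  by_cases hlt : e.k < e.D - e.k
  · refine ⟨1, ((Does.mulI 8 2 4).seq (hsub.seq ((Does.ult 10 2 9 (by show e.k < 2 ^ w; omega)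
      (by show e.D - e.k < 2 ^ w; omega)).seq ((Does.cond_true (by decide) ?_ ?_
      (Does.addI 9 2 0)).seq ((Does.addI 9 9 4).seq
        ((hhads (e.k + 4) 1 (by omega)).from_eq ?_)))))).of ?_ ?_ rfl⟩
    · simp [Regs.get, Regs.put, hlt]
    · simpa [Regs.get, Regs.put, hlt] using h1
    · simp [Regs.get, Regs.put, hlt]
    · simp [coinBits, min_eq_left hlt.le]
    · omega
  · refine ⟨0, ((Does.mulI 8 2 4).seq (hsub.seq ((Does.ult 10 2 9 (by show e.k < 2 ^ w; omega)
      (by show e.D - e.k < 2 ^ w; omega)).seq ((Does.cond_false (by decide) ?_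
      Does.skip).seq ((Does.addI 9 9 4).seq
        ((hhads (e.D - e.k + 4) 0 (by omega)).from_eq ?_)))))).of ?_ ?_ rfl⟩
    · simp [Regs.get, Regs.put, hlt]
    · simp [Regs.get, Regs.put, hlt]
    · simp [coinBits, min_eq_right (not_lt.1 hlt)]
    · omega

/-- The Hadamard gates on the digit word. -/
def digitCmd : Cmd :=
  .seq (.arith .ult 10 4 2) (.seq (.const 9 5) (.seq (.cond 10 (.const 9 0) .skip) (.hads (8, B))))

theorem does_digitCmd (hX : e.X = e.k * 4) (hK : e.K < 2 ^ w) (hk : e.k < 2 ^ w)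
    (h5 : 5 < 2 ^ w) : ∃ p,
    Does P 12 (digitCmd B) e (hadLayer (BitVec.ofNat w (B + 4 * e.k)) (digitBits e.K e.k)) 35
      { e with n := 0, p := p } := by
  have hhads : ∀ n p, n < 2 ^ w → Does (w := w) P 12 (.hads (8, B)) { e with n := n, p := p }
      (hadLayer (BitVec.ofNat w (B + 4 * e.k)) n) (6 * n + 1) { e with n := 0, p := p } := by
    intro n p hn
    refine (Does.hads (e := { e with n := n, p := p }) (by simp) hn).of ?_ le_rfl rfl
    simp [Regs.at, Regs.get, hX, show e.k * 4 + B = B + 4 * e.k by omega]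
  by_cases hlt : e.K < e.k
  · refine ⟨1, ((Does.ult 10 4 2 hK hk).seq ((Does.const 9 5).seq ((Does.cond_true (by decide)
      ?_ ?_ (Does.const 9 0)).seq ((hhads 0 1 (by omega)).from_eq ?_)))).of ?_ ?_ rfl⟩
    · simp [Regs.get, Regs.put, hlt]
    · have h1 : 1 < 2 ^ w := by omega
      simpa [Regs.get, Regs.put, hlt] using h1
    · simp [Regs.get, Regs.put, hlt]
    · simp [digitBits, not_le.2 hlt]
    · omega
  · refine ⟨0, ((Does.ult 10 4 2 hK hk).seq ((Does.const 9 5).seq ((Does.cond_false (by decide)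
      ?_ Does.skip).seq ((hhads 5 0 (by omega)).from_eq ?_)))).of ?_ ?_ rfl⟩
    · simp [Regs.get, Regs.put, hlt]
    · simp [Regs.get, Regs.put, hlt]
    · simp [digitBits, not_lt.1 hlt]
    · omega

/-- The command for `chooseG`. -/
def chooseCmd : Cmd := .seq (coinCmd B) (.seq (digitCmd B) (levelCmd C B))

theorem does_chooseCmd (hB : 2 ≤ B) (hk : 1 ≤ e.k) (hkD : e.k ≤ e.D) (hK : e.K < 2 ^ w)
    (h : 5 * e.D + 1 < w) :
    Does P 12 (chooseCmd C B) e (chooseG (w := w) (e.layout C B) e.k) (2000 * e.k)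
      { e with X := e.k * 4, n := 0, p := 1, q := e.T + 3 + 16 * (5 * e.k + 1) } := by
  have hw := Nat.lt_two_pow_self (n := w)
  obtain ⟨p, h1⟩ := does_coinCmd (w := w) (P := P) B hkD (by omega)
  obtain ⟨p', h2⟩ := does_digitCmd (w := w) (P := P)
    (e := { e with X := e.k * 4, n := 0, p := p }) B rfl hK
    (by show e.k < 2 ^ w; omega) (by omega)
  refine (h1.seq (h2.seq (does_levelCmd (e := Regs.mk ..) C B hB hk ?_))).of rfl ?_ rfl
  · show 5 * e.k + 1 < w
    omega
  · show 6 * e.k + 34 + (35 + (1200 * e.k + 344)) ≤ 2000 * e.k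
    omega

/-- The part of a search that is repeated: a choice and the search of the level below. -/
def branchCmd : Cmd :=
  .seq (chooseCmd C B) (.seq (.arithI .sub 2 2 1) (.seq (.call 1) (.arithI .add 2 2 1)))

/-- The search of the level in register `2`. -/
def searchCmd : Cmd :=
  .cond 2 (.seq (branchCmd C B) (.seq (signCmd B) (.seq (.adj (branchCmd C B))
    (.seq (zeroCmd B) (branchCmd C B))))) (leafCmd C B)

/-- A bound for the time of a search. -/
def searchTime : ℕ → ℕ
  | 0 => 173
  | k + 1 => 3 * searchTime k + 6500 * (k + 1)

/-- The added linear term turns the recursion into exact multiplication by 3, and 5048 = 173 + 4875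
is its value at level 0. -/
theorem searchTime_le (k : ℕ) : searchTime k + 3250 * k + 4875 ≤ 5048 * 3 ^ k := by
  induction k with
  | zero => simp [searchTime]
  | succ k ih =>
    rw [searchTime, pow_succ]
    omega

/-- Only registers below 8 are tracked across calls: the recursion overwrites the temporaries, and
the level register is restored after each call. Without a stack, the same command can hence be run
three times in a round, once inverted. -/
theorem does_searchCmd (hP : P.getD 1 .skip = searchCmd C B) (hB : 2 ≤ B) (hK : e.K < 2 ^ w)
    (h : 5 * e.D + 1 < w) (k : ℕ) (hk : k ≤ e.D) :
    Does P 8 (searchCmd C B) { e with k := k } (searchLevelG (w := w) (e.layout C B) k)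
      (searchTime k) { e with k := k } := by
  have hw := Nat.lt_two_pow_self (n := w)
  induction k with
  | zero =>
    refine Does.cond_false (by decide) rfl (Does.of_temporaries fun X n p q => ⟨X, n, p, q, ?_⟩)
    exact does_leafCmd (e := Regs.mk ..) C B
  | succ k ih =>
    have hb : Does P 8 (branchCmd C B) { e with k := k + 1 }
        (chooseG (w := w) (e.layout C B) (k + 1) ++ searchLevelG (e.layout C B) k)
        (searchTime k + 2000 * (k + 1) + 5) { e with k := k + 1 } := by
      have h1 : Does P 8 (chooseCmd C B) { e with k := k + 1 }
          (chooseG (w := w) (e.layout C B) (k + 1)) (2000 * (k + 1)) { e with k := k + 1 } :=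
        Does.of_temporaries fun X n p q => ⟨_, _, _, _,
          does_chooseCmd (e := { e with k := k + 1, X := X, n := n, p := p, q := q }) C B hB
            (Nat.le_add_left 1 k) hk hK h⟩
      have h2 := Does.call (p := 1) (hP.symm ▸ ih (by omega))
      refine (h1.seq ((Does.subI 2 2 1 (by exact Nat.le_add_left 1 k)).seq
        ((h2.from_eq ?_).seq (Does.addI 2 2 1)))).of ?_ ?_ ?_
      · simp [Regs.get, Regs.put]
      · simp
      · omega
      · simp [Regs.get, Regs.put]
    have hs : Does P 8 (signCmd B) { e with k := k + 1 }
        (signG (w := w) (e.layout C B) (k + 1)) 50 { e with k := k + 1 } :=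
      Does.of_temporaries fun X n p q => ⟨_, _, _, _,
        does_signCmd (e := { e with k := k + 1, X := X, n := n, p := p, q := q }) B C⟩
    have hz : Does P 8 (zeroCmd B) { e with k := k + 1 }
        (zeroG (w := w) (e.layout C B) (k + 1)) (160 * (k + 1 + 1) + 16) { e with k := k + 1 } :=
      Does.of_temporaries fun X n p q => ⟨_, _, _, _,
        does_zeroCmd (e := { e with k := k + 1, X := X, n := n, p := p, q := q }) C B
          (by show 4 * (k + 1) + 2 < 2 ^ w; omega)⟩
    refine (Does.cond_true (by decide) (by exact Nat.succ_ne_zero k) (by show k + 1 < 2 ^ w; omega)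
      (hb.seq (hs.seq (hb.adj.seq (hz.seq hb))))).of ?_ ?_ rfl
    · simp [searchLevelG]
    · rw [searchTime]
      omega

/-- The command for `roundG`. -/
def roundCmd : Cmd :=
  .seq (.arithI .sub 6 6 2) (.seq (.call 1) (.seq (recordCmd B) (.seq (.adj (.call 1))
    (zeroCmd B))))

theorem does_roundCmd (hP : P.getD 1 .skip = searchCmd C B) (hB : 2 ≤ B) (hK : e.K < 2 ^ w)
    (h : 5 * e.D + 1 < w) (i : ℕ) :
    Does P 8 (roundCmd B) { e with k := e.D, R := 2 * (i + 1) }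
      (roundG (w := w) (e.layout C B) (2 * i)) (2 * searchTime e.D + 160 * e.D + 269)
      { e with k := e.D, R := 2 * i } := by
  have hw := Nat.lt_two_pow_self (n := w)
  have hc : Does P 8 (.call 1) { e with k := e.D, R := 2 * i }
      (searchLevelG (w := w) (e.layout C B) e.D) (searchTime e.D + 1)
      { e with k := e.D, R := 2 * i } :=
    Does.call (hP.symm ▸ does_searchCmd (e := { e with R := 2 * i }) C B hP hB hK h e.D le_rfl)
  have hr : Does P 8 (recordCmd B) { e with k := e.D, R := 2 * i }
      (recordG (w := w) (e.layout C B) (2 * i)) 88 { e with k := e.D, R := 2 * i } :=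
    Does.of_temporaries fun X n p q => ⟨_, _, _, _,
      does_recordCmd (e := { e with k := e.D, R := 2 * i, X := X, n := n, p := p, q := q }) C B⟩
  have hz : Does P 8 (zeroCmd B) { e with k := e.D, R := 2 * i }
      (zeroG (w := w) (e.layout C B) e.D) (160 * (e.D + 1) + 16)
      { e with k := e.D, R := 2 * i } :=
    Does.of_temporaries fun X n p q => ⟨_, _, _, _,
      does_zeroCmd (e := { e with k := e.D, R := 2 * i, X := X, n := n, p := p, q := q }) C B
        (by show 4 * e.D + 2 < 2 ^ w; omega)⟩
  refine ((Does.subI 6 6 2 ?_).seq ((hc.from_eq ?_).seq (hr.seq (hc.adj.seq hz)))).of ?_ ?_ rfl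
  · show 2 ≤ 2 * (i + 1)
    omega
  · simp [Regs.get, Regs.put, mul_add]
  · simp [roundG, Regs.layout]
  · omega

/-- Puts the least exponent for which the power of `b` is at least the number in register `9` into
register `r`, if this register is zero. -/
def powerCmd (b r : ℕ) : Cmd :=
  .seq (.const 11 1) (.seq (.arith .ult 10 11 9) (.loop 10
    (.seq (.arithI .mul 11 11 b) (.seq (.arithI .add r r 1) (.arith .ult 10 11 9)))))

theorem does_powerCmd {b r d : ℕ} (hb : 1 ≤ b) (hr : r = 4 ∨ r = 5) (h0 : e.get r = 0)
    (hd : e.n ≤ b ^ d) (hmin : ∀ i < d, b ^ i < e.n) (hn : e.n < 2 ^ w) (hw : b ^ d < 2 ^ w) :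
    Does (w := w) P 12 (powerCmd b r) e [] (6 * d + 3)
      { e.put r d with p := 0, q := b ^ d } := by
  have hlt : ∀ i ≤ d, b ^ i < 2 ^ w := fun i hi => (Nat.pow_le_pow_right hb hi).trans_lt hw
  have h1 : 1 < 2 ^ w ∨ d = 0 := by
    rcases Nat.eq_zero_or_pos d with h | h
    · exact .inr h
    · left
      have := hmin 0 h
      rw [pow_zero] at this
      omega
  have hl := Does.loop (w := w) (P := P) (N := 12) (r := 10) (T := 5)
    (c := .seq (.arithI .mul 11 11 b) (.seq (.arithI .add r r 1) (.arith .ult 10 11 9)))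
    (by decide) d
    (fun j => { e.put r (d - j) with
      p := if b ^ (d - j) < e.n then 1 else 0
      q := b ^ (d - j) })
    (fun _ => []) (fun _ => []) (by simpa [Regs.get] using hd) rfl
    (fun i hi => by
      have h2 : 1 < 2 ^ w := by omega
      simpa [Regs.get, hmin (d - (i + 1)) (by omega)] using h2)
    (fun _ _ => rfl)
    (fun i hi => by
      have h2 : b ^ (d - i) = b ^ (d - (i + 1)) * b := by
        rw [← pow_succ]; congr 1; omega
      have h3 : d - i = d - (i + 1) + 1 := by omega
      have h4 := hlt (d - i) (by omega)
      rcases hr with rfl | rfl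
      · refine ((Does.mulI 11 11 b).seq ((Does.addI 4 4 1).seq (Does.ult 10 11 9 ?_ ?_))).of rfl
          le_rfl ?_
        · simpa [Regs.get, Regs.put, ← h2] using h4
        · simpa [Regs.get, Regs.put] using hn
        · simp [Regs.get, Regs.put, h2, ← h3]
      · refine ((Does.mulI 11 11 b).seq ((Does.addI 5 5 1).seq (Does.ult 10 11 9 ?_ ?_))).of rfl
          le_rfl ?_
        · simpa [Regs.get, Regs.put, ← h2] using h4
        · simpa [Regs.get, Regs.put] using hn
        · simp [Regs.get, Regs.put, h2, ← h3])
  rcases hr with rfl | rfl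
  · refine ((Does.const 11 1).seq ((Does.ult 10 11 9 ?_ ?_).seq (hl.from_eq ?_))).of rfl ?_ ?_
    · simpa [Regs.get, Regs.put] using hlt 0 (Nat.zero_le d)
    · simpa [Regs.get, Regs.put] using hn
    · have : e.K = 0 := h0
      simp [Regs.get, Regs.put, this]
    · omega
    · simp [Regs.put, not_lt.2 hd]
  · refine ((Does.const 11 1).seq ((Does.ult 10 11 9 ?_ ?_).seq (hl.from_eq ?_))).of rfl ?_ ?_
    · simpa [Regs.get, Regs.put] using hlt 0 (Nat.zero_le d)
    · simpa [Regs.get, Regs.put] using hn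
    · have : e.D = 0 := h0
      simp [Regs.get, Regs.put, this]
    · omega
    · simp [Regs.put, not_lt.2 hd]

/-- The preparation of the registers. -/
def setupCmd (s : ℕ) : Cmd :=
  .seq (.arith .add 9 0 1) (.seq (powerCmd 9 5) (.seq (powerCmd 32 4) (.seq (.arithI .mul 3 5 4)
    (.seq (.arithI .add 3 3 (B + 4)) (.seq (.arithI .add 2 5 0) (.const 6 (2 * s)))))))

theorem does_setupCmd {l m D K s : ℕ} (hD : l + m ≤ 9 ^ D) (hD' : ∀ i < D, 9 ^ i < l + m)
    (hK : l + m ≤ 32 ^ K) (hK' : ∀ i < K, 32 ^ i < l + m) (hD2 : 9 ^ D < 2 ^ w)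
    (hK2 : 32 ^ K < 2 ^ w) :
    Does (w := w) P 12 (setupCmd B s) ⟨l, m, 0, 0, 0, 0, 0, 0, 0, 0, 0⟩ [] (6 * D + 6 * K + 14)
      ⟨l, m, D, D * 4 + (B + 4), K, D, 2 * s, 0, l + m, 0, 32 ^ K⟩ := by
  have hN : l + m < 2 ^ w := hD.trans_lt hD2
  have h0 : Does (w := w) P 12 (.arith .add 9 0 1) ⟨l, m, 0, 0, 0, 0, 0, 0, 0, 0, 0⟩ [] 1
      ⟨l, m, 0, 0, 0, 0, 0, 0, l + m, 0, 0⟩ :=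
    Does.arith (e := ⟨l, m, 0, 0, 0, 0, 0, 0, 0, 0, 0⟩) (r := 9) (by decide) (by decide)
      (by decide) (BitVec.ofNat_add ..).symm
  have h1 := does_powerCmd (w := w) (P := P) (e := ⟨l, m, 0, 0, 0, 0, 0, 0, l + m, 0, 0⟩)
    (b := 9) (by norm_num) (.inr rfl) rfl hD hD' hN hD2
  have h2 := does_powerCmd (w := w) (P := P) (e := ⟨l, m, 0, 0, 0, D, 0, 0, l + m, 0, 9 ^ D⟩)
    (b := 32) (by norm_num) (.inl rfl) rfl hK hK' hN hK2
  refine (h0.seq (h1.seq (h2.seq ((Does.mulI 3 5 4).seq ((Does.addI 3 3 (B + 4)).seq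
    ((Does.addI 2 5 0).seq (Does.const 6 (2 * s)))))))).of rfl ?_ rfl
  omega

/-- The main procedure. -/
def mainCmd (s : ℕ) : Cmd :=
  .seq (.seq (setupCmd B s) (.gates [.imm (7, 1) (7, C), .imm (0, 0) (7, C + 1),
    .imm (1, 0) (7, C + 2)])) (.loop 6 (roundCmd B))

theorem exec_mainCmd {l m D K s : ℕ} (hP : P.getD 1 .skip = searchCmd C B) (hB : 2 ≤ B)
    (h : 5 * D + 1 < w) (hKw : K < 2 ^ w) (hs : 2 * s < 2 ^ w) (hD : l + m ≤ 9 ^ D)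
    (hD' : ∀ i < D, 9 ^ i < l + m) (hK : l + m ≤ 32 ^ K) (hK' : ∀ i < K, 32 ^ i < l + m)
    (hD2 : 9 ^ D < 2 ^ w) (hK2 : 32 ^ K < 2 ^ w) :
    ∃ s' t, Exec P (mainCmd C B s) (Control.start w l m)
      (mainG ⟨C, B, D * 4 + (B + 4), D, K⟩ s l m) t s' ∧
      t ≤ 6 * D + 6 * K + 37 + (2 * searchTime D + 160 * D + 270) * s := by
  have hstart : (⟨l, m, 0, 0, 0, 0, 0, 0, 0, 0, 0⟩ : Regs).Rep 12 (Control.start w l m) := by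
    intro r _ hr
    interval_cases r <;> rfl
  obtain ⟨s₁, t₁, x₁, h₁, r₁⟩ := (does_setupCmd (P := P) B (s := s) hD hD' hK hK' hD2 hK2).seq
    (Does.gates [.imm (7, 1) (7, C), .imm (0, 0) (7, C + 1), .imm (1, 0) (7, C + 2)]
      (by simp [GateSpec.Ok])) _ hstart
  let e : Regs := ⟨l, m, D, D * 4 + (B + 4), K, D, 2 * s, 0, l + m, 0, 32 ^ K⟩
  have hl := Does.loop (w := w) (P := P) (N := 8) (r := 6) (c := roundCmd B) (by decide) s
    (fun i => { e with k := e.D, R := 2 * i }) (roundsG (e.layout C B))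
    (fun i => roundG (e.layout C B) (2 * i)) rfl rfl
    (fun i hi => ⟨by show 2 * (i + 1) ≠ 0; omega, by show 2 * (i + 1) < 2 ^ w; omega⟩)
    (fun i hi => rfl) (fun i _ => does_roundCmd (e := e) C B hP hB hKw h i)
  obtain ⟨s₂, t₂, x₂, h₂, -⟩ := hl s₁ (fun r hr hr' => r₁ r (by omega) hr')
  refine ⟨s₂, t₁ + t₂, ?_, ?_⟩
  · simpa [mainCmd, mainG, GateSpec.gate, Regs.at, Regs.get, Regs.layout, e] using Exec.seq x₁ x₂
  · simp only [List.length_cons, List.length_nil] at h₁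
    have h4 : e.D = D := rfl
    rw [h4] at h₂
    linarith

/-- The program, with as many rounds as `s` says. -/
def searchProgram (s : ℕ) : Program :=
  [mainCmd (2 * s + 2) (2 * s + 5) s, searchCmd (2 * s + 2) (2 * s + 5)]

end blocks

/-! ### Choice of the parameters and conclusion -/

/-- The least exponents of `9` and `32` for which the powers are at least `N`. -/
theorem exists_exponents {N : ℕ} (hN : 1 ≤ N) : ∃ D K : ℕ, N ≤ 9 ^ D ∧ (∀ i < D, 9 ^ i < N) ∧
    N ≤ 32 ^ K ∧ (∀ i < K, 32 ^ i < N) ∧ K ≤ D ∧ 9 ^ D ≤ 9 * 32 ^ K ∧ 32 ^ K ≤ 32 * 9 ^ D ∧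
    9 ^ D ≤ 9 * N := by
  have h9 : ∃ D, N ≤ 9 ^ D := ⟨N, (Nat.lt_pow_self (by norm_num)).le⟩
  have h32 : ∃ K, N ≤ 32 ^ K := ⟨N, (Nat.lt_pow_self (by norm_num)).le⟩
  have hD : N ≤ 9 ^ Nat.find h9 := Nat.find_spec h9
  have hK : N ≤ 32 ^ Nat.find h32 := Nat.find_spec h32
  have hD2 : ∀ i < Nat.find h9, 9 ^ i < N := fun i hi => not_le.1 (Nat.find_min h9 hi)
  have hK2 : ∀ i < Nat.find h32, 32 ^ i < N := fun i hi => not_le.1 (Nat.find_min h32 hi)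
  have hDN : 9 ^ Nat.find h9 ≤ 9 * N := by
    rcases Nat.eq_zero_or_pos (Nat.find h9) with h | h
    · rw [h]; omega
    · have h1 := hD2 (Nat.find h9 - 1) (by omega)
      rw [show Nat.find h9 = Nat.find h9 - 1 + 1 by omega, pow_succ]
      omega
  have hKN : 32 ^ Nat.find h32 ≤ 32 * N := by
    rcases Nat.eq_zero_or_pos (Nat.find h32) with h | h
    · rw [h]; omega
    · have h1 := hK2 (Nat.find h32 - 1) (by omega)
      rw [show Nat.find h32 = Nat.find h32 - 1 + 1 by omega, pow_succ]
      omega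
  refine ⟨_, _, hD, hD2, hK, hK2, Nat.find_min' h32 (hD.trans ?_), by omega, by omega, hDN⟩
  exact Nat.pow_le_pow_left (by norm_num) _

/-- The number of rounds depends only on the constant 1/16384, so one program serves all inputs.
With s = n + 1 rounds the records occupy words up to 2s + 1, just before the constants at 2s + 2.
The multiple κ of the bit length leaves room for the addresses and for numbers up to a multiple of
32^D. -/
theorem searchProgram_spec : ∃ (P : Program) (κ : ℕ) (C : ℝ), ∀ l m w : ℕ, 1 ≤ max l m →
    κ * (Nat.log 2 (max l m) + 1) ≤ w →
    ∃ (gs : List (Gate w)) (t : ℕ), P.RunsIn w l m gs t ∧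
      (t : ℝ) ≤ C * Real.sqrt (max l m : ℕ) ∧
      ∀ (L : Fin l → ℤ) (M : Fin m → ℤ), Monotone L → Monotone M →
        FitsIn w L → FitsIn w M → 2 / 3 ≤ circuitSuccess L M gs := by
  obtain ⟨n, hn⟩ := exists_rounds (c := 1 / 16384) (by norm_num) (by norm_num)
  refine ⟨searchProgram (n + 1), 2 * n + 150, 5 * (10096 * (n + 1) + 9000),
    fun l m w hlm hw => ?_⟩
  set x := max l m with hx
  have hl : l ≤ x := le_max_left l m
  have hm : m ≤ x := le_max_right l m
  have hxN : x ≤ l + m := max_le (Nat.le_add_right l m) (Nat.le_add_left m l)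
  set a := Nat.log 2 x + 1 with ha
  have hxa : x < 2 ^ a := Nat.lt_pow_succ_log_self (by norm_num) x
  have ha1 : 1 ≤ a := Nat.le_add_left 1 _
  obtain ⟨D, K, hD, hD2, hK, hK2, hKD, h1, h2, hDN⟩ := exists_exponents (hlm.trans hxN)
  -- Otherwise 9^a < l + m ≤ 2x < 2 · 2^a ≤ 4^a ≤ 9^a.
  have hDa : D ≤ a := by
    by_contra! hlt
    have h3 := hD2 a hlt
    have h4 : 2 ^ a * 2 ^ a ≤ 9 ^ a := by
      rw [← mul_pow]
      exact Nat.pow_le_pow_left (by norm_num) a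
    have h5 : 2 ≤ 2 ^ a := by
      calc 2 = 2 ^ 1 := rfl
        _ ≤ 2 ^ a := Nat.pow_le_pow_right (by norm_num) ha1
    nlinarith
  have hmul : 2 * n + 150 * a ≤ w := by nlinarith
  have h32 : 32 ^ D ≤ 2 ^ (5 * a) := by
    rw [show (32 : ℕ) = 2 ^ 5 by norm_num, ← pow_mul]
    exact Nat.pow_le_pow_right (by norm_num) (by omega)
  have h9 : 9 ^ D ≤ 32 ^ D := Nat.pow_le_pow_left (by norm_num) D
  have h32K : 32 ^ K ≤ 32 ^ D := Nat.pow_le_pow_right (by norm_num) hKD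
  have hbig : 4 * 2 ^ (5 * a) < 2 ^ w := by
    rw [show (4 : ℕ) = 2 ^ 2 by norm_num, ← pow_add]
    exact Nat.pow_lt_pow_right (by norm_num) (by omega)
  have hxa5 : x ≤ 2 ^ (5 * a) := hxa.le.trans (Nat.pow_le_pow_right (by norm_num) (by omega))
  have hww : w < 2 ^ w := Nat.lt_two_pow_self
  obtain ⟨s, t, hex, ht⟩ := exec_mainCmd (w := w) (P := searchProgram (n + 1)) (l := l) (m := m)
    (D := D) (K := K) (s := n + 1) (2 * (n + 1) + 2) (2 * (n + 1) + 5) rfl (by omega) (by omega)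
    (by omega) (by omega) hD hD2 hK hK2 (by omega) (by omega)
  refine ⟨_, t + 1, ⟨s, .call hex⟩, ?_, fun L M hL hM fL fM => ?_⟩
  · have h3 := searchTime_le D
    -- Each round runs the search and its inverse, at 5048 · 3^D steps each; 9000 covers the setup.
    have h4 : t + 1 ≤ (10096 * (n + 1) + 9000) * 3 ^ D := by nlinarith
    -- Minimality of D gives 9^D ≤ 9(l + m) ≤ 18x, and 25 is a convenient square above 18.
    have h5 : (3 : ℝ) ^ D ≤ 5 * Real.sqrt x := by
      rw [← Real.sqrt_sq (show (0 : ℝ) ≤ 5 by norm_num), ← Real.sqrt_mul (by positivity)]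
      apply Real.le_sqrt_of_sq_le
      rw [← pow_mul, mul_comm D, pow_mul]
      have h6 : 9 ^ D ≤ 25 * x := by omega
      norm_num
      exact_mod_cast h6
    calc ((t + 1 : ℕ) : ℝ) ≤ ((10096 * (n + 1) + 9000) * 3 ^ D : ℕ) := by exact_mod_cast h4
      _ = (10096 * (n + 1) + 9000) * (3 : ℝ) ^ D := by push_cast; ring
      _ ≤ (10096 * (n + 1) + 9000) * (5 * Real.sqrt x) := by gcongr
      _ = _ := by ring
  · refine circuitSuccess_mainG ⟨?_, ?_, ?_, ?_, ?_⟩ hL hM fL fM ?_ hKD h1 h2 hK hn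
    all_goals dsimp only
    all_goals omega

theorem mainTheorem3 :
    -- one program solves the problem with error at most 1/3 in time `O(√l)`
    (∃ (P : Program) (κ : ℕ) (C : ℝ), ∀ l m w : ℕ, 1 ≤ max l m →
      κ * (Nat.log 2 (max l m) + 1) ≤ w →
      ∃ (gs : List (Gate w)) (t : ℕ), P.RunsIn w l m gs t ∧
        (t : ℝ) ≤ C * Real.sqrt (max l m : ℕ) ∧
        ∀ (L : Fin l → ℤ) (M : Fin m → ℤ), Monotone L → Monotone M →
          FitsIn w L → FitsIn w M → 2 / 3 ≤ circuitSuccess L M gs) ∧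
    -- optimality: `Ω(√l)` queries are necessary, for algorithms with arbitrary unitaries,
    (∃ c : ℝ, 0 < c ∧ ∀ (l d : ℕ) (A : QueryAlgorithm l l d), 2 * l ≤ d →
      (∀ L M : Fin l → Fin d, StrictMono L → StrictMono M → 2 / 3 ≤ A.success L M) →
      c * Real.sqrt l ≤ A.queries) ∧
    -- and time `Ω(√l)` is necessary in the time model of the first part
    (∃ c : ℝ, 0 < c ∧ ∀ (P : Program) (l w : ℕ) (gs : List (Gate w)) (t : ℕ),
      Nat.log 2 l + 3 ≤ w → P.RunsIn w l l gs t →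
      (∀ L M : Fin l → ℤ, StrictMono L → StrictMono M → FitsIn w L → FitsIn w M →
        2 / 3 ≤ circuitSuccess L M gs) →
      c * Real.sqrt l ≤ t) ∧
    -- `√l` is asymptotically smaller than `√l * c ^ log* l`
    (∀ c : ℝ, 1 < c → (fun l : ℕ => Real.sqrt l) =o[atTop]
      (fun l : ℕ => Real.sqrt l * c ^ logStar l)) := by
  refine ⟨searchProgram_spec, ⟨1 / 10, by norm_num, fun l d A hd h => query_lower_bound l d A hd h⟩,
    ⟨1 / 10, by norm_num, fun P l w gs t hw hrun h => ?_⟩,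
    fun c hc => sqrt_isLittleO_sqrt_mul_pow_logStar c hc⟩
  obtain ⟨s, hs⟩ := hrun
  exact (circuit_lower_bound gs hw h).trans (by exact_mod_cast hs.length_le)
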